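/- Let $d\ge 2$, and let $\mathbb M$ be the Euclidean space $\mathbb E^d$ or the hyperbolic space $\mathbb H^d$ (of curvature $-1$). For a point $c\in\mathbb M$ and an integer $k$ with $1\le k\le d/2$, let $\mathcal Q_k(c)$ denote the family of all polytopes $Q=\mathrm{conv}(S_1\cup S_2)\subset\mathbb M$, where $S_1$ and $S_2$ are regular simplices with $\dim S_1=k$ and $\dim S_2=d-k$, both centred at $c$ and contained in subspaces of $\mathbb M$ that meet at $c$ and are orthogonal there. Let $B\subset\mathbb M$ be a closed ball with centre $c$ and positive radius. Call $Q$ a *$k$-minimiser for $B$* if $Q\in\mathcal Q_k(c)$, $B\subseteq Q$, and $\mathrm{vol}_d(Q)\le \mathrm{vol}_d(P)$ for every convex polytope $P\subset\mathbb M$ with at most $d+2$ vertices that contains $B$. 1. For every ball $B\subset\mathbb M$ there is an integer $1\le k\le d/2$ such that for every convex polytope $P\subset\mathbb M$ with at most $d+2$ vertices and $B\subseteq P$ there is a polytope $Q\in\mathcal Q_k(c)$ with $B\subseteq Q$ and $\mathrm{vol}_d(P)\ge \mathrm{vol}_d(Q)$. 2. For every ball $B\subset\mathbb E^d$ there is a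 $k$-minimiser for $B$ for some $1\le k\le d/2$; and whenever $Q$ is a $k$-minimiser for $B$ with $1\le k\le d/2$, then $k=\lfloor d/2\rfloor$, or $d=4$ and $k=1$. 3. There is an $\varepsilon>0$, depending only on $d$, such that the assertion of 2 also holds for every ball $B\subset\mathbb H^d$ of radius at most $\varepsilon$. -/

import Mathlib

open scoped RealInnerProductSpace
open MeasureTheory

noncomputable section

/-- `P` is a convex polytope with at most `n` vertices, i.e. the convex hull of at most `n` points.
In the projective ball model of hyperbolic space the geodesic segments are the Euclidean ones, so
this is also the notion of a hyperbolic polytope, for sets contained in the model. -/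
def IsPolytopeWithAtMost {d : ℕ} (n : ℕ) (P : Set (EuclideanSpace ℝ (Fin d))) : Prop :=
  ∃ t : Finset (EuclideanSpace ℝ (Fin d)), t.card ≤ n ∧ P = convexHull ℝ (t : Set _)

/-! ### Euclidean space -/

/-- `Q = conv (S₁ ∪ S₂)`, where `S₁`, `S₂` are regular simplices with centre `c`, of dimensions
`k` and `d - k`, lying in orthogonal affine subspaces (which both contain `c`). -/
def IsOrthogonalSimplexHull {d : ℕ} (c : EuclideanSpace ℝ (Fin d)) (k : ℕ)
    (Q : Set (EuclideanSpace ℝ (Fin d))) : Prop :=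
  ∃ (S₁ : Affine.Simplex ℝ (EuclideanSpace ℝ (Fin d)) k)
    (S₂ : Affine.Simplex ℝ (EuclideanSpace ℝ (Fin d)) (d - k)),
    S₁.Equilateral ∧ S₂.Equilateral ∧ S₁.centroid = c ∧ S₂.centroid = c ∧
    (affineSpan ℝ (Set.range S₁.points)).direction ⟂
      (affineSpan ℝ (Set.range S₂.points)).direction ∧
    Q = convexHull ℝ (S₁.closedInterior ∪ S₂.closedInterior)

/-- `Q` is the convex hull of two regular simplices of dimensions `k` and `d - k`,
`1 ≤ k ≤ d / 2`, centred at `c` and lying in orthogonal subspaces; `Q` contains the ball of radius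
`r` about `c`, and its volume is least among all polytopes with at most `d + 2` vertices containing
that ball. -/
def IsEuclideanMinimizer {d : ℕ} (c : EuclideanSpace ℝ (Fin d)) (r : ℝ) (k : ℕ)
    (Q : Set (EuclideanSpace ℝ (Fin d))) : Prop :=
  1 ≤ k ∧ 2 * k ≤ d ∧ IsOrthogonalSimplexHull c k Q ∧ Metric.closedBall c r ⊆ Q ∧
    ∀ P : Set (EuclideanSpace ℝ (Fin d)), IsPolytopeWithAtMost (d + 2) P →
      Metric.closedBall c r ⊆ P → volume Q ≤ volume P

/-! ### Hyperbolic space: the projective (Beltrami–Klein) ball model -/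

/-- The points of hyperbolic `d`-space of curvature `-1`: the open unit ball. -/
def kleinBall (d : ℕ) : Set (EuclideanSpace ℝ (Fin d)) := Metric.ball 0 1

/-- The hyperbolic distance of two points of the model. -/
def hypDist {d : ℕ} (x y : EuclideanSpace ℝ (Fin d)) : ℝ :=
  Real.arcosh ((1 - ⟪x, y⟫) / (√(1 - ‖x‖ ^ 2) * √(1 - ‖y‖ ^ 2)))

/-- The Riemannian metric tensor of the model at the point `c`. -/
def hypMetric {d : ℕ} (c u v : EuclideanSpace ℝ (Fin d)) : ℝ :=
  ⟪u, v⟫ / (1 - ‖c‖ ^ 2) + ⟪c, u⟫ * ⟪c, v⟫ / (1 - ‖c‖ ^ 2) ^ 2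

/-- The hyperbolic volume. The density `(1 - ‖x‖²) ^ (-(d + 1) / 2)` is the square root of the
determinant of the metric tensor at `x`. -/
def hypVolume (d : ℕ) : Measure (EuclideanSpace ℝ (Fin d)) :=
  (volume.restrict (kleinBall d)).withDensity
    fun x => ENNReal.ofReal ((1 - ‖x‖ ^ 2) ^ (-(((d : ℝ) + 1) / 2)))

/-- The closed hyperbolic ball of radius `r` about `c`. -/
def hypClosedBall {d : ℕ} (c : EuclideanSpace ℝ (Fin d)) (r : ℝ) :
    Set (EuclideanSpace ℝ (Fin d)) :=
  {x | x ∈ kleinBall d ∧ hypDist c x ≤ r}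

/-- The simplex `S` is contained in hyperbolic space and regular there (all edges have the same
hyperbolic length), and its hyperbolic centre is `c`: the point `c` belongs to the subspace spanned
by `S` and has the same distance from all vertices. Hyperbolic subspaces are the intersections of
affine subspaces with the model. -/
def IsHypRegularSimplex {d m : ℕ} (c : EuclideanSpace ℝ (Fin d))
    (S : Affine.Simplex ℝ (EuclideanSpace ℝ (Fin d)) m) : Prop :=
  (∀ i, S.points i ∈ kleinBall d) ∧
  (∃ a : ℝ, ∀ i j, i ≠ j → hypDist (S.points i) (S.points j) = a) ∧
  c ∈ affineSpan ℝ (Set.range S.points) ∧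
  (∃ b : ℝ, ∀ i, hypDist c (S.points i) = b)

/-- `Q = conv (S₁ ∪ S₂)`, where `S₁`, `S₂` are regular hyperbolic simplices with centre `c`, of
dimensions `k` and `d - k`, lying in subspaces which are orthogonal at `c`. -/
def IsHypOrthogonalSimplexHull {d : ℕ} (c : EuclideanSpace ℝ (Fin d)) (k : ℕ)
    (Q : Set (EuclideanSpace ℝ (Fin d))) : Prop :=
  ∃ (S₁ : Affine.Simplex ℝ (EuclideanSpace ℝ (Fin d)) k)
    (S₂ : Affine.Simplex ℝ (EuclideanSpace ℝ (Fin d)) (d - k)),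
    IsHypRegularSimplex c S₁ ∧ IsHypRegularSimplex c S₂ ∧
    (∀ u ∈ (affineSpan ℝ (Set.range S₁.points)).direction,
      ∀ v ∈ (affineSpan ℝ (Set.range S₂.points)).direction, hypMetric c u v = 0) ∧
    Q = convexHull ℝ (S₁.closedInterior ∪ S₂.closedInterior)

/-- The hyperbolic counterpart of `IsEuclideanMinimizer`. -/
def IsHypMinimizer {d : ℕ} (c : EuclideanSpace ℝ (Fin d)) (r : ℝ) (k : ℕ)
    (Q : Set (EuclideanSpace ℝ (Fin d))) : Prop :=
  1 ≤ k ∧ 2 * k ≤ d ∧ IsHypOrthogonalSimplexHull c k Q ∧ hypClosedBall c r ⊆ Q ∧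
    ∀ P : Set (EuclideanSpace ℝ (Fin d)), IsPolytopeWithAtMost (d + 2) P → P ⊆ kleinBall d →
      hypClosedBall c r ⊆ P → hypVolume d Q ≤ hypVolume d P

end

/-! Everything is proved for measures whose density is an increasing function of the distance from
the origin. The constant density gives the Euclidean case. In the projective model centred at the
centre of the ball, hyperbolic volume is of this kind too, so one symmetrization argument serves
both geometries.

A polytope with at most `d + 2` vertices that contains a centred ball has a Radon partition of its
(possibly padded) vertex list into `k + 1` and `d - k + 1` points (`exists_isRadonDependency`). Take
an edge joining two points of the same class and symmetrize: its ends become symmetric about the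
hyperplane through the origin orthogonal to it, and all other vertices are projected to that
hyperplane. This does not increase the measure (`radialMeasure_steiner_le`). Because the affine
dependency is unique up to a factor and has equal signs at the two ends, the ball stays inside
(`closedBall_subset_convexHull_steiner`). The sum of the squared norms of the vertices drops unless
nothing moves. Minimising this sum on a compact set of configurations yields one that is fixed by
all these symmetrizations (`exists_symmetric_configuration`). Such a configuration consists of two
regular simplices centred at the origin in orthogonal subspaces (`isOrthoFrame_of_symmetric`).

For such a pair with circumradii `r` and `t`, the Euclidean volume and the inradius are explicit
(`IsOrthoFrame.volume_eq`, `IsOrthoFrame.radius_bound`). The inequality of arithmetic and geometric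
means gives the best radii. The optimal value depends on `k` only through `(k + 1) ^ (k + 1) * (d -
k + 1) ^ (d - k + 1)`, and strict convexity of `x log x` makes it least exactly at `k = d / 2`. So
the alternative `d = 4`, `k = 1` never occurs.

In hyperbolic space the isometric involution `kleinInvolution c` moves `c` to the origin. It maps
segments to segments and preserves distance and volume. A dominating type `k` for all radii then
follows from symmetrization and a finite minimum (`exists_hyp_dominating_type`). For small balls the
hyperbolic volume of the optimal Euclidean body of type `d / 2` exceeds its Euclidean volume by a
factor close to `1`, while all other types, and bodies of type `d / 2` with a large circumradius,
are larger already in Euclidean volume (`IsSmallRadius.hyp_minimizers`). -/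

set_option linter.unusedSectionVars false

/-! ### Convex hulls of finite families and their dependence on the vertices -/

section ConvexHullRange

variable {E ι : Type*} [NormedAddCommGroup E] [InnerProductSpace ℝ E] [Fintype ι]

theorem mem_convexHull_range_iff_exists_stdSimplex {v : ι → E} {x : E} :
    x ∈ convexHull ℝ (Set.range v) ↔ ∃ c ∈ stdSimplex ℝ ι, ∑ i, c i • v i = x := by
  classical
  have h : Set.range v = Fintype.linearCombination ℝ v '' (Set.range fun i : ι ↦ Pi.single i 1) := by
    ext y
    simp [Set.mem_range, Fintype.linearCombination_apply_single]
  have h1 : convexHull ℝ (Set.range v) = Fintype.linearCombination ℝ v '' stdSimplex ℝ ι := by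
    rw [h, ← (Fintype.linearCombination ℝ v).image_convexHull,
      ← convexHull_rangle_single_eq_stdSimplex ℝ ι]
  rw [h1]
  simp [Fintype.linearCombination_apply]

theorem isCompact_convexHull_range (v : ι → E) : IsCompact (convexHull ℝ (Set.range v)) :=
  (Set.finite_range v).isCompact_convexHull ℝ

/-- Membership in the convex hull of finitely many points in terms of its support function. -/
theorem mem_convexHull_range_iff_forall_exists_inner_le {v : ι → E} {x : E} :
    x ∈ convexHull ℝ (Set.range v) ↔ ∀ u : E, ∃ i, ⟪u, x⟫ ≤ ⟪u, v i⟫ := by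
  constructor
  · intro hx u
    obtain ⟨c, hc, rfl⟩ := mem_convexHull_range_iff_exists_stdSimplex.1 hx
    by_contra! hlt
    set y := ∑ i, c i • v i with hy
    have h1 : ⟪u, y⟫ = ∑ i, c i * ⟪u, v i⟫ := by
      simp [hy, inner_sum, inner_smul_right]
    have h2 : ⟪u, y⟫ = ∑ i, c i * ⟪u, y⟫ := by rw [← Finset.sum_mul, hc.2, one_mul]
    have h3 : ∃ i, 0 < c i := by
      by_contra! h
      have : ∑ i, c i ≤ 0 := Finset.sum_nonpos fun i _ => h i
      linarith [hc.2]
    obtain ⟨i, hi⟩ := h3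
    have : ∑ i, c i * ⟪u, v i⟫ < ∑ i, c i * ⟪u, y⟫ :=
      Finset.sum_lt_sum (fun j _ => mul_le_mul_of_nonneg_left (hlt j).le (hc.1 j))
        ⟨i, Finset.mem_univ _, mul_lt_mul_of_pos_left (hlt i) hi⟩
    linarith
  · intro h
    by_contra hx
    by_cases hι : IsEmpty ι
    · exact (h 0).elim fun i => isEmptyElim i
    -- For `y` the point of the hull nearest to `x`, the direction `x - y` strictly separates `x`
    -- from all vertices.
    obtain ⟨y, hy, hmin⟩ := exists_norm_eq_iInf_of_complete_convex
      (K := convexHull ℝ (Set.range v)) ((Set.range_nonempty_iff_nonempty.2 (not_isEmpty_iff.1 hι)).convexHull)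
      (isCompact_convexHull_range v).isComplete (convex_convexHull ℝ _) x
    rw [norm_eq_iInf_iff_real_inner_le_zero (convex_convexHull ℝ _) hy] at hmin
    obtain ⟨i, hi⟩ := h (x - y)
    have h1 := hmin (v i) (subset_convexHull ℝ _ ⟨i, rfl⟩)
    have h2 : 0 < ⟪x - y, x - y⟫ := by
      rw [real_inner_self_eq_norm_sq]
      have : x - y ≠ 0 := sub_ne_zero.2 fun h => hx (h ▸ hy)
      positivity
    rw [inner_sub_right] at h1 h2
    linarith

/-- For each direction, the support function criterion is a finite union of closed conditions on the
vertices. -/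
theorem isClosed_setOf_mem_convexHull_range (x : E) :
    IsClosed {v : ι → E | x ∈ convexHull ℝ (Set.range v)} := by
  have : {v : ι → E | x ∈ convexHull ℝ (Set.range v)} =
      ⋂ u : E, ⋃ i, {v : ι → E | ⟪u, x⟫ ≤ ⟪u, v i⟫} := by
    ext v
    simp [mem_convexHull_range_iff_forall_exists_inner_le]
  rw [this]
  refine isClosed_iInter fun u => isClosed_iUnion_of_finite fun i => ?_
  exact isClosed_le continuous_const (by fun_prop)

/-- A ball of radius `δ` around `x` in the hull leaves slack in every direction `u`: moving all
vertices by less than `δ / 2` lowers the support function by at most `‖u‖ * (δ / 2)`. -/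
theorem eventually_mem_convexHull_range {v : ι → E} {x : E}
    (hx : x ∈ interior (convexHull ℝ (Set.range v))) :
    ∀ᶠ w in nhds v, x ∈ convexHull ℝ (Set.range w) := by
  obtain ⟨δ, hδ, hball⟩ := Metric.mem_nhds_iff.1 (mem_interior_iff_mem_nhds.1 hx)
  filter_upwards [Metric.ball_mem_nhds v (half_pos hδ)] with w hw
  rw [mem_convexHull_range_iff_forall_exists_inner_le]
  intro u
  rcases eq_or_ne u 0 with rfl | hu
  · have hx' := (mem_convexHull_range_iff_forall_exists_inner_le.1 (interior_subset hx)) 0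
    simpa using hx'
  have hu' : 0 < ‖u‖ := norm_pos_iff.2 hu
  have hy : x + (δ / 2 / ‖u‖) • u ∈ convexHull ℝ (Set.range v) := by
    apply hball
    rw [Metric.mem_ball, dist_eq_norm, add_sub_cancel_left, norm_smul, Real.norm_of_nonneg (by positivity),
      div_mul_cancel₀ _ hu'.ne']
    linarith
  obtain ⟨i, hi⟩ := mem_convexHull_range_iff_forall_exists_inner_le.1 hy u
  refine ⟨i, ?_⟩
  rw [inner_add_right, inner_smul_right, real_inner_self_eq_norm_sq] at hi
  have h1 : ⟪u, v i - w i⟫ ≤ ‖u‖ * ‖v i - w i‖ := real_inner_le_norm _ _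
  have h2 : ‖v i - w i‖ ≤ δ / 2 := by
    have := dist_le_pi_dist v w i
    rw [dist_eq_norm] at this
    rw [Metric.mem_ball, dist_comm] at hw
    linarith
  rw [inner_sub_right] at h1
  have h3 : δ / 2 / ‖u‖ * ‖u‖ ^ 2 = ‖u‖ * (δ / 2) := by field_simp
  nlinarith

end ConvexHullRange

/-! ### Measures with radial density and lower semicontinuity -/

section RadialMeasure

variable {E : Type*} [NormedAddCommGroup E] [InnerProductSpace ℝ E] [FiniteDimensional ℝ E]
  [MeasurableSpace E] [BorelSpace E]

/-- The measure with density `f ‖x‖` with respect to the Lebesgue measure. -/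
noncomputable def radialMeasure (E : Type*) [NormedAddCommGroup E] [InnerProductSpace ℝ E]
    [FiniteDimensional ℝ E] [MeasurableSpace E] [BorelSpace E] (f : ℝ → ENNReal) : Measure E :=
  volume.withDensity fun x => f ‖x‖

/-- Fatou's lemma for indicator functions: an interior point of the limit lies in all late hulls,
and the frontier of a convex set is null. The density may take the value `⊤`. -/
theorem radialMeasure_convexHull_le_liminf {ι : Type*} [Fintype ι] (f : ℝ → ENNReal)
    {v : ι → E} {w : ℕ → ι → E} (hw : Filter.Tendsto w Filter.atTop (nhds v)) :
    radialMeasure E f (convexHull ℝ (Set.range v)) ≤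
      Filter.liminf (fun n => radialMeasure E f (convexHull ℝ (Set.range (w n)))) Filter.atTop := by
  set μ := radialMeasure E f
  have hac : μ ≪ volume := withDensity_absolutelyContinuous _ _
  have hmeas : ∀ u : ι → E, MeasurableSet (convexHull ℝ (Set.range u)) := fun u =>
    (isCompact_convexHull_range u).isClosed.measurableSet
  have hint : μ (convexHull ℝ (Set.range v)) ≤ μ (interior (convexHull ℝ (Set.range v))) := by
    have h0 : μ (frontier (convexHull ℝ (Set.range v))) = 0 :=
      hac ((convex_convexHull ℝ _).addHaar_frontier _)
    have hsub : convexHull ℝ (Set.range v) ⊆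
        interior (convexHull ℝ (Set.range v)) ∪ frontier (convexHull ℝ (Set.range v)) := by
      rw [← closure_eq_interior_union_frontier]
      exact subset_closure
    calc _ ≤ _ := measure_mono hsub
      _ ≤ _ := measure_union_le _ _
      _ = _ := by rw [h0, add_zero]
  refine hint.trans ?_
  rw [← lintegral_indicator_one isOpen_interior.measurableSet]
  calc _ ≤ ∫⁻ x, Filter.liminf (fun n => (convexHull ℝ (Set.range (w n))).indicator
          (1 : E → ENNReal) x) Filter.atTop ∂μ := by
        refine lintegral_mono fun x => ?_
        by_cases hx : x ∈ interior (convexHull ℝ (Set.range v))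
        · have := hw.eventually (eventually_mem_convexHull_range hx)
          rw [Set.indicator_of_mem hx]
          refine Filter.le_liminf_of_le (by isBoundedDefault) ?_
          filter_upwards [this] with n hn
          rw [Set.indicator_of_mem hn]
        · simp [Set.indicator_of_notMem hx]
    _ ≤ Filter.liminf (fun n => ∫⁻ x, (convexHull ℝ (Set.range (w n))).indicator
          (1 : E → ENNReal) x ∂μ) Filter.atTop :=
        lintegral_liminf_le fun n => measurable_one.indicator (hmeas _)
    _ = _ := by simp_rw [lintegral_indicator_one (hmeas _)]

theorem lowerSemicontinuous_radialMeasure_convexHull {ι : Type*} [Fintype ι] (f : ℝ → ENNReal) :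
    LowerSemicontinuous fun v : ι → E => radialMeasure E f (convexHull ℝ (Set.range v)) := by
  rw [lowerSemicontinuous_iff_isClosed_preimage]
  intro V
  refine IsSeqClosed.isClosed fun w v hw hv => ?_
  refine (radialMeasure_convexHull_le_liminf f hv).trans ?_
  refine Filter.liminf_le_of_frequently_le' (Filter.Frequently.of_forall fun n => hw n)

end RadialMeasure

/-! ### Comparison of radial measures fibre by fibre -/

section Fibers

variable {E : Type*} [NormedAddCommGroup E] [InnerProductSpace ℝ E] [FiniteDimensional ℝ E]
  [MeasurableSpace E] [BorelSpace E]

/-- Among all balls of a given radius, the centred one has the least integral of a radially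
increasing function. -/
theorem setLIntegral_closedBall_zero_le {φ : ℝ → ENNReal} (hφ : MonotoneOn φ (Set.Ici 0))
    (a : E) (h : ℝ) :
    ∫⁻ x in Metric.closedBall (0 : E) h, φ ‖x‖ ≤ ∫⁻ x in Metric.closedBall a h, φ ‖x‖ := by
  rcases lt_or_ge h 0 with hh | hh
  · simp [Metric.closedBall_eq_empty.2 hh]
  set B := Metric.closedBall (0 : E) h
  set B' := Metric.closedBall a h
  have hB : MeasurableSet B := Metric.isClosed_closedBall.measurableSet
  have hB' : MeasurableSet B' := Metric.isClosed_closedBall.measurableSet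
  have hvol : volume B = volume B' := (Measure.addHaar_closedBall_center volume a h).symm
  -- Off their intersection the two balls have equal volume; there `φ ‖x‖` is at most `φ h` on the
  -- centred ball and at least `φ h` on the other.
  have hdiff : volume (B \ B') = volume (B' \ B) := by
    have h1 := measure_inter_add_sdiff (μ := (volume : Measure E)) B hB'
    have h2 := measure_inter_add_sdiff (μ := (volume : Measure E)) B' hB
    rw [Set.inter_comm] at h2
    have hfin : volume (B ∩ B') ≠ ⊤ :=
      ((measure_mono Set.inter_subset_left).trans_lt measure_closedBall_lt_top).ne
    rw [← h1, ← h2] at hvol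
    exact (ENNReal.add_right_inj hfin).1 hvol
  rw [← lintegral_inter_add_sdiff (fun x => φ ‖x‖) B hB',
    ← lintegral_inter_add_sdiff (fun x => φ ‖x‖) B' hB, Set.inter_comm B' B]
  gcongr 1
  calc ∫⁻ x in B \ B', φ ‖x‖ ≤ ∫⁻ _ in B \ B', φ h :=
        setLIntegral_mono' (hB.diff hB') fun x hx =>
          hφ (norm_nonneg x) hh (mem_closedBall_zero_iff.1 hx.1)
    _ = ∫⁻ _ in B' \ B, φ h := by simp [hdiff]
    _ ≤ ∫⁻ x in B' \ B, φ ‖x‖ :=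
        setLIntegral_mono' (hB'.diff hB) fun x hx =>
          hφ hh (norm_nonneg x) (by
            have := hx.2
            rw [mem_closedBall_zero_iff] at this
            exact (not_le.1 this).le)

theorem radialMeasure_eq_lintegral_fibers {f : ℝ → ENNReal} (hfm : Measurable f)
    (W : Submodule ℝ E) {A : Set E} (hA : MeasurableSet A) :
    radialMeasure E f A = ∫⁻ b : Wᗮ, ∫⁻ a : W,
      {a : W | (a : E) + b ∈ A}.indicator (fun a => f (√(‖a‖ ^ 2 + ‖b‖ ^ 2))) a := by
  have hmp : MeasurePreserving (W.measurableEquivProd (0 : E)) volume volume := by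
    have := W.measurePreserving_measurableEquivProd (0 : E)
    rwa [InnerProductSpace.euclideanHausdorffMeasure_eq_volume] at this
  have hg : Measurable (A.indicator fun x : E => f ‖x‖) :=
    (hfm.comp measurable_norm).indicator hA
  rw [radialMeasure, withDensity_apply _ hA, ← lintegral_indicator hA,
    ← hmp.symm.lintegral_comp hg, Measure.volume_eq_prod, lintegral_prod_symm]
  · refine lintegral_congr fun b => lintegral_congr fun a => ?_
    have hnorm : ‖(a : E) + b‖ = √(‖a‖ ^ 2 + ‖b‖ ^ 2) := by
      rw [← Real.sqrt_sq (norm_nonneg ((a : E) + b)), sq,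
        norm_add_sq_eq_norm_sq_add_norm_sq_of_inner_eq_zero _ _ (b.2 a a.2)]
      simp [sq]
    rw [Submodule.measurableEquivProd_symm_apply]
    by_cases h : (a : E) + b ∈ A
    · simp [Set.indicator, h, hnorm]
    · simp [Set.indicator, h]
  · exact (hg.comp (MeasurableEquiv.measurable _)).aemeasurable

/-- On the fibre over `b` the density is still increasing in `‖a‖`. The fibre of `A'` sits in a
centred ball of radius `h`, the fibre of `A` contains some ball of that radius, and the centred ball
weighs least. A negative `h` accounts for an empty fibre. -/
theorem radialMeasure_le_of_fibers {f : ℝ → ENNReal} (hf : MonotoneOn f (Set.Ici 0))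
    (hfm : Measurable f) (W : Submodule ℝ E) {A A' : Set E} (hA : MeasurableSet A)
    (hA' : MeasurableSet A')
    (H : ∀ b ∈ Wᗮ, ∃ a₀ ∈ W, ∃ h : ℝ, (∀ a ∈ W, a + b ∈ A' → ‖a‖ ≤ h) ∧
      ∀ a ∈ W, ‖a - a₀‖ ≤ h → a + b ∈ A) :
    radialMeasure E f A' ≤ radialMeasure E f A := by
  rw [radialMeasure_eq_lintegral_fibers hfm W hA, radialMeasure_eq_lintegral_fibers hfm W hA']
  refine lintegral_mono fun b => ?_
  obtain ⟨a₀, ha₀, h, h1, h2⟩ := H b b.2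
  set φ : ℝ → ENNReal := fun t => f (√(t ^ 2 + ‖b‖ ^ 2)) with hφ
  have hφm : MonotoneOn φ (Set.Ici 0) := by
    intro s hs t ht hst
    have : s ^ 2 ≤ t ^ 2 := pow_le_pow_left₀ hs hst 2
    exact hf (Real.sqrt_nonneg _) (Real.sqrt_nonneg _) (Real.sqrt_le_sqrt (by linarith))
  calc _ ≤ ∫⁻ a : W, (Metric.closedBall (0 : W) h).indicator (fun a => φ ‖a‖) a := by
        refine lintegral_mono fun a => Set.indicator_le_indicator_of_subset ?_ (by simp) a
        intro a ha
        rw [mem_closedBall_zero_iff]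
        exact h1 a a.2 ha
    _ ≤ ∫⁻ a : W, (Metric.closedBall (⟨a₀, ha₀⟩ : W) h).indicator (fun a => φ ‖a‖) a := by
        rw [lintegral_indicator Metric.isClosed_closedBall.measurableSet,
          lintegral_indicator Metric.isClosed_closedBall.measurableSet]
        exact setLIntegral_closedBall_zero_le (E := W) hφm _ _
    _ ≤ _ := by
        refine lintegral_mono fun a => Set.indicator_le_indicator_of_subset ?_ (by simp) a
        intro a ha
        rw [Metric.mem_closedBall, dist_eq_norm] at ha
        exact h2 a a.2 ha

end Fibers

/-! ### Steiner symmetrization along an edge -/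

section Steiner

variable {E ι : Type*} [NormedAddCommGroup E] [InnerProductSpace ℝ E] [Fintype ι] [DecidableEq ι]

/-- The coordinate of `x` in the direction of `u`. -/
noncomputable def coordAlong (u x : E) : ℝ := ⟪u, x⟫ / ‖u‖ ^ 2

/-- The vertices of the Steiner symmetral of `conv v` with respect to the hyperplane through the
origin orthogonal to the edge `v p - v q`. -/
noncomputable def steiner (v : ι → E) (p q : ι) : ι → E := fun i =>
  v i + ((if i = p then 1 / 2 else if i = q then -1 / 2 else 0) -
    coordAlong (v p - v q) (v i)) • (v p - v q)

theorem coordAlong_add (u x y : E) : coordAlong u (x + y) = coordAlong u x + coordAlong u y := by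
  simp [coordAlong, inner_add_right, add_div]

theorem coordAlong_smul (u : E) (r : ℝ) (x : E) : coordAlong u (r • x) = r * coordAlong u x := by
  simp [coordAlong, inner_smul_right, mul_div_assoc]

theorem coordAlong_sub (u x y : E) : coordAlong u (x - y) = coordAlong u x - coordAlong u y := by
  simp [coordAlong, inner_sub_right, sub_div]

theorem coordAlong_sum (u : E) (c : ι → ℝ) (v : ι → E) :
    coordAlong u (∑ i, c i • v i) = ∑ i, c i * coordAlong u (v i) := by
  simp [coordAlong, inner_sum, inner_smul_right, Finset.sum_div, mul_div_assoc]

theorem coordAlong_self {u : E} (hu : u ≠ 0) : coordAlong u u = 1 := by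
  have : ‖u‖ ≠ 0 := norm_ne_zero_iff.2 hu
  rw [coordAlong, real_inner_self_eq_norm_sq, div_self (by positivity)]

/-- A combination with fixed weights moves only along the edge direction, and its new coordinate
there depends only on the weights at `p` and `q`. -/
theorem sum_smul_steiner (v : ι → E) {p q : ι} (hpq : p ≠ q) (c : ι → ℝ) :
    ∑ i, c i • steiner v p q i = ∑ i, c i • v i +
      ((c p - c q) / 2 - coordAlong (v p - v q) (∑ i, c i • v i)) • (v p - v q) := by
  have h1 : ∑ i, c i * (if i = p then 1 / 2 else if i = q then -1 / 2 else 0) = (c p - c q) / 2 := by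
    rw [← Finset.add_sum_erase _ _ (Finset.mem_univ p),
      ← Finset.add_sum_erase _ _ (Finset.mem_erase.2 ⟨hpq.symm, Finset.mem_univ q⟩),
      Finset.sum_eq_zero]
    · simp [hpq.symm]; ring
    · intro i hi
      simp only [Finset.mem_erase] at hi
      simp [hi.1, hi.2.1]
  simp only [steiner, smul_add, Finset.sum_add_distrib, smul_smul, ← Finset.sum_smul, mul_sub,
    Finset.sum_sub_distrib, h1, coordAlong_sum]

/-- Weight `η` is shifted from `p` to `q`; the two bounds keep both weights nonnegative. -/
theorem sum_smul_sub_mem_convexHull_range {v : ι → E} {p q : ι} (hpq : p ≠ q) {c : ι → ℝ}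
    (hc : c ∈ stdSimplex ℝ ι) {η : ℝ} (hp : η ≤ c p) (hq : -c q ≤ η) :
    ∑ i, c i • v i - η • (v p - v q) ∈ convexHull ℝ (Set.range v) := by
  rw [mem_convexHull_range_iff_exists_stdSimplex]
  refine ⟨fun i => c i - η * ((Pi.single p 1 : ι → ℝ) i - (Pi.single q 1 : ι → ℝ) i), ⟨fun i => ?_, ?_⟩, ?_⟩
  · rcases eq_or_ne i p with rfl | hip
    · simp [hpq]; linarith
    · rcases eq_or_ne i q with rfl | hiq
      · simp [hpq.symm]; linarith
      · simp [hip, hiq, hc.1 i]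
  · simp [Finset.sum_sub_distrib, ← Finset.mul_sum, hc.2]
  · simp only [sub_smul, Finset.sum_sub_distrib, mul_smul, ← Finset.smul_sum, Pi.single_apply,
      ite_smul, one_smul, zero_smul, Finset.sum_ite_eq', Finset.mem_univ, if_true]

/-- Along a fixed orthogonal part, a convex combination with maximal weight on the edge `p q`. -/
theorem exists_isMaxOn_edge_weight (v : ι → E) (p q : ι) (b : E)
    (hne : ∃ c ∈ stdSimplex ℝ ι, ∃ t : ℝ, ∑ i, c i • v i = b + t • (v p - v q))
    (hb : ⟪v p - v q, b⟫ = 0) (hu : v p - v q ≠ 0) :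
    ∃ c ∈ stdSimplex ℝ ι, (∃ t : ℝ, ∑ i, c i • v i = b + t • (v p - v q)) ∧
      ∀ c' ∈ stdSimplex ℝ ι, (∃ t : ℝ, ∑ i, c' i • v i = b + t • (v p - v q)) →
        c' p + c' q ≤ c p + c q := by
  -- Eliminating `t` turns the condition into a closed equation in `c`, so that the maximum exists
  -- by compactness of the simplex.
  have key : ∀ c : ι → ℝ, (∃ t : ℝ, ∑ i, c i • v i = b + t • (v p - v q)) ↔
      ∑ i, c i • v i - (∑ i, c i * coordAlong (v p - v q) (v i)) • (v p - v q) = b := by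
    intro c
    constructor
    · rintro ⟨t, ht⟩
      rw [← coordAlong_sum, ht, coordAlong_add, coordAlong_smul, coordAlong_self hu]
      simp [coordAlong, hb]
    · intro h
      exact ⟨_, by rw [← h]; exact (sub_add_cancel _ _).symm⟩
  simp only [key] at hne ⊢
  have hclosed : IsClosed {c : ι → ℝ | ∑ i, c i • v i -
      (∑ i, c i * coordAlong (v p - v q) (v i)) • (v p - v q) = b} :=
    isClosed_eq (by fun_prop) continuous_const
  obtain ⟨c₀, hc₀, hc₀'⟩ := hne
  obtain ⟨c, hc, hmax⟩ := ((isCompact_stdSimplex (𝕜 := ℝ) ι).inter_right hclosed).exists_isMaxOn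
    ⟨c₀, hc₀, hc₀'⟩ (f := fun c => c p + c q) (by fun_prop)
  exact ⟨c, hc.1, hc.2, fun c' h1 h2 => hmax ⟨h1, h2⟩⟩

theorem sum_smul_steiner_of_eq (v : ι → E) {p q : ι} (hpq : p ≠ q) {c : ι → ℝ} {b : E} {t : ℝ}
    (hb : ⟪v p - v q, b⟫ = 0) (hu : v p - v q ≠ 0)
    (h : ∑ i, c i • v i = b + t • (v p - v q)) :
    ∑ i, c i • steiner v p q i = b + ((c p - c q) / 2) • (v p - v q) := by
  rw [sum_smul_steiner v hpq, h, coordAlong_add, coordAlong_smul, coordAlong_self hu]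
  simp only [coordAlong, hb]
  module

theorem exists_of_sum_smul_steiner_eq (v : ι → E) {p q : ι} (hpq : p ≠ q) {c : ι → ℝ} {b : E}
    {t : ℝ} (hb : ⟪v p - v q, b⟫ = 0) (hu : v p - v q ≠ 0)
    (h : ∑ i, c i • steiner v p q i = b + t • (v p - v q)) :
    t = (c p - c q) / 2 ∧ ∃ t' : ℝ, ∑ i, c i • v i = b + t' • (v p - v q) := by
  rw [sum_smul_steiner v hpq] at h
  have h2 := congrArg (coordAlong (v p - v q)) h
  rw [coordAlong_add, coordAlong_add, coordAlong_smul, coordAlong_smul, coordAlong_self hu] at h2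
  have h3 : coordAlong (v p - v q) b = 0 := by simp [coordAlong, hb]
  have ht : t = (c p - c q) / 2 := by rw [h3] at h2; linarith
  refine ⟨ht, coordAlong (v p - v q) (∑ i, c i • v i), ?_⟩
  rw [ht] at h
  rw [← sub_eq_zero] at h ⊢
  rw [← h]
  module

theorem steiner_sub (v : ι → E) {p q : ι} (hpq : p ≠ q) (hu : v p - v q ≠ 0) :
    steiner v p q p - steiner v p q q = v p - v q := by
  have h := coordAlong_self hu
  rw [coordAlong_sub] at h
  have h' : coordAlong (v p - v q) (v p) = 1 + coordAlong (v p - v q) (v q) := by linarith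
  simp only [steiner, if_pos, if_neg hpq.symm, h']
  module

/-- Points of the Steiner symmetral over a given orthogonal part. -/
theorem add_smul_mem_convexHull_steiner (v : ι → E) {p q : ι} (hpq : p ≠ q) {c : ι → ℝ}
    (hc : c ∈ stdSimplex ℝ ι) {b : E} {t τ : ℝ} (hb : ⟪v p - v q, b⟫ = 0) (hu : v p - v q ≠ 0)
    (h : ∑ i, c i • v i = b + t • (v p - v q)) (hτ : |τ| ≤ (c p + c q) / 2) :
    b + τ • (v p - v q) ∈ convexHull ℝ (Set.range (steiner v p q)) := by
  have h1 := sum_smul_steiner_of_eq v hpq hb hu h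
  rw [abs_le] at hτ
  have h2 := sum_smul_sub_mem_convexHull_range (v := steiner v p q) hpq hc
    (η := (c p - c q) / 2 - τ) (by linarith) (by linarith)
  rw [h1, steiner_sub v hpq hu] at h2
  convert h2 using 1
  module

/-- Let `c` have maximal weight on `p` and `q` among the combinations over `b`. A point of the new
fibre has coordinate `(c' p - c' q) / 2`, hence of size at most `(c p + c q) / 2`. The old fibre
contains a whole interval of that half-length, swept out by moving weight between `p` and `q`. -/
theorem radialMeasure_steiner_le [FiniteDimensional ℝ E] [MeasurableSpace E] [BorelSpace E]
    {f : ℝ → ENNReal} (hf : MonotoneOn f (Set.Ici 0)) (hfm : Measurable f) (v : ι → E) {p q : ι}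
    (hpq : p ≠ q) (hu : v p - v q ≠ 0) :
    radialMeasure E f (convexHull ℝ (Set.range (steiner v p q))) ≤
      radialMeasure E f (convexHull ℝ (Set.range v)) := by
  refine radialMeasure_le_of_fibers hf hfm (ℝ ∙ (v p - v q))
    (isCompact_convexHull_range _).isClosed.measurableSet
    (isCompact_convexHull_range _).isClosed.measurableSet fun b hb => ?_
  have hb' : ⟪v p - v q, b⟫ = 0 := hb _ (Submodule.mem_span_singleton_self _)
  have hu' : 0 < ‖v p - v q‖ := norm_pos_iff.2 hu
  by_cases hne : ∃ c ∈ stdSimplex ℝ ι, ∃ t : ℝ, ∑ i, c i • v i = b + t • (v p - v q)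
  · obtain ⟨c, hc, ⟨t, ht⟩, hmax⟩ := exists_isMaxOn_edge_weight v p q b hne hb' hu
    refine ⟨(t + (c q - c p) / 2) • (v p - v q), Submodule.smul_mem _ _
      (Submodule.mem_span_singleton_self _), (c p + c q) / 2 * ‖v p - v q‖, ?_, ?_⟩
    · intro a ha hab
      obtain ⟨τ, rfl⟩ := Submodule.mem_span_singleton.1 ha
      obtain ⟨c', hc', h'⟩ := mem_convexHull_range_iff_exists_stdSimplex.1 hab
      rw [add_comm] at h'
      obtain ⟨h1, h2⟩ := exists_of_sum_smul_steiner_eq v hpq hb' hu h'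
      have h3 := hmax c' hc' h2
      rw [norm_smul]
      gcongr
      rw [Real.norm_eq_abs, abs_le, h1]
      constructor <;> linarith [hc'.1 p, hc'.1 q]
    · intro a ha hab
      obtain ⟨τ, rfl⟩ := Submodule.mem_span_singleton.1 ha
      rw [← sub_smul, norm_smul, mul_le_mul_iff_left₀ hu', Real.norm_eq_abs, abs_le] at hab
      have h2 := sum_smul_sub_mem_convexHull_range (v := v) hpq hc
        (η := t - τ) (by linarith) (by linarith)
      rw [ht] at h2
      convert h2 using 1
      module
  -- Neither hull meets the fibre over `b`; the radius `-1` stands for the empty ball.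
  · refine ⟨0, Submodule.zero_mem _, -1, ?_, ?_⟩
    · intro a ha hab
      obtain ⟨τ, rfl⟩ := Submodule.mem_span_singleton.1 ha
      obtain ⟨c', hc', h'⟩ := mem_convexHull_range_iff_exists_stdSimplex.1 hab
      rw [add_comm] at h'
      exact absurd ⟨c', hc', (exists_of_sum_smul_steiner_eq v hpq hb' hu h').2⟩ hne
    · intro a _ h
      linarith [norm_nonneg (a - 0)]

/-- Steiner symmetrization along an edge joining two points on the same side of the Radon
partition keeps every centred ball. -/
theorem closedBall_subset_convexHull_steiner {v : ι → E} {p q : ι} (hpq : p ≠ q)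
    (hu : v p - v q ≠ 0) {z : ι → ℝ} (hz : 0 ≤ z p * z q)
    (hdep : ∀ g : ι → ℝ, ∑ i, g i = 0 → ∑ i, g i • v i = 0 → ∃ θ : ℝ, g = θ • z) {ρ : ℝ}
    (hball : Metric.closedBall 0 ρ ⊆ convexHull ℝ (Set.range v)) :
    Metric.closedBall 0 ρ ⊆ convexHull ℝ (Set.range (steiner v p q)) := by
  intro x hx
  set u := v p - v q with hudef
  set t₁ := coordAlong u x with ht₁
  set b := x - t₁ • u with hbdef
  have hu' : 0 < ‖u‖ := norm_pos_iff.2 hu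
  have hb : ⟪u, b⟫ = 0 := by
    rw [hbdef, inner_sub_right, inner_smul_right, real_inner_self_eq_norm_sq, ht₁, coordAlong]
    field_simp
    simp
  have hx1 : x = b + t₁ • u := by rw [hbdef]; module
  -- The mirror image of `x` in the hyperplane orthogonal to `u` also lies in the ball.
  have hx2 : b + (-t₁) • u ∈ Metric.closedBall (0 : E) ρ := by
    rw [mem_closedBall_zero_iff] at hx ⊢
    refine le_trans (le_of_eq ?_) hx
    rw [hx1, ← sq_eq_sq₀ (norm_nonneg _) (norm_nonneg _), norm_add_sq_real, norm_add_sq_real]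
    simp [norm_smul, inner_smul_right, real_inner_comm u b, hb]
  obtain ⟨c₁, hc₁, hs₁⟩ := mem_convexHull_range_iff_exists_stdSimplex.1 (hball hx)
  obtain ⟨c₂, hc₂, hs₂⟩ := mem_convexHull_range_iff_exists_stdSimplex.1 (hball hx2)
  obtain ⟨c, hc, ⟨τ, hτ⟩, hmax⟩ := exists_isMaxOn_edge_weight v p q b
    ⟨c₁, hc₁, t₁, hs₁.trans hx1⟩ hb hu
  -- The difference `c - c'`, corrected by a shift along the edge, is an affine dependency, hence `θ
  -- • z`. Maximality of `c` gives `0 ≤ θ * z p + θ * z q`; as `z p` and `z q` do not have opposite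
  -- signs, both terms are nonnegative. So the old fibre reaches no further than the interval
  -- obtained from `c` by moving weight along the edge.
  have key : ∀ c' ∈ stdSimplex ℝ ι, ∀ t : ℝ, ∑ i, c' i • v i = b + t • u →
      τ - t ≤ c p ∧ -c q ≤ τ - t := by
    intro c' hc' t ht
    obtain ⟨θ, hθ⟩ := hdep (fun i => c i - c' i - (τ - t) * ((Pi.single p 1 : ι → ℝ) i - (Pi.single q 1 : ι → ℝ) i))
      (by simp [Finset.sum_sub_distrib, ← Finset.mul_sum, hc.2, hc'.2]) (by
        simp only [sub_smul, Finset.sum_sub_distrib, mul_smul, ← Finset.smul_sum, Pi.single_apply,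
          ite_smul, one_smul, zero_smul, Finset.sum_ite_eq', Finset.mem_univ, if_true, hτ, ht]
        rw [← hudef]
        module)
    have hp := congrFun hθ p
    have hq := congrFun hθ q
    simp [hpq, hpq.symm] at hp hq
    have hm := hmax c' hc' ⟨t, ht⟩
    have h1 : 0 ≤ θ * z p + θ * z q := by linarith
    have h2 : 0 ≤ (θ * z p) * (θ * z q) := by nlinarith [sq_nonneg θ]
    have h3 : 0 ≤ θ * z p := by nlinarith
    have h4 : 0 ≤ θ * z q := by nlinarith
    constructor <;> linarith [hc'.1 p, hc'.1 q]
  -- The old fibre contains both `t₁` and `-t₁`; adding the bounds for the two yields `|t₁| ≤ (c p +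
  -- c q) / 2`.
  obtain ⟨h1, h2⟩ := key c₁ hc₁ t₁ (hs₁.trans hx1)
  obtain ⟨h3, h4⟩ := key c₂ hc₂ (-t₁) hs₂
  rw [hx1]
  refine add_smul_mem_convexHull_steiner v hpq hc hb hu hτ ?_
  rw [abs_le]
  constructor <;> linarith

theorem norm_sq_steiner (v : ι → E) (p q i : ι) (hu : v p - v q ≠ 0) :
    ‖steiner v p q i‖ ^ 2 = ‖v i‖ ^ 2 +
      ((if i = p then 1 / 2 else if i = q then -1 / 2 else 0) ^ 2 -
        coordAlong (v p - v q) (v i) ^ 2) * ‖v p - v q‖ ^ 2 := by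
  have hu' : 0 < ‖v p - v q‖ := norm_pos_iff.2 hu
  have h : ⟪v p - v q, v i⟫ = coordAlong (v p - v q) (v i) * ‖v p - v q‖ ^ 2 := by
    rw [coordAlong]
    field_simp
  rw [steiner, norm_add_sq_real, norm_smul, mul_pow, Real.norm_eq_abs, sq_abs, inner_smul_right,
    real_inner_comm, h]
  ring

/-- Vertices off the edge are projected. With `H` the coordinate of `v p`, both new ends of the edge
have as squared norm the mean of the two old ones minus `(H - 1 / 2) ^ 2 * ‖v p - v q‖ ^ 2`. In the
hyperbolic case this keeps the polytope inside the model. -/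
theorem norm_steiner_le {v : ι → E} {p q : ι} (hpq : p ≠ q) (hu : v p - v q ≠ 0) {R : ℝ}
    (hR : ∀ i, ‖v i‖ ≤ R) (i : ι) : ‖steiner v p q i‖ ≤ R := by
  have hR0 : 0 ≤ R := (norm_nonneg _).trans (hR i)
  have hsq : ∀ j, ‖v j‖ ^ 2 ≤ R ^ 2 := fun j => pow_le_pow_left₀ (norm_nonneg _) (hR j) 2
  have h := coordAlong_self hu
  rw [coordAlong_sub] at h
  have hsub := norm_sub_sq_real (v p) (v q)
  have hp : ⟪v p - v q, v p⟫ = coordAlong (v p - v q) (v p) * ‖v p - v q‖ ^ 2 := by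
    have hu' : 0 < ‖v p - v q‖ := norm_pos_iff.2 hu
    rw [coordAlong]; field_simp
  rw [inner_sub_left, real_inner_self_eq_norm_sq, real_inner_comm] at hp
  refine abs_le_of_sq_le_sq' ?_ hR0 |>.2
  rw [norm_sq_steiner v p q i hu]
  have h0 : 0 ≤ ‖v p - v q‖ ^ 2 := by positivity
  set H := coordAlong (v p - v q) (v p)
  have hq : coordAlong (v p - v q) (v q) = H - 1 := by linarith
  rcases eq_or_ne i p with rfl | hip
  · simp only [if_true]
    nlinarith [hsq i, hsq q, mul_nonneg h0 (sq_nonneg (H - 1 / 2))]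
  · rcases eq_or_ne i q with rfl | hiq
    · simp only [hip, if_true, if_false, hq]
      nlinarith [hsq p, hsq i, mul_nonneg h0 (sq_nonneg (H - 1 / 2))]
    · simp only [hip, hiq, if_false]
      nlinarith [hsq i, mul_nonneg h0 (sq_nonneg (coordAlong (v p - v q) (v i)))]

/-- Steiner symmetrization decreases the sum of the squared norms of the vertices, strictly unless
the polytope is already symmetric. -/
theorem sum_norm_sq_steiner (v : ι → E) {p q : ι} (hpq : p ≠ q) (hu : v p - v q ≠ 0) :
    ∑ i, ‖steiner v p q i‖ ^ 2 = ∑ i, ‖v i‖ ^ 2 -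
      ((∑ i ∈ (Finset.univ.erase p).erase q, coordAlong (v p - v q) (v i) ^ 2) +
        (coordAlong (v p - v q) (v p) + coordAlong (v p - v q) (v q)) ^ 2 / 2) *
        ‖v p - v q‖ ^ 2 := by
  have h := coordAlong_self hu
  rw [coordAlong_sub] at h
  set u := v p - v q
  have hq : coordAlong u (v p) = 1 + coordAlong u (v q) := by linarith
  simp only [norm_sq_steiner v p q _ hu, Finset.sum_add_distrib, ← Finset.sum_mul,
    Finset.sum_sub_distrib]
  have h1 : ∑ i, (if i = p then 1 / 2 else if i = q then -1 / 2 else 0 : ℝ) ^ 2 = 1 / 2 := by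
    rw [← Finset.add_sum_erase _ _ (Finset.mem_univ p),
      ← Finset.add_sum_erase _ _ (Finset.mem_erase.2 ⟨hpq.symm, Finset.mem_univ q⟩),
      Finset.sum_eq_zero]
    · simp [hpq.symm]; norm_num
    · intro i hi
      simp only [Finset.mem_erase] at hi
      simp [hi.1, hi.2.1]
  have h2 : ∑ i, coordAlong u (v i) ^ 2 = coordAlong u (v p) ^ 2 + (coordAlong u (v q) ^ 2 +
      ∑ i ∈ (Finset.univ.erase p).erase q, coordAlong u (v i) ^ 2) := by
    rw [Finset.add_sum_erase _ (fun i => coordAlong u (v i) ^ 2)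
      (Finset.mem_erase.2 ⟨hpq.symm, Finset.mem_univ q⟩),
      Finset.add_sum_erase _ (fun i => coordAlong u (v i) ^ 2) (Finset.mem_univ p)]
  rw [h1, h2, hq]
  ring

end Steiner

/-! ### From Radon dependencies to orthogonal pairs of regular simplices -/

section Symmetrization

variable {E ι : Type*} [NormedAddCommGroup E] [InnerProductSpace ℝ E] [Fintype ι]

/-- A linear functional constant on the vertices is constant on the hull, hence on a ball. -/
theorem eq_zero_of_inner_eq_const {v : ι → E} {ρ : ℝ} (hρ : 0 < ρ)
    (hball : Metric.closedBall 0 ρ ⊆ convexHull ℝ (Set.range v)) {z : E} {c : ℝ}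
    (h : ∀ i, ⟪z, v i⟫ = c) : z = 0 := by
  have hconst : ∀ x ∈ convexHull ℝ (Set.range v), ⟪z, x⟫ = c := by
    intro x hx
    obtain ⟨w, hw, rfl⟩ := mem_convexHull_range_iff_exists_stdSimplex.1 hx
    simp [inner_sum, inner_smul_right, h, ← Finset.sum_mul, hw.2]
  by_contra hz
  have hz' : 0 < ‖z‖ := norm_pos_iff.2 hz
  have h0 := hconst 0 (hball (by simp [hρ.le]))
  have h1 := hconst ((ρ / ‖z‖) • z) (hball (by
    rw [mem_closedBall_zero_iff, norm_smul, Real.norm_of_nonneg (by positivity),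
      div_mul_cancel₀ _ hz'.ne']))
  rw [inner_smul_right, real_inner_self_eq_norm_sq] at h1
  rw [inner_zero_right] at h0
  rw [← h0] at h1
  have : 0 < ρ / ‖z‖ * ‖z‖ ^ 2 := by positivity
  linarith

/-- The affine dependencies of `d + 2` points spanning a `d`-dimensional space are proportional. -/
theorem affine_dependency_unique [FiniteDimensional ℝ E] {v : ι → E}
    (hcard : Fintype.card ι = Module.finrank ℝ E + 2) {ρ : ℝ} (hρ : 0 < ρ)
    (hball : Metric.closedBall 0 ρ ⊆ convexHull ℝ (Set.range v)) {z : ι → ℝ} (hz : z ≠ 0)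
    (hz0 : ∑ i, z i = 0) (hzv : ∑ i, z i • v i = 0) (g : ι → ℝ) (hg0 : ∑ i, g i = 0)
    (hgv : ∑ i, g i • v i = 0) : ∃ θ : ℝ, g = θ • z := by
  -- The dependencies form the kernel of `φ`. The range contains `{1} × ball`, so `φ` is onto, and
  -- rank-nullity leaves a kernel of dimension `(d + 2) - (d + 1) = 1`.
  let φ : (ι → ℝ) →ₗ[ℝ] ℝ × E :=
    (Fintype.linearCombination ℝ fun _ => (1 : ℝ)).prod (Fintype.linearCombination ℝ v)
  have hφ : ∀ c, φ c = (∑ i, c i, ∑ i, c i • v i) := fun c => by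
    simp [φ, Fintype.linearCombination_apply]
  have hmem : ∀ x ∈ Metric.closedBall (0 : E) ρ, ((1 : ℝ), x) ∈ LinearMap.range φ := by
    intro x hx
    obtain ⟨c, hc, hcx⟩ := mem_convexHull_range_iff_exists_stdSimplex.1 (hball hx)
    exact ⟨c, by rw [hφ, hc.2, hcx]⟩
  have hrange : LinearMap.range φ = ⊤ := by
    rw [eq_top_iff]
    rintro ⟨τ, y⟩ -
    have h0 := hmem 0 (by simp [hρ.le])
    obtain ⟨ε, hε, hεy⟩ : ∃ ε > (0 : ℝ), ε • y ∈ Metric.closedBall (0 : E) ρ := by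
      refine ⟨ρ / (‖y‖ + 1), by positivity, ?_⟩
      rw [mem_closedBall_zero_iff, norm_smul, Real.norm_of_nonneg (by positivity), div_mul_eq_mul_div,
        div_le_iff₀ (by positivity)]
      nlinarith [norm_nonneg y]
    have h1 := hmem _ hεy
    have h2 := (LinearMap.range φ).add_mem
      ((LinearMap.range φ).smul_mem ε⁻¹ ((LinearMap.range φ).sub_mem h1 h0))
      ((LinearMap.range φ).smul_mem τ h0)
    convert h2 using 1
    ext <;> simp [hε.ne']
  have hrank := LinearMap.finrank_range_add_finrank_ker φ
  rw [hrange, finrank_top, Module.finrank_prod, Module.finrank_self, Module.finrank_fintype_fun_eq_card,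
    hcard] at hrank
  have hker : Module.finrank ℝ (LinearMap.ker φ) = 1 := by omega
  have hzk : z ∈ LinearMap.ker φ := by simp [LinearMap.mem_ker, hφ, hz0, hzv]
  have hgk : g ∈ LinearMap.ker φ := by simp [LinearMap.mem_ker, hφ, hg0, hgv]
  obtain ⟨θ, hθ⟩ := (finrank_eq_one_iff_of_nonzero' (⟨z, hzk⟩ : LinearMap.ker φ)
    (by simpa [Subtype.ext_iff] using hz)).1 hker ⟨g, hgk⟩
  exact ⟨θ, by simpa [Subtype.ext_iff] using hθ.symm⟩

/-- `z` is a normalised affine dependency of the points `v` whose signs are given by `σ`. -/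
structure IsRadonDependency (σ : ι → ℝ) (v : ι → E) (z : ι → ℝ) : Prop where
  sign : ∀ i, 0 ≤ σ i * z i
  sum_sign : ∑ i, σ i * z i = 1
  sum : ∑ i, z i = 0
  sum_smul : ∑ i, z i • v i = 0

theorem IsRadonDependency.ne_zero {σ : ι → ℝ} {v : ι → E} {z : ι → ℝ}
    (h : IsRadonDependency σ v z) : z ≠ 0 := by
  rintro rfl
  simpa using h.sum_sign

theorem IsRadonDependency.mul_nonneg {σ : ι → ℝ} (hσ : ∀ i, σ i = 1 ∨ σ i = -1) {v : ι → E}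
    {z : ι → ℝ} (h : IsRadonDependency σ v z) {p q : ι} (hpq : σ p = σ q) : 0 ≤ z p * z q := by
  have hp := h.sign p
  have hq := h.sign q
  have : (σ p * z p) * (σ q * z q) = z p * z q := by
    rcases hσ p with hp | hp <;> rw [← hpq, hp] <;> ring
  rw [← this]
  positivity

/-- Replace the weights at `p` and `q` by their mean. The error on the old vertices is a multiple of
the edge vector, and the symmetrization removes it because the two new weights agree. -/
theorem IsRadonDependency.steiner [DecidableEq ι] {σ : ι → ℝ} {v : ι → E} {z : ι → ℝ}
    (h : IsRadonDependency σ v z) {p q : ι} (hpq : p ≠ q) (hs : σ p = σ q) (hu : v p - v q ≠ 0) :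
    ∃ z', IsRadonDependency σ (steiner v p q) z' := by
  set z' : ι → ℝ := fun i =>
    z i + (z q - z p) / 2 * ((Pi.single p 1 : ι → ℝ) i - (Pi.single q 1 : ι → ℝ) i) with hz'
  have hp' : z' p = (z p + z q) / 2 := by simp [hz', hpq]; ring
  have hq' : z' q = (z p + z q) / 2 := by simp [hz', hpq.symm]; ring
  have hsum : ∑ i, z' i • v i = ((z q - z p) / 2) • (v p - v q) := by
    simp only [hz', add_smul, sub_smul, Finset.sum_add_distrib, Finset.sum_sub_distrib, mul_smul,
      ← Finset.smul_sum, Pi.single_apply, ite_smul, one_smul, zero_smul, Finset.sum_ite_eq',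
      Finset.mem_univ, if_true, h.sum_smul, zero_add]
  refine ⟨z', fun i => ?_, ?_, ?_, ?_⟩
  · have h1 := h.sign p
    have h2 := h.sign q
    rcases eq_or_ne i p with rfl | hip
    · rw [hp']; rw [← hs] at h2; linarith
    · rcases eq_or_ne i q with rfl | hiq
      · rw [hq']; rw [hs] at h1; linarith
      · simpa [hz', hip, hiq] using h.sign i
  · have h1 : ∀ i, σ i * z' i = σ i * z i + (z q - z p) / 2 *
        (σ i * (Pi.single p 1 : ι → ℝ) i - σ i * (Pi.single q 1 : ι → ℝ) i) := fun i => by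
      simp only [hz']; ring
    simp only [h1, Finset.sum_add_distrib, ← Finset.mul_sum, Finset.sum_sub_distrib, h.sum_sign]
    simp [Pi.single_apply, hs]
  · simp [hz', Finset.sum_add_distrib, ← Finset.mul_sum, h.sum]
  · rw [sum_smul_steiner v hpq, hsum, coordAlong_smul, coordAlong_self hu, hp', hq']
    module

theorem isClosed_setOf_isRadonDependency (σ : ι → ℝ) :
    IsClosed {x : (ι → E) × (ι → ℝ) | IsRadonDependency σ x.1 x.2} := by
  have : {x : (ι → E) × (ι → ℝ) | IsRadonDependency σ x.1 x.2} =
      (⋂ i, {x | 0 ≤ σ i * x.2 i}) ∩ ({x | ∑ i, σ i * x.2 i = 1} ∩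
        ({x | ∑ i, x.2 i = 0} ∩ {x | ∑ i, x.2 i • x.1 i = 0})) := by
    ext x
    simp only [Set.mem_ofPred_eq, Set.mem_inter_iff, Set.mem_iInter]
    exact ⟨fun h => ⟨h.1, h.2, h.3, h.4⟩, fun h => ⟨h.1, h.2.1, h.2.2.1, h.2.2.2⟩⟩
  rw [this]
  refine (isClosed_iInter fun i => isClosed_le continuous_const (by fun_prop)).inter
    ((isClosed_eq (by fun_prop) continuous_const).inter
    ((isClosed_eq (by fun_prop) continuous_const).inter
      (isClosed_eq (by fun_prop) continuous_const)))

variable [FiniteDimensional ℝ E]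

/-- The configurations in a ball of radius `R` whose convex hull contains a ball of radius `ρ`. -/
theorem isCompact_setOf_configurations {σ : ι → ℝ} (hσ : ∀ i, σ i = 1 ∨ σ i = -1) (R ρ : ℝ) :
    IsCompact {x : (ι → E) × (ι → ℝ) | (∀ i, ‖x.1 i‖ ≤ R) ∧ IsRadonDependency σ x.1 x.2 ∧
      Metric.closedBall 0 ρ ⊆ convexHull ℝ (Set.range x.1)} := by
  have : ProperSpace E := FiniteDimensional.proper_real E
  have hK : IsCompact ((Set.univ.pi fun _ : ι => Metric.closedBall (0 : E) R) ×ˢ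
      (Set.univ.pi fun _ : ι => Set.Icc (-1 : ℝ) 1)) :=
    (isCompact_univ_pi fun _ => isCompact_closedBall _ _).prod
      (isCompact_univ_pi fun _ => isCompact_Icc)
  refine hK.of_isClosed_subset ?_ ?_
  · have h1 : IsClosed {x : (ι → E) × (ι → ℝ) | ∀ i, ‖x.1 i‖ ≤ R} := by
      simp only [Set.ofPred_forall]
      exact isClosed_iInter fun i => isClosed_le (by fun_prop) continuous_const
    have h2 : IsClosed {x : (ι → E) × (ι → ℝ) |
        Metric.closedBall 0 ρ ⊆ convexHull ℝ (Set.range x.1)} := by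
      simp only [Set.subset_def, Set.ofPred_forall]
      exact isClosed_iInter fun y => isClosed_iInter fun _ =>
        (isClosed_setOf_mem_convexHull_range y).preimage continuous_fst
    exact h1.inter ((isClosed_setOf_isRadonDependency σ).inter h2)
  · rintro ⟨v, z⟩ ⟨h1, h2, -⟩
    refine ⟨fun i _ => by simpa using h1 i, fun i _ => ?_⟩
    -- The normalisation by signs bounds every coefficient, which makes the set of dependencies
    -- compact.
    have h3 : σ i * z i ≤ 1 := by
      rw [← h2.sum_sign]
      exact Finset.single_le_sum (f := fun i => σ i * z i) (fun j _ => h2.sign j)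
        (Finset.mem_univ i)
    have h4 := h2.sign i
    simp only at h4 h3 ⊢
    rcases hσ i with h | h <;> rw [h] at h3 h4 <;> constructor <;> linarith

variable [MeasurableSpace E] [BorelSpace E]

/-- Repeated Steiner symmetrization leads to a configuration which is symmetric with respect to
all edges joining points on the same side of the Radon partition. -/
theorem exists_symmetric_configuration {f : ℝ → ENNReal} (hf : MonotoneOn f (Set.Ici 0))
    (hfm : Measurable f) (hcard : Fintype.card ι = Module.finrank ℝ E + 2) {σ : ι → ℝ}
    (hσ : ∀ i, σ i = 1 ∨ σ i = -1) {R ρ : ℝ} (hρ : 0 < ρ) {v : ι → E} {z : ι → ℝ}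
    (hR : ∀ i, ‖v i‖ ≤ R) (hz : IsRadonDependency σ v z)
    (hball : Metric.closedBall 0 ρ ⊆ convexHull ℝ (Set.range v)) :
    ∃ (v' : ι → E) (z' : ι → ℝ), (∀ i, ‖v' i‖ ≤ R) ∧ IsRadonDependency σ v' z' ∧
      Metric.closedBall 0 ρ ⊆ convexHull ℝ (Set.range v') ∧
      radialMeasure E f (convexHull ℝ (Set.range v')) ≤
        radialMeasure E f (convexHull ℝ (Set.range v)) ∧
      ∀ p q, p ≠ q → σ p = σ q →
        (∀ i, i ≠ p → i ≠ q → ⟪v' p - v' q, v' i⟫ = 0) ∧ ‖v' p‖ = ‖v' q‖ := by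
  classical
  set V := radialMeasure E f (convexHull ℝ (Set.range v))
  have hclosed : IsClosed {x : (ι → E) × (ι → ℝ) |
      radialMeasure E f (convexHull ℝ (Set.range x.1)) ≤ V} :=
    ((lowerSemicontinuous_iff_isClosed_preimage.1
      (lowerSemicontinuous_radialMeasure_convexHull f)) V).preimage continuous_fst
  -- A minimiser of the sum of squared norms replaces an infinite iteration: lower semicontinuity
  -- keeps the constraint on the measure closed, every further symmetrization stays in this compact
  -- set, and so the decrease in `sum_norm_sq_steiner` must vanish term by term.
  obtain ⟨⟨v', z'⟩, ⟨⟨h1, h2, h3⟩, h4⟩, hmin⟩ :=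
    ((isCompact_setOf_configurations (E := E) hσ R ρ).inter_right hclosed).exists_isMinOn
      ⟨(v, z), ⟨hR, hz, hball⟩, le_refl V⟩ (f := fun x => ∑ i, ‖x.1 i‖ ^ 2) (by fun_prop)
  simp only [Set.mem_ofPred_eq] at h1 h2 h3 h4
  refine ⟨v', z', h1, h2, h3, h4, fun p q hpq hs => ?_⟩
  rcases eq_or_ne (v' p - v' q) 0 with hu | hu
  · exact ⟨fun i _ _ => by simp [hu], by rw [sub_eq_zero.1 hu]⟩
  obtain ⟨z'', hz''⟩ := h2.steiner hpq hs hu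
  have hle : ∑ i, ‖v' i‖ ^ 2 ≤ ∑ i, ‖steiner v' p q i‖ ^ 2 := by
    refine hmin (a := (steiner v' p q, z'')) ⟨⟨norm_steiner_le hpq hu h1, hz'', ?_⟩, ?_⟩
    · exact closedBall_subset_convexHull_steiner hpq hu (h2.mul_nonneg hσ hs)
        (affine_dependency_unique hcard hρ h3 h2.ne_zero h2.sum h2.sum_smul) h3
    · exact (radialMeasure_steiner_le hf hfm v' hpq hu).trans h4
  rw [sum_norm_sq_steiner v' hpq hu] at hle
  have hu' : 0 < ‖v' p - v' q‖ ^ 2 := by have := norm_pos_iff.2 hu; positivity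
  set S := ∑ i ∈ (Finset.univ.erase p).erase q, coordAlong (v' p - v' q) (v' i) ^ 2 with hS
  have hS0 : 0 ≤ S := Finset.sum_nonneg fun _ _ => sq_nonneg _
  set T := coordAlong (v' p - v' q) (v' p) + coordAlong (v' p - v' q) (v' q) with hT
  have hle' : S + T ^ 2 / 2 ≤ 0 := by
    by_contra! hlt
    nlinarith [mul_pos hlt hu']
  have hS1 : S = 0 := by nlinarith [sq_nonneg T]
  have hT1 : T = 0 := by
    have : T ^ 2 = 0 := by nlinarith [sq_nonneg T]
    exact pow_eq_zero_iff two_ne_zero |>.1 this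
  constructor
  · intro i hip hiq
    have h5 := (Finset.sum_eq_zero_iff_of_nonneg fun _ _ => sq_nonneg _).1 hS1 i (by simp [hip, hiq])
    have h6 : coordAlong (v' p - v' q) (v' i) = 0 := pow_eq_zero_iff two_ne_zero |>.1 h5
    rw [coordAlong, div_eq_zero_iff] at h6
    exact h6.resolve_right hu'.ne'
  · rw [hT, ← coordAlong_add, coordAlong, div_eq_zero_iff] at hT1
    have h7 := hT1.resolve_right hu'.ne'
    rw [real_inner_comm, real_inner_add_sub_eq_zero_iff] at h7
    exact h7

/-- `a` and `b` are the vertices of regular simplices with centre `0` and circumradii `r` and `t`,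
lying in orthogonal subspaces. -/
structure IsOrthoFrame {E : Type*} [NormedAddCommGroup E] [InnerProductSpace ℝ E] {k m : ℕ}
    (a : Fin (k + 1) → E) (b : Fin (m + 1) → E) (r t : ℝ) : Prop where
  r_pos : 0 < r
  t_pos : 0 < t
  norm_a : ∀ i, ‖a i‖ = r
  norm_b : ∀ i, ‖b i‖ = t
  sum_a : ∑ i, a i = 0
  sum_b : ∑ i, b i = 0
  inner_a : ∀ i j, i ≠ j → k * ⟪a i, a j⟫ = -r ^ 2
  inner_b : ∀ i j, i ≠ j → m * ⟪b i, b j⟫ = -t ^ 2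
  inner_ab : ∀ i j, ⟪a i, b j⟫ = 0

theorem IsOrthoFrame.symm {E : Type*} [NormedAddCommGroup E] [InnerProductSpace ℝ E] {k m : ℕ}
    {a : Fin (k + 1) → E} {b : Fin (m + 1) → E} {r t : ℝ} (h : IsOrthoFrame a b r t) :
    IsOrthoFrame b a t r :=
  ⟨h.t_pos, h.r_pos, h.norm_b, h.norm_a, h.sum_b, h.sum_a, h.inner_b, h.inner_a, fun i j => by
    rw [real_inner_comm]; exact h.inner_ab j i⟩

/-- The sign pattern of the Radon partition into `k + 1` and `m + 1` points. -/
def radonSign (k m : ℕ) : Fin (k + 1) ⊕ Fin (m + 1) → ℝ := Sum.elim (fun _ => 1) (fun _ => -1)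

theorem radonSign_eq (k m : ℕ) (i : Fin (k + 1) ⊕ Fin (m + 1)) :
    radonSign k m i = 1 ∨ radonSign k m i = -1 := by
  rcases i with i | i <;> simp [radonSign]

/-- By orthogonality all points other than `a j` have the same inner product with `a j`; as the
points sum to zero, these `n` equal numbers add up to `-‖a j‖ ^ 2`. -/
theorem sum_eq_zero_and_inner_of_symmetric {n : ℕ} {a : Fin (n + 1) → E}
    (hsum : ∑ i, a i = 0) (horth : ∀ p q i, p ≠ q → i ≠ p → i ≠ q → ⟪a p - a q, a i⟫ = 0)
    (i j : Fin (n + 1)) (hij : i ≠ j) : n * ⟪a i, a j⟫ = -‖a j‖ ^ 2 := by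
  have h0 : ∑ l, ⟪a l, a j⟫ = 0 := by rw [← sum_inner, hsum, inner_zero_left]
  rw [← Finset.add_sum_erase _ _ (Finset.mem_univ j), real_inner_self_eq_norm_sq,
    Finset.sum_congr rfl (g := fun _ => ⟪a i, a j⟫)] at h0
  · simp at h0
    linarith
  · intro l hl
    rcases eq_or_ne l i with rfl | hli
    · rfl
    have := horth l i j hli (Finset.ne_of_mem_erase hl).symm hij.symm
    rw [inner_sub_left] at this
    linarith

/-- The crux is that both classes have centroid `0`. A combination `w` with weights constant on each
class has, by symmetry, constant inner product with the points of each class. The Radon dependency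
forces the two constants to agree, and then `w = 0` since the hull contains a ball. Indicator
weights give the two centroids. -/
theorem isOrthoFrame_of_symmetric {k m : ℕ} (hk : 1 ≤ k) (hm : 1 ≤ m)
    (hcard : k + m = Module.finrank ℝ E) {ρ : ℝ} (hρ : 0 < ρ)
    {v : Fin (k + 1) ⊕ Fin (m + 1) → E} {z : Fin (k + 1) ⊕ Fin (m + 1) → ℝ}
    (hz : IsRadonDependency (radonSign k m) v z)
    (hball : Metric.closedBall 0 ρ ⊆ convexHull ℝ (Set.range v))
    (hsymm : ∀ p q, p ≠ q → radonSign k m p = radonSign k m q →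
        (∀ i, i ≠ p → i ≠ q → ⟪v p - v q, v i⟫ = 0) ∧ ‖v p‖ = ‖v q‖) :
    IsOrthoFrame (fun i => v (Sum.inl i)) (fun i => v (Sum.inr i)) ‖v (Sum.inl 0)‖
      ‖v (Sum.inr 0)‖ := by
  set σ := radonSign k m with hσ
  have hdep := affine_dependency_unique
    (by simp; omega) hρ hball hz.ne_zero hz.sum hz.sum_smul
  -- a weighted sum with weights constant on the two sides vanishes
  have hg : ∀ g : Fin (k + 1) ⊕ Fin (m + 1) → ℝ, (∀ p q, σ p = σ q → g p = g q) →
      ∑ i, g i • v i = 0 := by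
    intro g hg
    set w := ∑ i, g i • v i with hw
    have hF : ∀ p q, σ p = σ q → ⟪w, v p⟫ = ⟪w, v q⟫ := by
      intro p q hpq
      rcases eq_or_ne p q with rfl | hne
      · rfl
      obtain ⟨h1, h2⟩ := hsymm p q hne hpq
      have h3 : ⟪v p - v q, w⟫ = 0 := by
        rw [hw, inner_sum, Finset.sum_eq_add p q hne]
        · rw [inner_smul_right, inner_smul_right, ← hg p q hpq, ← mul_add, ← inner_add_right,
            real_inner_comm, (real_inner_add_sub_eq_zero_iff _ _).2 h2, mul_zero]
        · intro i _ hi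
          rw [inner_smul_right, h1 i hi.1 hi.2, mul_zero]
        · simp
        · simp
      rw [real_inner_comm, inner_sub_right] at h3
      linarith
    set α := (⟪w, v (Sum.inl 0)⟫ + ⟪w, v (Sum.inr 0)⟫) / 2 with hα
    set β := (⟪w, v (Sum.inl 0)⟫ - ⟪w, v (Sum.inr 0)⟫) / 2 with hβ
    have hF' : ∀ i, ⟪w, v i⟫ = α + β * σ i := by
      rintro (i | i)
      · rw [hF (Sum.inl i) (Sum.inl 0) (by simp [hσ, radonSign]), hα, hβ]
        simp [hσ, radonSign]
        ring
      · rw [hF (Sum.inr i) (Sum.inr 0) (by simp [hσ, radonSign]), hα, hβ]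
        simp [hσ, radonSign]
        ring
    -- Pairing `w` with the dependency gives `α * 0 + β * 1 = 0`.
    have hβ0 : β = 0 := by
      have h4 : ⟪w, ∑ i, z i • v i⟫ = 0 := by rw [hz.sum_smul, inner_zero_right]
      rw [inner_sum] at h4
      have h5 : ∀ i, ⟪w, z i • v i⟫ = α * z i + β * (σ i * z i) := fun i => by
        rw [inner_smul_right, hF']; ring
      simp only [h5, Finset.sum_add_distrib, ← Finset.mul_sum, hz.sum, hz.sum_sign] at h4
      linarith
    exact eq_zero_of_inner_eq_const hρ hball (c := α) fun i => by rw [hF', hβ0]; ring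
  have hsa : ∑ i, v (Sum.inl i) = 0 := by
    have := hg (Sum.elim (fun _ => 1) fun _ => 0) (by
      rintro (p | p) (q | q) h <;> simp [hσ, radonSign] at h ⊢ <;> norm_num at h)
    simpa [Fintype.sum_sum_type] using this
  have hsb : ∑ i, v (Sum.inr i) = 0 := by
    have := hg (Sum.elim (fun _ => 0) fun _ => 1) (by
      rintro (p | p) (q | q) h <;> simp [hσ, radonSign] at h ⊢ <;> norm_num at h)
    simpa [Fintype.sum_sum_type] using this
  have hna : ∀ i, ‖v (Sum.inl i)‖ = ‖v (Sum.inl 0)‖ := by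
    intro i
    rcases eq_or_ne i 0 with rfl | hi
    · rfl
    exact (hsymm (Sum.inl i) (Sum.inl 0) (by simpa using hi) (by simp [hσ, radonSign])).2
  have hnb : ∀ i, ‖v (Sum.inr i)‖ = ‖v (Sum.inr 0)‖ := by
    intro i
    rcases eq_or_ne i 0 with rfl | hi
    · rfl
    exact (hsymm (Sum.inr i) (Sum.inr 0) (by simpa using hi) (by simp [hσ, radonSign])).2
  -- Coinciding points would give a dependency with coefficients `1` and `-1` at `p` and `q`,
  -- whereas all dependencies are multiples of `z`, which has no opposite signs there.
  have hne : ∀ p q, p ≠ q → σ p = σ q → v p ≠ v q := by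
    intro p q hpq hs heq
    obtain ⟨θ, hθ⟩ := hdep (fun i => (Pi.single p 1 : _ → ℝ) i - (Pi.single q 1 : _ → ℝ) i)
      (by simp) (by
        simp only [sub_smul, Finset.sum_sub_distrib, Pi.single_apply, ite_smul, one_smul, zero_smul,
          Finset.sum_ite_eq', Finset.mem_univ, if_true, heq, sub_self])
    have h1 := congrFun hθ p
    have h2 := congrFun hθ q
    simp [hpq, hpq.symm] at h1 h2
    have h3 := hz.mul_nonneg (radonSign_eq k m) hs
    have h4 : (θ * z p) * (θ * z q) = θ ^ 2 * (z p * z q) := by ring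
    rw [← h1, ← h2] at h4
    have : 0 ≤ θ ^ 2 * (z p * z q) := by positivity
    linarith
  refine ⟨?_, ?_, hna, hnb, hsa, hsb, fun i j hij => ?_, fun i j hij => ?_, fun i j => ?_⟩
  · rw [norm_pos_iff]
    intro h0
    have h1 : v (Sum.inl (Fin.last k)) = 0 := by rw [← norm_eq_zero, hna, h0, norm_zero]
    refine hne (Sum.inl 0) (Sum.inl (Fin.last k)) ?_ (by simp [hσ, radonSign]) (by rw [h0, h1])
    simp [Fin.ext_iff]; omega
  · rw [norm_pos_iff]
    intro h0
    have h1 : v (Sum.inr (Fin.last m)) = 0 := by rw [← norm_eq_zero, hnb, h0, norm_zero]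
    refine hne (Sum.inr 0) (Sum.inr (Fin.last m)) ?_ (by simp [hσ, radonSign]) (by rw [h0, h1])
    simp [Fin.ext_iff]; omega
  · rw [sum_eq_zero_and_inner_of_symmetric (a := fun i => v (Sum.inl i)) hsa ?_ i j hij, hna]
    intro p q i hpq hip hiq
    exact (hsymm (Sum.inl p) (Sum.inl q) (by simpa using hpq) (by simp [hσ, radonSign])).1
      (Sum.inl i) (by simpa using hip) (by simpa using hiq)
  · rw [sum_eq_zero_and_inner_of_symmetric (a := fun i => v (Sum.inr i)) hsb ?_ i j hij, hnb]
    intro p q i hpq hip hiq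
    exact (hsymm (Sum.inr p) (Sum.inr q) (by simpa using hpq) (by simp [hσ, radonSign])).1
      (Sum.inr i) (by simpa using hip) (by simpa using hiq)
  · have h0 : ∑ l, ⟪v (Sum.inl l), v (Sum.inr j)⟫ = 0 := by
      rw [← sum_inner, hsa, inner_zero_left]
    rw [Finset.sum_congr rfl (g := fun _ => ⟪v (Sum.inl i), v (Sum.inr j)⟫)] at h0
    · simp at h0
      rcases h0 with h0 | h0
      · have : (0 : ℝ) ≤ k := by positivity
        linarith
      · exact h0
    · intro l _
      rcases eq_or_ne l i with rfl | hli
      · rfl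
      have := (hsymm (Sum.inl l) (Sum.inl i) (by simpa using hli) (by simp [hσ, radonSign])).1
        (Sum.inr j) (by simp) (by simp)
      rw [inner_sub_left] at this
      linarith

/-- Symmetrization: a polytope with `d + 2` vertices containing a centred ball may be replaced by
the convex hull of two regular simplices in orthogonal subspaces. -/
theorem exists_isOrthoFrame_radialMeasure_le {f : ℝ → ENNReal} (hf : MonotoneOn f (Set.Ici 0))
    (hfm : Measurable f) {k m : ℕ} (hk : 1 ≤ k) (hm : 1 ≤ m) (hcard : k + m = Module.finrank ℝ E)
    {R ρ : ℝ} (hρ : 0 < ρ) {v : Fin (k + 1) ⊕ Fin (m + 1) → E}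
    {z : Fin (k + 1) ⊕ Fin (m + 1) → ℝ} (hR : ∀ i, ‖v i‖ ≤ R)
    (hz : IsRadonDependency (radonSign k m) v z)
    (hball : Metric.closedBall 0 ρ ⊆ convexHull ℝ (Set.range v)) :
    ∃ (a : Fin (k + 1) → E) (b : Fin (m + 1) → E) (r t : ℝ), IsOrthoFrame a b r t ∧ r ≤ R ∧ t ≤ R ∧
      Metric.closedBall 0 ρ ⊆ convexHull ℝ (Set.range a ∪ Set.range b) ∧
      radialMeasure E f (convexHull ℝ (Set.range a ∪ Set.range b)) ≤
        radialMeasure E f (convexHull ℝ (Set.range v)) := by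
  obtain ⟨v', z', h1, h2, h3, h4, h5⟩ := exists_symmetric_configuration hf hfm
    (by simp; omega) (radonSign_eq k m) hρ hR hz hball
  have hrange : Set.range (fun i => v' (Sum.inl i)) ∪ Set.range (fun i => v' (Sum.inr i)) =
      Set.range v' := by
    ext x
    simp [Sum.exists]
  refine ⟨_, _, _, _, isOrthoFrame_of_symmetric hk hm hcard hρ h2 h3 h5, h1 _, h1 _, ?_, ?_⟩
  · rwa [hrange]
  · rwa [hrange]

end Symmetrization

/-! ### Existence of a Radon partition with two classes of at least two points -/

section RadonPartition

variable {E : Type*} [NormedAddCommGroup E] [InnerProductSpace ℝ E]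

/-- The indices of positive weight form the first class; zero weights are counted with the negative
ones. Division by the sum of absolute values normalises. -/
theorem exists_isRadonDependency_of_card_pos {ι : Type*} [Fintype ι] {d : ℕ}
    (hcard : Fintype.card ι = d + 2) {w : ι → E} {z : ι → ℝ} (hz0 : ∑ i, z i = 0)
    (hzw : ∑ i, z i • w i = 0) (h2 : 2 ≤ Fintype.card {i // 0 < z i})
    (hle : 2 * Fintype.card {i // 0 < z i} ≤ d + 2) :
    ∃ k m : ℕ, 1 ≤ k ∧ k ≤ m ∧ k + m = d ∧ ∃ (e : Fin (k + 1) ⊕ Fin (m + 1) ≃ ι)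
      (z' : Fin (k + 1) ⊕ Fin (m + 1) → ℝ), IsRadonDependency (radonSign k m) (w ∘ e) z' := by
  have hc := Fintype.card_subtype_compl (fun i => 0 < z i)
  set N := Fintype.card {i // 0 < z i} with hN
  rw [hcard] at hc
  obtain ⟨k, hk⟩ : ∃ k, N = k + 1 := ⟨N - 1, by omega⟩
  obtain ⟨m, hm⟩ : ∃ m, d + 2 - N = m + 1 := ⟨d + 1 - N, by omega⟩
  refine ⟨k, m, by omega, by omega, by omega, ?_⟩
  let e₁ : Fin (k + 1) ≃ {i // 0 < z i} := (Fintype.equivFinOfCardEq (hN.symm.trans hk)).symm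
  let e₂ : Fin (m + 1) ≃ {i // ¬ 0 < z i} := (Fintype.equivFinOfCardEq (hc.trans hm)).symm
  let e : Fin (k + 1) ⊕ Fin (m + 1) ≃ ι := (Equiv.sumCongr e₁ e₂).trans (Equiv.sumCompl _)
  have hl : ∀ i, 0 < z (e (Sum.inl i)) := fun i => by simpa [e] using (e₁ i).2
  have hr : ∀ i, z (e (Sum.inr i)) ≤ 0 := fun i => by simpa [e] using (e₂ i).2
  have hsign : ∀ i, 0 ≤ radonSign k m i * z (e i) := by
    rintro (i | i)
    · simpa [radonSign] using (hl i).le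
    · simpa [radonSign] using hr i
  set S := ∑ i, radonSign k m i * z (e i) with hS
  have hSpos : 0 < S := Finset.sum_pos' (fun i _ => hsign i)
    ⟨Sum.inl 0, Finset.mem_univ _, by simpa [radonSign] using hl 0⟩
  refine ⟨e, fun i => z (e i) / S, fun i => ?_, ?_, ?_, ?_⟩
  · rw [← mul_div_assoc]
    exact div_nonneg (hsign i) hSpos.le
  · simp only [← mul_div_assoc, ← Finset.sum_div]
    rw [← hS, div_self hSpos.ne']
  · rw [← Finset.sum_div, Equiv.sum_comp e z, hz0, zero_div]
  · have h1 : ∀ i, (z (e i) / S) • (w ∘ e) i = S⁻¹ • (z (e i) • w (e i)) := fun i => by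
      rw [smul_smul, div_eq_inv_mul]; rfl
    simp only [h1, ← Finset.smul_sum]
    rw [Equiv.sum_comp e fun i => z i • w i, hzw, smul_zero]

variable [FiniteDimensional ℝ E]

/-- There is room for a redundant point: list the vertices, with repetitions, as `d + 1` points and
add the midpoint of two distinct ones. The resulting dependency has exactly two positive weights. -/
theorem exists_isRadonDependency_of_card_le {d : ℕ} (hd : 2 ≤ d) (hfin : Module.finrank ℝ E = d)
    {t : Finset E} (ht : t.card ≤ d + 1) {ρ : ℝ} (hρ : 0 < ρ)
    (hball : Metric.closedBall 0 ρ ⊆ convexHull ℝ (t : Set E)) :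
    ∃ k m : ℕ, 1 ≤ k ∧ k ≤ m ∧ k + m = d ∧ ∃ v z, IsRadonDependency (radonSign k m) v z ∧
      convexHull ℝ (Set.range v) = convexHull ℝ (t : Set E) ∧
      ∀ i, v i ∈ convexHull ℝ (t : Set E) := by
  classical
  have hne : t.Nonempty := by
    rw [Finset.nonempty_iff_ne_empty]
    rintro rfl
    have : (0 : E) ∈ convexHull ℝ ((∅ : Finset E) : Set E) := hball (by simp [hρ.le])
    simp at this
  obtain ⟨x₀, hx₀⟩ := hne
  have : Nonempty t := ⟨⟨x₀, hx₀⟩⟩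
  obtain ⟨φ⟩ : Nonempty (t ↪ Fin (d + 1)) := Function.Embedding.nonempty_of_card_le (by simpa using ht)
  set g : Fin (d + 1) → E := fun i => ((Function.invFun φ i : t) : E) with hg
  have hrange : Set.range g = t := by
    ext x
    constructor
    · rintro ⟨i, rfl⟩
      exact (Function.invFun φ i : t).2
    · intro hx
      exact ⟨φ ⟨x, hx⟩, by rw [hg]; simp [Function.leftInverse_invFun φ.injective _]⟩
  obtain ⟨i, j, hij⟩ : ∃ i j, g i ≠ g j := by
    by_contra! h
    have hz : ∀ z : E, z = 0 := fun z =>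
      eq_zero_of_inner_eq_const hρ (by rw [hrange]; exact hball) (c := ⟪z, g 0⟫)
        fun i => by rw [h i 0]
    have : Subsingleton E := ⟨fun x y => (hz x).trans (hz y).symm⟩
    rw [Module.finrank_zero_of_subsingleton] at hfin
    omega
  have hij' : i ≠ j := fun h => hij (by rw [h])
  set w : Option (Fin (d + 1)) → E := fun o => o.elim ((1 / 2 : ℝ) • g i + (1 / 2 : ℝ) • g j) g with hw
  set z : Option (Fin (d + 1)) → ℝ := fun o => o.elim (-1) fun l =>
    (if l = i then 1 / 2 else 0) + (if l = j then 1 / 2 else 0) with hz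
  have hpos : Fintype.card {o // 0 < z o} = 2 := by
    rw [Fintype.card_subtype]
    have : (Finset.univ.filter fun o => 0 < z o) = {some i, some j} := by
      ext o
      rcases o with _ | l
      · simp [hz]
      · rcases eq_or_ne l i with rfl | hli
        · simp [hz, hij']
        · rcases eq_or_ne l j with rfl | hlj
          · simp [hz, hli]
          · simp [hz, hli, hlj]
    rw [this, Finset.card_pair (by simpa using hij')]
  obtain ⟨k, m, h1, h2, h3, e, z', h4⟩ := exists_isRadonDependency_of_card_pos (d := d)
    (w := w) (z := z) (by simp)
    (by rw [Fintype.sum_option]; simp [hz, Finset.sum_add_distrib]; norm_num)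
    (by
      rw [Fintype.sum_option]
      simp [hz, hw, add_smul, Finset.sum_add_distrib, ite_smul]
      abel) hpos.ge
    (by rw [hpos]; omega)
  have hmem : ∀ o, w o ∈ convexHull ℝ (t : Set E) := by
    have hgm : ∀ l, g l ∈ convexHull ℝ (t : Set E) := fun l =>
      subset_convexHull ℝ _ (hrange ▸ ⟨l, rfl⟩)
    rintro (_ | l)
    · exact (convex_convexHull ℝ _) (hgm i) (hgm j) (by norm_num) (by norm_num) (by norm_num)
    · exact hgm l
  refine ⟨k, m, h1, h2, h3, w ∘ e, z', h4, ?_, fun i => hmem _⟩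
  rw [e.surjective.range_comp]
  apply subset_antisymm
  · refine convexHull_min ?_ (convex_convexHull ℝ _)
    rintro x ⟨o, rfl⟩
    exact hmem o
  · refine convexHull_mono ?_
    rw [← hrange]
    rintro x ⟨l, rfl⟩
    exact ⟨some l, rfl⟩

/-- Solved for `p`, the dependency exhibits it as a convex combination of the other points. -/
theorem convexHull_erase_of_dependency [DecidableEq E] {t : Finset E} {f : E → ℝ}
    (h0 : ∑ e ∈ t, f e = 0) (h1 : ∑ e ∈ t, f e • e = 0) {p : E} (hp : p ∈ t) (hfp : 0 < f p)
    (huniq : ∀ x ∈ t, 0 < f x → x = p) :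
    convexHull ℝ ((t.erase p : Finset E) : Set E) = convexHull ℝ (t : Set E) := by
  apply subset_antisymm (convexHull_mono (by simp))
  have hmem : p ∈ convexHull ℝ ((t.erase p : Finset E) : Set E) := by
    rw [Finset.mem_convexHull']
    rw [← Finset.add_sum_erase _ _ hp] at h0 h1
    refine ⟨fun x => -f x / f p, fun x hx => ?_, ?_, ?_⟩
    · have hx' := Finset.mem_erase.1 hx
      have : f x ≤ 0 := by
        by_contra! h
        exact hx'.1 (huniq x hx'.2 h)
      exact div_nonneg (by linarith) hfp.le
    · rw [← Finset.sum_div, Finset.sum_neg_distrib, div_eq_one_iff_eq hfp.ne']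
      linarith
    · have h2 : ∀ x ∈ t.erase p, (-f x / f p) • x = (-(f p)⁻¹) • (f x • x) := fun x _ => by
        rw [smul_smul]; congr 1; ring
      rw [Finset.sum_congr rfl h2, ← Finset.smul_sum, eq_neg_of_add_eq_zero_right h1, smul_neg,
        neg_smul, neg_neg, smul_smul, inv_mul_cancel₀ hfp.ne', one_smul]
  refine convexHull_min (fun x hx => ?_) (convex_convexHull ℝ _)
  rcases eq_or_ne x p with rfl | hxp
  · exact hmem
  · exact subset_convexHull ℝ _ (by simpa [hxp] using hx)

/-- A polytope with at most `d + 2` vertices which contains a centred ball is the convex hull of a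
configuration with a Radon partition into `k + 1` and `m + 1` points, `1 ≤ k ≤ m`. -/
theorem exists_isRadonDependency {d : ℕ} (hd : 2 ≤ d) (hfin : Module.finrank ℝ E = d)
    {t : Finset E} (ht : t.card ≤ d + 2) {ρ : ℝ} (hρ : 0 < ρ)
    (hball : Metric.closedBall 0 ρ ⊆ convexHull ℝ (t : Set E)) :
    ∃ k m : ℕ, 1 ≤ k ∧ k ≤ m ∧ k + m = d ∧ ∃ v z, IsRadonDependency (radonSign k m) v z ∧
      convexHull ℝ (Set.range v) = convexHull ℝ (t : Set E) ∧
      ∀ i, v i ∈ convexHull ℝ (t : Set E) := by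
  classical
  rcases Nat.lt_or_ge t.card (d + 2) with hlt | hge
  · exact exists_isRadonDependency_of_card_le hd hfin (by omega) hρ hball
  have hcard : t.card = d + 2 := le_antisymm ht hge
  -- a dependency with exactly one positive coefficient makes a point superfluous
  have hsingle : ∀ f : E → ℝ, ∑ e ∈ t, f e = 0 → ∑ e ∈ t, f e • e = 0 → (∃ x ∈ t, 0 < f x) →
      Fintype.card {i : t // 0 < f i} < 2 →
      ∃ k m : ℕ, 1 ≤ k ∧ k ≤ m ∧ k + m = d ∧ ∃ v z, IsRadonDependency (radonSign k m) v z ∧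
      convexHull ℝ (Set.range v) = convexHull ℝ (t : Set E) ∧
      ∀ i, v i ∈ convexHull ℝ (t : Set E) := by
    rintro f h0 h1 ⟨p, hp, hfp⟩ hlt
    have hconv := convexHull_erase_of_dependency h0 h1 hp hfp fun x hx hfx => by
      have hsub : Subsingleton {i : t // 0 < f i} :=
        Fintype.card_le_one_iff_subsingleton.1 (by omega)
      have := Subsingleton.elim (⟨⟨x, hx⟩, hfx⟩ : {i : t // 0 < f i}) ⟨⟨p, hp⟩, hfp⟩
      simpa using this
    rw [← hconv]
    exact exists_isRadonDependency_of_card_le hd hfin (by rw [Finset.card_erase_of_mem hp]; omega)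
      hρ (hconv.symm ▸ hball)
  have hmulti : ∀ f : E → ℝ, ∑ e ∈ t, f e = 0 → ∑ e ∈ t, f e • e = 0 →
      2 ≤ Fintype.card {i : t // 0 < f i} → 2 * Fintype.card {i : t // 0 < f i} ≤ d + 2 →
      ∃ k m : ℕ, 1 ≤ k ∧ k ≤ m ∧ k + m = d ∧ ∃ v z, IsRadonDependency (radonSign k m) v z ∧
      convexHull ℝ (Set.range v) = convexHull ℝ (t : Set E) ∧
      ∀ i, v i ∈ convexHull ℝ (t : Set E) := by
    intro f h0 h1 h2 h3
    obtain ⟨k, m, hk, hm, hkm, e, z', hz'⟩ := exists_isRadonDependency_of_card_pos (d := d)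
      (ι := t) (w := fun x => (x : E)) (z := fun x => f x) (by simpa using hcard)
      (by rw [← h0]; exact Finset.sum_coe_sort t f)
      (by rw [← h1]; exact Finset.sum_coe_sort t fun x => f x • x) h2 h3
    refine ⟨k, m, hk, hm, hkm, _, z', hz', ?_, fun i => ?_⟩
    · rw [e.surjective.range_comp]
      simp
    · exact subset_convexHull ℝ _ (e i).2
  obtain ⟨f, hf1, hf0, hfne⟩ := Module.exists_nontrivial_relation_sum_zero_of_finrank_succ_lt_card
    (R := ℝ) (t := t) (by rw [hfin, hcard]; omega)
  have hpos : ∃ x ∈ t, 0 < f x := Finset.exists_pos_of_sum_zero_of_exists_nonzero f hf0 hfne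
  have hf0' : ∑ e ∈ t, (-f e) = 0 := by rw [Finset.sum_neg_distrib, hf0, neg_zero]
  have hf1' : ∑ e ∈ t, (-f e) • e = 0 := by
    simp only [neg_smul, Finset.sum_neg_distrib, hf1, neg_zero]
  have hneg : ∃ x ∈ t, 0 < -f x := by
    refine Finset.exists_pos_of_sum_zero_of_exists_nonzero _ hf0' ?_
    simpa using hfne
  rcases Nat.lt_or_ge (Fintype.card {i : t // 0 < f i}) 2 with h | h
  · exact hsingle f hf0 hf1 hpos h
  rcases Nat.lt_or_ge (Fintype.card {i : t // 0 < -f i}) 2 with h' | h'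
  · exact hsingle (fun x => -f x) hf0' hf1' hneg h'
  have hsum : Fintype.card {i : t // 0 < f i} + Fintype.card {i : t // 0 < -f i} ≤ d + 2 := by
    rw [Fintype.card_subtype, Fintype.card_subtype, ← Finset.card_union_of_disjoint]
    · refine (Finset.card_le_univ _).trans ?_
      simp [hcard]
    · rw [Finset.disjoint_filter]
      intro x _ h1
      linarith
  -- After a possible change of sign, the positive class holds at most half of the points.
  rcases Nat.lt_or_ge (d + 2) (2 * Fintype.card {i : t // 0 < f i}) with h3 | h3
  · exact hmulti (fun x => -f x) hf0' hf1' h' (by omega)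
  · exact hmulti f hf0 hf1 h h3

end RadonPartition

/-! ### Volume of a simplex with one vertex at the origin -/

section CornerSimplex

variable {E : Type*} [NormedAddCommGroup E] [InnerProductSpace ℝ E]

/-- The simplex with vertices `0` and `e i`. -/
def cornerSimplex {ι : Type*} (e : ι → E) : Set E := convexHull ℝ (insert 0 (Set.range e))

theorem mem_cornerSimplex {ι : Type*} [Fintype ι] {e : ι → E} {x : E} :
    x ∈ cornerSimplex e ↔ ∃ c : ι → ℝ, (∀ i, 0 ≤ c i) ∧ ∑ i, c i ≤ 1 ∧ ∑ i, c i • e i = x := by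
  have hr : insert 0 (Set.range e) = Set.range fun o : Option ι => o.elim 0 e := by
    ext y
    simp [Option.exists, eq_comm]
  rw [cornerSimplex, hr, mem_convexHull_range_iff_exists_stdSimplex]
  constructor
  · rintro ⟨c, hc, h⟩
    have hs := hc.2
    rw [Fintype.sum_option] at h hs
    exact ⟨fun i => c (some i), fun i => hc.1 _, by linarith [hc.1 none], by simpa using h⟩
  · rintro ⟨c, hc, hs, h⟩
    refine ⟨fun o => o.elim (1 - ∑ i, c i) c, ⟨?_, ?_⟩, ?_⟩
    · rintro (_ | i)
      · simpa using hs
      · exact hc i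
    · rw [Fintype.sum_option]; simp
    · rw [Fintype.sum_option]; simpa using h

theorem measurableSet_cornerSimplex [MeasurableSpace E] [BorelSpace E] {ι : Type*} [Finite ι]
    (e : ι → E) : MeasurableSet (cornerSimplex e) :=
  (((Set.finite_range e).insert 0).isCompact_convexHull ℝ).isClosed.measurableSet

variable [FiniteDimensional ℝ E] [MeasurableSpace E] [BorelSpace E]

/-- The volume of the corner simplex of an orthonormal basis. -/
noncomputable def cornerVolume (E : Type*) [NormedAddCommGroup E] [InnerProductSpace ℝ E]
    [FiniteDimensional ℝ E] [MeasurableSpace E] [BorelSpace E] : ENNReal :=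
  volume (cornerSimplex (stdOrthonormalBasis ℝ E))

/-- The simplex is a linear image of the one over an orthonormal basis, and the Gram matrix is `Mᵀ *
M` for the matrix `M` of that map. -/
theorem volume_cornerSimplex {ι : Type*} [Fintype ι] [DecidableEq ι]
    (hcard : Fintype.card ι = Module.finrank ℝ E) (e : ι → E) :
    volume (cornerSimplex e) =
      ENNReal.ofReal (√(Matrix.of fun i j => ⟪e i, e j⟫).det) * cornerVolume E := by
  set B : OrthonormalBasis ι ℝ E := (stdOrthonormalBasis ℝ E).reindex
    (Fintype.equivFinOfCardEq hcard).symm with hB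
  have hB' : cornerSimplex B = cornerSimplex (stdOrthonormalBasis ℝ E) := by
    rw [cornerSimplex, cornerSimplex, hB, OrthonormalBasis.coe_reindex,
      (Equiv.surjective _).range_comp]
  set f : E →ₗ[ℝ] E := B.toBasis.constr ℝ e with hf
  have hfB : ∀ i, f (B i) = e i := fun i => by
    rw [hf, ← B.coe_toBasis, Module.Basis.constr_basis]
  have himage : f '' cornerSimplex B = cornerSimplex e := by
    rw [cornerSimplex, f.image_convexHull, Set.image_insert_eq, map_zero, ← Set.range_comp]
    congr
    ext i
    exact hfB i
  have hdet : |LinearMap.det f| = √(Matrix.of fun i j => ⟪e i, e j⟫).det := by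
    set M := LinearMap.toMatrix B.toBasis B.toBasis f with hM
    have hgram : (Matrix.of fun i j => ⟪e i, e j⟫) = M.transpose * M := by
      ext i j
      rw [Matrix.mul_apply, Matrix.of_apply, ← B.sum_inner_mul_inner]
      refine Finset.sum_congr rfl fun l _ => ?_
      rw [Matrix.transpose_apply, hM, LinearMap.toMatrix_apply, LinearMap.toMatrix_apply,
        B.coe_toBasis, hfB, hfB, B.coe_toBasis_repr_apply, B.coe_toBasis_repr_apply,
        B.repr_apply_apply, B.repr_apply_apply, real_inner_comm]
    rw [hgram, Matrix.det_mul, Matrix.det_transpose, ← sq, Real.sqrt_sq_eq_abs, hM,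
      LinearMap.det_toMatrix]
  rw [← himage, Measure.addHaar_image_linearMap, hdet, hB', cornerVolume]

theorem cornerVolume_ne_top : cornerVolume E ≠ ⊤ :=
  (((Set.finite_range _).insert 0).isCompact_convexHull ℝ).measure_lt_top.ne

/-- Together with finiteness this lets the common factor be cancelled when volumes are compared. -/
theorem cornerVolume_ne_zero : cornerVolume E ≠ 0 := by
  refine (Measure.measure_pos_of_nonempty_interior _ ?_).ne'
  rw [cornerSimplex, interior_convexHull_nonempty_iff_affineSpan_eq_top, ← SetLike.coe_set_eq,
    affineSpan_insert_zero]
  have := (stdOrthonormalBasis ℝ E).toBasis.span_eq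
  rw [OrthonormalBasis.coe_toBasis] at this
  rw [this]
  rfl

end CornerSimplex

/-! ### Facets and inradius of the hull of an orthogonal pair -/

section RegularSimplex

variable {E : Type*} [NormedAddCommGroup E] [InnerProductSpace ℝ E] {k m : ℕ}
  {a : Fin (k + 1) → E} {b : Fin (m + 1) → E} {r t : ℝ}

theorem IsOrthoFrame.inner_a_eq (h : IsOrthoFrame a b r t) (hk : 1 ≤ k) (i j : Fin (k + 1)) :
    ⟪a i, a j⟫ = r ^ 2 / k * ((k + 1) * (if i = j then 1 else 0) - 1) := by
  have hk0 : (k : ℝ) ≠ 0 := by positivity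
  split_ifs with hij
  · rw [hij, real_inner_self_eq_norm_sq, h.norm_a]
    field_simp
    ring
  · have := h.inner_a i j hij
    field_simp
    linarith

theorem IsOrthoFrame.inner_sum_a (h : IsOrthoFrame a b r t) (hk : 1 ≤ k) (s : Fin (k + 1) → ℝ)
    (s' : Fin (m + 1) → ℝ) (i : Fin (k + 1)) :
    ⟪∑ l, s l • a l + ∑ l, s' l • b l, a i⟫ = r ^ 2 / k * ((k + 1) * s i - ∑ l, s l) := by
  rw [inner_add_left, sum_inner, sum_inner]
  have h1 : ∀ l, ⟪s' l • b l, a i⟫ = 0 := fun l => by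
    rw [inner_smul_left, real_inner_comm, h.inner_ab]; simp
  have h2 : ∀ l, ⟪s l • a l, a i⟫ = r ^ 2 / k * ((k + 1) * (s l * if l = i then 1 else 0) - s l) :=
    fun l => by
      rw [inner_smul_left, h.inner_a_eq hk]
      split_ifs <;> simp <;> ring
  simp only [h1, h2, Finset.sum_const_zero, add_zero, ← Finset.mul_sum, Finset.sum_sub_distrib]
  simp

theorem IsOrthoFrame.inner_sum_b (h : IsOrthoFrame a b r t) (hm : 1 ≤ m) (s : Fin (k + 1) → ℝ)
    (s' : Fin (m + 1) → ℝ) (i : Fin (m + 1)) :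
    ⟪∑ l, s l • a l + ∑ l, s' l • b l, b i⟫ = t ^ 2 / m * ((m + 1) * s' i - ∑ l, s' l) := by
  rw [add_comm]
  exact h.symm.inner_sum_a hm s' s i

/-- Omitting one vertex from each simplex leaves `k + m` linearly independent vectors, which span
the space. -/
theorem IsOrthoFrame.eq_zero_of_inner_eq_zero [FiniteDimensional ℝ E] (h : IsOrthoFrame a b r t)
    (hk : 1 ≤ k) (hm : 1 ≤ m) (hfin : k + m = Module.finrank ℝ E) {x : E}
    (ha : ∀ i, ⟪x, a i⟫ = 0) (hb : ∀ j, ⟪x, b j⟫ = 0) : x = 0 := by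
  set e : Fin k ⊕ Fin m → E := Sum.elim (fun i => a i.succ) (fun j => b j.succ) with he
  have hr := h.r_pos
  have ht := h.t_pos
  have hli : LinearIndependent ℝ e := by
    rw [Fintype.linearIndependent_iff]
    intro g hg
    rw [Fintype.sum_sum_type] at hg
    -- The omitted vertices get weight `0`; pairing with them shows that the weights sum to zero on
    -- each side, and pairing with the others then kills each weight.
    have hg' : ∑ l, (Fin.cons 0 (fun i => g (Sum.inl i)) : Fin (k + 1) → ℝ) l • a l +
        ∑ l, (Fin.cons 0 (fun i => g (Sum.inr i)) : Fin (m + 1) → ℝ) l • b l = 0 := by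
      rw [Fin.sum_univ_succ, Fin.sum_univ_succ]
      simpa [he] using hg
    have h1 := h.inner_sum_a hk (Fin.cons 0 (fun i => g (Sum.inl i)))
      (Fin.cons 0 (fun i => g (Sum.inr i)))
    have h2 := h.inner_sum_b hm (Fin.cons 0 (fun i => g (Sum.inl i)))
      (Fin.cons 0 (fun i => g (Sum.inr i)))
    simp only [hg', inner_zero_left] at h1 h2
    have hk0 : (0 : ℝ) < r ^ 2 / k := by positivity
    have hm0 : (0 : ℝ) < t ^ 2 / m := by positivity
    have h3 := (mul_eq_zero.1 (h1 0).symm).resolve_left hk0.ne'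
    have h4 := (mul_eq_zero.1 (h2 0).symm).resolve_left hm0.ne'
    rw [Fin.cons_zero] at h3 h4
    rintro (i | i)
    · have h5 := (mul_eq_zero.1 (h1 i.succ).symm).resolve_left hk0.ne'
      rw [Fin.cons_succ] at h5
      have : ((k : ℝ) + 1) * g (Sum.inl i) = 0 := by linarith
      exact (mul_eq_zero.1 this).resolve_left (by positivity)
    · have h5 := (mul_eq_zero.1 (h2 i.succ).symm).resolve_left hm0.ne'
      rw [Fin.cons_succ] at h5
      have : ((m : ℝ) + 1) * g (Sum.inr i) = 0 := by linarith
      exact (mul_eq_zero.1 this).resolve_left (by positivity)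
  have hspan := hli.span_eq_top_of_card_eq_finrank' (by simpa using hfin)
  have hx : x ∈ (Submodule.span ℝ (Set.range e))ᗮ := by
    rw [Submodule.mem_orthogonal']
    intro y hy
    induction hy using Submodule.span_induction with
    | mem y hy =>
      obtain ⟨i | i, rfl⟩ := hy
      · exact ha _
      · exact hb _
    | zero => simp
    | add y z _ _ hy hz => rw [inner_add_right, hy, hz, add_zero]
    | smul c y _ hy => rw [inner_smul_right, hy, mul_zero]
  rw [hspan, Submodule.top_orthogonal_eq_bot] at hx
  simpa using hx

theorem mem_convexHull_range_union_iff {x : E} :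
    x ∈ convexHull ℝ (Set.range a ∪ Set.range b) ↔ ∃ (s : Fin (k + 1) → ℝ) (s' : Fin (m + 1) → ℝ),
      (∀ i, 0 ≤ s i) ∧ (∀ i, 0 ≤ s' i) ∧ ∑ i, s i + ∑ i, s' i = 1 ∧
      ∑ i, s i • a i + ∑ i, s' i • b i = x := by
  rw [← Set.Sum.elim_range, mem_convexHull_range_iff_exists_stdSimplex]
  constructor
  · rintro ⟨c, hc, rfl⟩
    refine ⟨fun i => c (Sum.inl i), fun i => c (Sum.inr i), fun i => hc.1 _, fun i => hc.1 _, ?_, ?_⟩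
    · rw [← Fintype.sum_sum_type, hc.2]
    · rw [Fintype.sum_sum_type]; simp
  · rintro ⟨s, s', h1, h2, h3, rfl⟩
    refine ⟨Sum.elim s s', ⟨by rintro (i | i) <;> simp [h1, h2], ?_⟩, ?_⟩
    · rw [Fintype.sum_sum_type]; simpa using h3
    · rw [Fintype.sum_sum_type]; simp

theorem IsOrthoFrame.mem_of_sum_le (h : IsOrthoFrame a b r t) {s : Fin (k + 1) → ℝ}
    {s' : Fin (m + 1) → ℝ} (hs : ∀ i, 0 ≤ s i) (hs' : ∀ i, 0 ≤ s' i)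
    (hsum : ∑ i, s i + ∑ i, s' i ≤ 1) :
    ∑ i, s i • a i + ∑ i, s' i • b i ∈ convexHull ℝ (Set.range a ∪ Set.range b) := by
  rw [mem_convexHull_range_union_iff]
  have hk : (0 : ℝ) < (k : ℝ) + 1 := by positivity
  set c := (1 - (∑ i, s i + ∑ i, s' i)) / ((k : ℝ) + 1) with hc
  refine ⟨fun i => s i + c, s', fun i => add_nonneg (hs i) (div_nonneg (by linarith) hk.le), hs',
    ?_, ?_⟩
  · simp [Finset.sum_add_distrib, hc]
    field_simp
    ring
  · simp [add_smul, Finset.sum_add_distrib, ← Finset.smul_sum, h.sum_a]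

/-- The hull of an orthogonal pair of regular simplices contains the ball of radius `ρ` if its
facets have distance at least `ρ` from the origin. -/
theorem IsOrthoFrame.closedBall_subset [FiniteDimensional ℝ E] (h : IsOrthoFrame a b r t)
    (hk : 1 ≤ k) (hm : 1 ≤ m) (hfin : k + m = Module.finrank ℝ E) {ρ : ℝ}
    (hρ : ρ ^ 2 * (k ^ 2 / r ^ 2 + m ^ 2 / t ^ 2) ≤ 1) :
    Metric.closedBall 0 ρ ⊆ convexHull ℝ (Set.range a ∪ Set.range b) := by
  intro x hx
  rw [mem_closedBall_zero_iff] at hx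
  have hr := h.r_pos
  have ht := h.t_pos
  obtain ⟨i, -, hi⟩ := Finset.univ.exists_min_image (fun i => ⟪x, a i⟫) Finset.univ_nonempty
  obtain ⟨j, -, hj⟩ := Finset.univ.exists_min_image (fun j => ⟪x, b j⟫) Finset.univ_nonempty
  have hk0 : (0 : ℝ) < k := by positivity
  have hm0 : (0 : ℝ) < m := by positivity
  have hxa : ∑ l, ⟪x, a l⟫ = 0 := by rw [← inner_sum, h.sum_a, inner_zero_right]
  have hxb : ∑ l, ⟪x, b l⟫ = 0 := by rw [← inner_sum, h.sum_b, inner_zero_right]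
  -- These weights reproduce the inner products of `x` with all vertices. They are nonnegative and
  -- vanish at `i` and `j`, so `x` is placed in the cone over the facet omitting `a i` and `b j`.
  set s : Fin (k + 1) → ℝ := fun l => k / (r ^ 2 * (k + 1)) * (⟪x, a l⟫ - ⟪x, a i⟫) with hs
  set s' : Fin (m + 1) → ℝ := fun l => m / (t ^ 2 * (m + 1)) * (⟪x, b l⟫ - ⟪x, b j⟫) with hs'
  have hsum : ∑ l, s l = -(k / r ^ 2) * ⟪x, a i⟫ := by
    rw [hs, ← Finset.mul_sum, Finset.sum_sub_distrib, hxa]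
    simp
    field_simp
  have hsum' : ∑ l, s' l = -(m / t ^ 2) * ⟪x, b j⟫ := by
    rw [hs', ← Finset.mul_sum, Finset.sum_sub_distrib, hxb]
    simp
    field_simp
  have hx' : ∑ l, s l • a l + ∑ l, s' l • b l = x := by
    rw [← sub_eq_zero]
    refine h.eq_zero_of_inner_eq_zero hk hm hfin (fun l => ?_) fun l => ?_
    · rw [inner_sub_left, h.inner_sum_a hk, hsum, hs]
      field_simp
      ring
    · rw [inner_sub_left, h.inner_sum_b hm, hsum', hs']
      field_simp
      ring
  rw [← hx']
  refine h.mem_of_sum_le (fun l => ?_) (fun l => ?_) ?_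
  · exact mul_nonneg (by positivity) (sub_nonneg.2 (hi l (Finset.mem_univ _)))
  · exact mul_nonneg (by positivity) (sub_nonneg.2 (hj l (Finset.mem_univ _)))
  -- The facet omitting `a i` and `b j` lies in the hyperplane `⟪x, n⟫ = 1`, at distance `1 / ‖n‖`
  -- from the origin.
  · set n := -(k / r ^ 2 : ℝ) • a i - (m / t ^ 2 : ℝ) • b j with hn
    have h1 : ∑ l, s l + ∑ l, s' l = ⟪x, n⟫ := by
      rw [hsum, hsum', hn, inner_sub_right, inner_smul_right, inner_smul_right]
      ring
    have h2 : ‖n‖ ^ 2 = k ^ 2 / r ^ 2 + m ^ 2 / t ^ 2 := by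
      rw [hn, norm_sub_sq_real, norm_smul, norm_smul, h.norm_a, h.norm_b, inner_smul_left,
        inner_smul_right, h.inner_ab, Real.norm_eq_abs, Real.norm_eq_abs, mul_pow, mul_pow, sq_abs,
        sq_abs]
      field_simp
      ring
    rw [h1]
    have h3 := real_inner_le_norm x n
    rw [← h2, ← mul_pow] at hρ
    have h4 : ‖x‖ * ‖n‖ ≤ ρ * ‖n‖ := by gcongr
    have h5 : ρ * ‖n‖ ≤ 1 := by nlinarith
    linarith

/-- With `n` the facet normal scaled so that the hull lies in `⟪x, n⟫ ≤ 1`, the point of the ball in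
the direction of `n` gives `ρ * ‖n‖ ≤ 1`. -/
theorem IsOrthoFrame.radius_bound (h : IsOrthoFrame a b r t) (hk : 1 ≤ k) (hm : 1 ≤ m) {ρ : ℝ}
    (hρ : 0 < ρ) (hball : Metric.closedBall 0 ρ ⊆ convexHull ℝ (Set.range a ∪ Set.range b)) :
    ρ ^ 2 * (k ^ 2 / r ^ 2 + m ^ 2 / t ^ 2) ≤ 1 := by
  have hr := h.r_pos
  have ht := h.t_pos
  have hk0 : (0 : ℝ) < k := by positivity
  have hm0 : (0 : ℝ) < m := by positivity
  set n := -(k / r ^ 2 : ℝ) • a 0 - (m / t ^ 2 : ℝ) • b 0 with hn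
  have h2 : ‖n‖ ^ 2 = k ^ 2 / r ^ 2 + m ^ 2 / t ^ 2 := by
    rw [hn, norm_sub_sq_real, norm_smul, norm_smul, h.norm_a, h.norm_b, inner_smul_left,
      inner_smul_right, h.inner_ab, Real.norm_eq_abs, Real.norm_eq_abs, mul_pow, mul_pow, sq_abs,
      sq_abs]
    field_simp
    ring
  have hn0 : 0 < ‖n‖ := by
    have : 0 < ‖n‖ ^ 2 := by rw [h2]; positivity
    exact norm_pos_iff.2 fun h0 => by simp [h0] at this
  have hx : (ρ / ‖n‖) • n ∈ convexHull ℝ (Set.range a ∪ Set.range b) := hball (by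
    rw [mem_closedBall_zero_iff, norm_smul, Real.norm_of_nonneg (by positivity),
      div_mul_cancel₀ _ hn0.ne'])
  obtain ⟨s, s', hs, hs', hsum, hx'⟩ := mem_convexHull_range_union_iff.1 hx
  have h3 : ⟪(ρ / ‖n‖) • n, n⟫ = ρ * ‖n‖ := by
    rw [inner_smul_left, real_inner_self_eq_norm_sq]
    simp
    field_simp
  have h4 : ⟪(ρ / ‖n‖) • n, n⟫ ≤ 1 := by
    rw [← hx', hn, inner_sub_right, inner_smul_right, inner_smul_right, h.inner_sum_a hk,
      h.inner_sum_b hm]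
    have e1 : -(k / r ^ 2 : ℝ) * (r ^ 2 / k * ((k + 1) * s 0 - ∑ l, s l)) =
      ∑ l, s l - (k + 1) * s 0 := by field_simp; ring
    have e2 : (m / t ^ 2 : ℝ) * (t ^ 2 / m * ((m + 1) * s' 0 - ∑ l, s' l)) =
      (m + 1) * s' 0 - ∑ l, s' l := by field_simp
    rw [e1, e2]
    have := mul_nonneg (by positivity : (0 : ℝ) ≤ k + 1) (hs 0)
    have := mul_nonneg (by positivity : (0 : ℝ) ≤ m + 1) (hs' 0)
    linarith
  rw [← h2, ← mul_pow]
  rw [h3] at h4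
  exact pow_le_one₀ (by positivity) h4

end RegularSimplex

/-! ### Volume of the hull of an orthogonal pair -/

section FrameVolume

/-- The matrix is a multiple of the identity plus a matrix of rank one, so the matrix determinant
lemma applies. -/
theorem det_regular_gram (n : ℕ) (c : ℝ) :
    (Matrix.of fun i j : Fin n => c * ((n + 1) * (if i = j then 1 else 0) - 1)).det =
      (c * (n + 1)) ^ n / (n + 1) := by
  have hn : (n : ℝ) + 1 ≠ 0 := by positivity
  have h : (Matrix.of fun i j : Fin n => c * ((n + 1) * (if i = j then 1 else 0) - 1)) =
      (c * (n + 1)) • (1 + Matrix.replicateCol Unit (fun _ : Fin n => -((n : ℝ) + 1)⁻¹) *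
        Matrix.replicateRow Unit (fun _ : Fin n => (1 : ℝ))) := by
    ext i j
    simp [Matrix.mul_apply, Matrix.one_apply]
    split_ifs <;> field_simp <;> ring
  rw [h, Matrix.det_smul, Matrix.det_one_add_replicateCol_mul_replicateRow]
  simp [dotProduct]
  field_simp
  ring

/-- The volume of the hull of two regular simplices of dimensions `k`, `m` and circumradii `r`,
`t` in orthogonal subspaces, in units of the volume of the standard corner simplex. -/
noncomputable def frameVolume (k m : ℕ) (r t : ℝ) : ℝ :=
  √((k + 1) ^ (k + 1) * (m + 1) ^ (m + 1) * ((r ^ 2 / k) ^ k * (t ^ 2 / m) ^ m))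

variable {E : Type*} [NormedAddCommGroup E] [InnerProductSpace ℝ E] {k m : ℕ}
  {a : Fin (k + 1) → E} {b : Fin (m + 1) → E} {r t : ℝ}

/-- The edges of a simplicial cone spanned by a facet. -/
def facetVertices (a : Fin (k + 1) → E) (b : Fin (m + 1) → E) (p : Fin (k + 1) × Fin (m + 1)) :
    Fin k ⊕ Fin m → E :=
  Sum.elim (fun i => a (p.1.succAbove i)) (fun j => b (p.2.succAbove j))

theorem mem_cornerSimplex_facetVertices {p : Fin (k + 1) × Fin (m + 1)} {x : E} :
    x ∈ cornerSimplex (facetVertices a b p) ↔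
      ∃ (s : Fin (k + 1) → ℝ) (s' : Fin (m + 1) → ℝ), (∀ i, 0 ≤ s i) ∧ (∀ i, 0 ≤ s' i) ∧
      s p.1 = 0 ∧ s' p.2 = 0 ∧ ∑ i, s i + ∑ i, s' i ≤ 1 ∧
      ∑ i, s i • a i + ∑ i, s' i • b i = x := by
  rw [mem_cornerSimplex]
  constructor
  · rintro ⟨c, hc, hs, rfl⟩
    rw [Fintype.sum_sum_type] at hs
    refine ⟨p.1.insertNth 0 fun i => c (Sum.inl i), p.2.insertNth 0 fun i => c (Sum.inr i),
      ?_, ?_, by simp, by simp, ?_, ?_⟩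
    · intro i
      refine Fin.succAboveCases p.1 ?_ (fun i => ?_) i <;> simp [hc]
    · intro i
      refine Fin.succAboveCases p.2 ?_ (fun i => ?_) i <;> simp [hc]
    · rw [Fin.sum_univ_succAbove _ p.1, Fin.sum_univ_succAbove _ p.2]
      simpa using hs
    · rw [Fin.sum_univ_succAbove _ p.1, Fin.sum_univ_succAbove _ p.2, Fintype.sum_sum_type]
      simp [facetVertices]
  · rintro ⟨s, s', hs, hs', h0, h0', hsum, rfl⟩
    refine ⟨Sum.elim (fun i => s (p.1.succAbove i)) (fun j => s' (p.2.succAbove j)), ?_, ?_, ?_⟩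
    · rintro (i | i) <;> simp [hs, hs']
    · rw [Fin.sum_univ_succAbove _ p.1, Fin.sum_univ_succAbove _ p.2, h0, h0'] at hsum
      rw [Fintype.sum_sum_type]
      simpa using hsum
    · rw [Fin.sum_univ_succAbove _ p.1, Fin.sum_univ_succAbove _ p.2, h0, h0', Fintype.sum_sum_type]
      simp [facetVertices]

/-- Because each vertex family sums to zero, the least weight on each side can be subtracted without
moving the point; this places it in the cone over a facet. -/
theorem IsOrthoFrame.convexHull_eq_iUnion (h : IsOrthoFrame a b r t) :
    convexHull ℝ (Set.range a ∪ Set.range b) = ⋃ p, cornerSimplex (facetVertices a b p) := by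
  apply subset_antisymm
  · intro x hx
    obtain ⟨s, s', hs, hs', hsum, rfl⟩ := mem_convexHull_range_union_iff.1 hx
    obtain ⟨i, -, hi⟩ := Finset.univ.exists_min_image s Finset.univ_nonempty
    obtain ⟨j, -, hj⟩ := Finset.univ.exists_min_image s' Finset.univ_nonempty
    refine Set.mem_iUnion.2 ⟨(i, j), mem_cornerSimplex_facetVertices.2
      ⟨fun l => s l - s i, fun l => s' l - s' j, fun l => sub_nonneg.2 (hi l (Finset.mem_univ _)),
        fun l => sub_nonneg.2 (hj l (Finset.mem_univ _)), sub_self _, sub_self _, ?_, ?_⟩⟩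
    · simp only [Finset.sum_sub_distrib, Finset.sum_const, Finset.card_univ, Fintype.card_fin,
        nsmul_eq_mul]
      have := mul_nonneg (Nat.cast_nonneg (α := ℝ) (k + 1)) (hs i)
      have := mul_nonneg (Nat.cast_nonneg (α := ℝ) (m + 1)) (hs' j)
      linarith
    · simp [sub_smul, Finset.sum_sub_distrib, ← Finset.smul_sum, h.sum_a, h.sum_b]
  · refine Set.iUnion_subset fun p x hx => ?_
    obtain ⟨s, s', hs, hs', -, -, hsum, rfl⟩ := mem_cornerSimplex_facetVertices.1 hx
    exact h.mem_of_sum_le hs hs' hsum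

/-- Points of a cone have their least inner product with the omitted vertex. Two cones that omit
different vertices therefore meet only in a hyperplane, a null set. -/
theorem IsOrthoFrame.inner_le_of_mem_corner (h : IsOrthoFrame a b r t) (hk : 1 ≤ k)
    {p : Fin (k + 1) × Fin (m + 1)} {x : E} (hx : x ∈ cornerSimplex (facetVertices a b p))
    (i : Fin (k + 1)) : ⟪x, a p.1⟫ ≤ ⟪x, a i⟫ := by
  obtain ⟨s, s', hs, hs', h0, h0', hsum, rfl⟩ := mem_cornerSimplex_facetVertices.1 hx
  rw [h.inner_sum_a hk, h.inner_sum_a hk, h0]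
  have := hs i
  gcongr

theorem IsOrthoFrame.inner_le_of_mem_corner' (h : IsOrthoFrame a b r t) (hm : 1 ≤ m)
    {p : Fin (k + 1) × Fin (m + 1)} {x : E} (hx : x ∈ cornerSimplex (facetVertices a b p))
    (i : Fin (m + 1)) : ⟪x, b p.2⟫ ≤ ⟪x, b i⟫ := by
  obtain ⟨s, s', hs, hs', h0, h0', hsum, rfl⟩ := mem_cornerSimplex_facetVertices.1 hx
  rw [h.inner_sum_b hm, h.inner_sum_b hm, h0']
  have := hs' i
  gcongr

theorem IsOrthoFrame.injective_a (h : IsOrthoFrame a b r t) (hk : 1 ≤ k) :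
    Function.Injective a := by
  intro i j hij
  by_contra hne
  have h1 := h.inner_a i j hne
  rw [hij, real_inner_self_eq_norm_sq, h.norm_a] at h1
  have := h.r_pos
  have : 0 < (k : ℝ) * r ^ 2 + r ^ 2 := by positivity
  linarith

variable [FiniteDimensional ℝ E] [MeasurableSpace E] [BorelSpace E]

theorem volume_setOf_inner_eq {u w : E} (h : u ≠ w) :
    volume {x : E | ⟪x, u⟫ = ⟪x, w⟫} = 0 := by
  have : {x : E | ⟪x, u⟫ = ⟪x, w⟫} = ((ℝ ∙ (u - w))ᗮ : Submodule ℝ E) := by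
    ext x
    rw [SetLike.mem_coe, Submodule.mem_orthogonal_singleton_iff_inner_left, inner_sub_right,
      sub_eq_zero]
    rfl
  rw [this]
  refine Measure.addHaar_submodule _ _ fun htop => ?_
  have hm : u - w ∈ ((ℝ ∙ (u - w))ᗮ : Submodule ℝ E) := by rw [htop]; trivial
  rw [Submodule.mem_orthogonal_singleton_iff_inner_left, inner_self_eq_zero, sub_eq_zero] at hm
  exact h hm

/-- The hull splits into `(k + 1) * (m + 1)` almost disjoint cones over facets, all with the same
block diagonal Gram determinant. -/
theorem IsOrthoFrame.volume_eq (h : IsOrthoFrame a b r t) (hk : 1 ≤ k) (hm : 1 ≤ m)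
    (hfin : k + m = Module.finrank ℝ E) :
    volume (convexHull ℝ (Set.range a ∪ Set.range b)) =
      ENNReal.ofReal (frameVolume k m r t) * cornerVolume E := by
  have hk0 : (0 : ℝ) < k := by positivity
  have hm0 : (0 : ℝ) < m := by positivity
  rw [h.convexHull_eq_iUnion, measure_iUnion₀]
  · have hdet : ∀ p, (Matrix.of fun i j =>
        ⟪facetVertices a b p i, facetVertices a b p j⟫).det =
        (r ^ 2 / k * (k + 1)) ^ k / (k + 1) * ((t ^ 2 / m * (m + 1)) ^ m / (m + 1)) := by
      intro p
      rw [← det_regular_gram, ← det_regular_gram, ← Matrix.det_fromBlocks_zero₂₁ _ 0]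
      congr 1
      ext (i | i) (j | j)
      · simp [facetVertices, h.inner_a_eq hk]
      · simp [facetVertices, h.inner_ab]
      · simp [facetVertices, real_inner_comm, h.inner_ab]
      · simp [facetVertices, h.symm.inner_a_eq hm]
    have hvol : ∀ p, volume (cornerSimplex (facetVertices a b p)) = ENNReal.ofReal
        (√((r ^ 2 / k * (k + 1)) ^ k / (k + 1) * ((t ^ 2 / m * (m + 1)) ^ m / (m + 1)))) *
          cornerVolume E := fun p => by
      rw [volume_cornerSimplex (by simpa using hfin), hdet]
    simp only [hvol, tsum_fintype, Finset.sum_const, Finset.card_univ, Fintype.card_prod,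
      Fintype.card_fin, nsmul_eq_mul]
    rw [← mul_assoc, ← ENNReal.ofReal_natCast, ← ENNReal.ofReal_mul (by positivity)]
    congr 2
    rw [frameVolume]
    symm
    rw [Real.sqrt_eq_iff_eq_sq (by positivity) (by positivity), mul_pow _ (√_),
      Real.sq_sqrt (by positivity)]
    push_cast
    rw [mul_pow (r ^ 2 / (k : ℝ)), mul_pow (t ^ 2 / (m : ℝ))]
    field_simp
    ring
  · intro p q hpq
    refine measure_mono_null ?_ (?_ : volume (if p.1 = q.1 then {x : E | ⟪x, b p.2⟫ = ⟪x, b q.2⟫}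
      else {x : E | ⟪x, a p.1⟫ = ⟪x, a q.1⟫}) = 0)
    · rintro x ⟨hp, hq⟩
      split_ifs
      · exact le_antisymm (h.inner_le_of_mem_corner' hm hp _) (h.inner_le_of_mem_corner' hm hq _)
      · exact le_antisymm (h.inner_le_of_mem_corner hk hp _) (h.inner_le_of_mem_corner hk hq _)
    · split_ifs with h1
      · exact volume_setOf_inner_eq fun h2 => hpq (Prod.ext h1 (h.symm.injective_a hm h2))
      · exact volume_setOf_inner_eq fun h2 => h1 (h.injective_a hk h2)
  · exact fun p => (measurableSet_cornerSimplex _).nullMeasurableSet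

end FrameVolume

/-! ### Existence of orthogonal pairs with prescribed radii -/

section FrameExists

theorem nonempty_linearIsometryEquiv_of_finrank_eq {V W : Type*} [NormedAddCommGroup V]
    [InnerProductSpace ℝ V] [FiniteDimensional ℝ V] [NormedAddCommGroup W] [InnerProductSpace ℝ W]
    [FiniteDimensional ℝ W] (h : Module.finrank ℝ V = Module.finrank ℝ W) :
    Nonempty (V ≃ₗᵢ[ℝ] W) :=
  ⟨(stdOrthonormalBasis ℝ V).equiv (stdOrthonormalBasis ℝ W) (finCongr h)⟩

/-- Vertices of a regular simplex in the hyperplane orthogonal to `(1, …, 1)`. -/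
theorem exists_regular_vectors (k : ℕ) (hk : 1 ≤ k) {r : ℝ} (hr : 0 < r) :
    ∃ a : Fin (k + 1) → EuclideanSpace ℝ (Fin k), (∀ i, ‖a i‖ = r) ∧ ∑ i, a i = 0 ∧
      ∀ i j, i ≠ j → k * ⟪a i, a j⟫ = -r ^ 2 := by
  set o : EuclideanSpace ℝ (Fin (k + 1)) := WithLp.toLp 2 fun _ => 1 with ho
  have ho0 : o ≠ 0 := fun h => by
    have := congrArg (fun x : EuclideanSpace ℝ (Fin (k + 1)) => x 0) h
    simp [ho] at this
  have hoo : ⟪o, o⟫ = k + 1 := by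
    rw [PiLp.inner_apply]; simp [ho]
  have hrank : Module.finrank ℝ (ℝ ∙ o)ᗮ = Module.finrank ℝ (EuclideanSpace ℝ (Fin k)) := by
    have : Fact (Module.finrank ℝ (EuclideanSpace ℝ (Fin (k + 1))) = k + 1) :=
      ⟨finrank_euclideanSpace_fin⟩
    rw [Submodule.finrank_orthogonal_span_singleton (n := k) ho0]
    simp
  obtain ⟨φ⟩ := nonempty_linearIsometryEquiv_of_finrank_eq hrank
  have hk0 : (0 : ℝ) < k := by positivity
  -- The projection of a coordinate unit vector orthogonal to `o` has squared norm `k / (k + 1)`.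
  set c : ℝ := r * √((k + 1) / k) with hc
  have hc2 : c ^ 2 = r ^ 2 * ((k + 1) / k) := by rw [hc, mul_pow, Real.sq_sqrt (by positivity)]
  set x : Fin (k + 1) → EuclideanSpace ℝ (Fin (k + 1)) := fun i =>
    c • (EuclideanSpace.single i 1 - ((k : ℝ) + 1)⁻¹ • o) with hx
  have hso : ∀ i, ⟪EuclideanSpace.single i (1 : ℝ), o⟫ = 1 := fun i => by
    simp [EuclideanSpace.inner_single_left, ho]
  have hxo : ∀ i, x i ∈ (ℝ ∙ o)ᗮ := fun i => by
    rw [Submodule.mem_orthogonal_singleton_iff_inner_left, hx]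
    simp only [inner_smul_left, inner_sub_left, hso, hoo]
    have : (k : ℝ) + 1 ≠ 0 := by positivity
    simp [this]
  have hin : ∀ i j, ⟪x i, x j⟫ = c ^ 2 * ((if i = j then 1 else 0) - ((k : ℝ) + 1)⁻¹) := by
    intro i j
    have h1 : ⟪EuclideanSpace.single i (1 : ℝ), EuclideanSpace.single j (1 : ℝ)⟫ =
        if i = j then 1 else 0 := by
      rw [EuclideanSpace.inner_single_left, PiLp.single_apply]
      simp
    have h2 : ⟪o, EuclideanSpace.single j (1 : ℝ)⟫ = 1 := by rw [real_inner_comm, hso]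
    simp only [hx, inner_smul_left, inner_smul_right, inner_sub_left, inner_sub_right, hso, hoo, h1,
      h2]
    simp
    field_simp
    ring
  refine ⟨fun i => φ ⟨x i, hxo i⟩, fun i => ?_, ?_, fun i j hij => ?_⟩
  · rw [LinearIsometryEquiv.norm_map, Submodule.coe_norm]
    have h1 : ‖x i‖ ^ 2 = r ^ 2 := by
      rw [← real_inner_self_eq_norm_sq, hin, hc2, if_pos rfl]
      field_simp
      ring
    exact (sq_eq_sq₀ (norm_nonneg _) hr.le).1 h1
  · rw [← map_sum]
    convert map_zero φ
    rw [Subtype.ext_iff]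
    simp only [AddSubmonoidClass.coe_finsetSum, ZeroMemClass.coe_zero, hx, ← Finset.smul_sum,
      Finset.sum_sub_distrib]
    convert smul_zero c
    ext l
    have : (k : ℝ) + 1 ≠ 0 := by positivity
    simp [ho, this]
  · rw [LinearIsometryEquiv.inner_map_map, Submodule.coe_inner, hin, hc2, if_neg hij]
    field_simp
    ring

theorem exists_isOrthoFrame {E : Type*} [NormedAddCommGroup E] [InnerProductSpace ℝ E]
    [FiniteDimensional ℝ E] {k m : ℕ} (hk : 1 ≤ k) (hm : 1 ≤ m)
    (hfin : k + m = Module.finrank ℝ E) {r t : ℝ} (hr : 0 < r) (ht : 0 < t) :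
    ∃ (a : Fin (k + 1) → E) (b : Fin (m + 1) → E), IsOrthoFrame a b r t := by
  obtain ⟨a, ha, hsa, hia⟩ := exists_regular_vectors k hk hr
  obtain ⟨b, hb, hsb, hib⟩ := exists_regular_vectors m hm ht
  have hrank : Module.finrank ℝ
      (WithLp 2 (EuclideanSpace ℝ (Fin k) × EuclideanSpace ℝ (Fin m))) = Module.finrank ℝ E := by
    rw [← hfin, (WithLp.linearEquiv 2 ℝ _).finrank_eq, Module.finrank_prod]
    simp
  obtain ⟨φ⟩ := nonempty_linearIsometryEquiv_of_finrank_eq hrank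
  have hsa' : ∑ i, ((a i, 0) : EuclideanSpace ℝ (Fin k) × EuclideanSpace ℝ (Fin m)) = 0 := by
    simp [Prod.ext_iff, Prod.fst_sum, Prod.snd_sum, hsa]
  have hsb' : ∑ i, ((0, b i) : EuclideanSpace ℝ (Fin k) × EuclideanSpace ℝ (Fin m)) = 0 := by
    simp [Prod.ext_iff, Prod.fst_sum, Prod.snd_sum, hsb]
  refine ⟨fun i => φ (WithLp.toLp 2 (a i, 0)), fun i => φ (WithLp.toLp 2 (0, b i)),
    hr, ht, fun i => ?_, fun i => ?_, ?_, ?_, fun i j hij => ?_, fun i j hij => ?_, fun i j => ?_⟩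
  · simp [ha]
  · simp [hb]
  · rw [← map_sum, ← WithLp.toLp_sum, hsa', WithLp.toLp_zero, map_zero]
  · rw [← map_sum, ← WithLp.toLp_sum, hsb', WithLp.toLp_zero, map_zero]
  · rw [LinearIsometryEquiv.inner_map_map, WithLp.prod_inner_apply]
    simpa using hia i j hij
  · rw [LinearIsometryEquiv.inner_map_map, WithLp.prod_inner_apply]
    simpa using hib i j hij
  · rw [LinearIsometryEquiv.inner_map_map, WithLp.prod_inner_apply]
    simp

end FrameExists

/-! ### Optimal radii and optimal dimensions -/

section VolumeBounds

theorem pow_mul_pow_le_of_weighted_sum_le {k m : ℕ} (hkm : 1 ≤ k + m) {p q c : ℝ} (hp : 0 ≤ p)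
    (hq : 0 ≤ q) (h : k * p + m * q ≤ (k + m) * c) : p ^ k * q ^ m ≤ c ^ (k + m) := by
  have hd : (0 : ℝ) < (k : ℝ) + m := by exact_mod_cast hkm
  have h1 := Real.geom_mean_le_arith_mean2_weighted (w₁ := k / ((k : ℝ) + m))
    (w₂ := m / ((k : ℝ) + m)) (by positivity) (by positivity) hp hq (by field_simp)
  have h2 : k / ((k : ℝ) + m) * p + m / ((k : ℝ) + m) * q ≤ c := by
    rw [div_mul_eq_mul_div, div_mul_eq_mul_div, ← add_div, div_le_iff₀ hd]
    linarith
  have h3 : ∀ (n : ℕ) (x : ℝ), 0 ≤ x → (x ^ (n / ((k : ℝ) + m))) ^ (k + m) = x ^ n := by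
    intro n x hx
    rw [← Real.rpow_natCast, ← Real.rpow_mul hx]
    push_cast
    rw [div_mul_cancel₀ _ hd.ne', Real.rpow_natCast]
  calc p ^ k * q ^ m = (p ^ (k / ((k : ℝ) + m)) * q ^ (m / ((k : ℝ) + m))) ^ (k + m) := by
        rw [mul_pow, h3 k p hp, h3 m q hq]
    _ ≤ c ^ (k + m) := by
        refine pow_le_pow_left₀ (by positivity) (h1.trans h2) _

/-- The least value of `frameVolume` under the constraint that the inradius is at least `ρ`. -/
noncomputable def optimalVolume (k m : ℕ) (ρ : ℝ) : ℝ :=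
  √((k + 1) ^ (k + 1) * (m + 1) ^ (m + 1) * ((k + m) * ρ ^ 2) ^ (k + m))

/-- The constraint bounds the mean of `k / r ^ 2` and `m / t ^ 2` with weights `k` and `m`. The
corresponding geometric mean is the reciprocal of the quantity to be minimised. -/
theorem optimalVolume_le_frameVolume {k m : ℕ} (hk : 1 ≤ k) (hm : 1 ≤ m) {r t ρ : ℝ} (hr : 0 < r)
    (ht : 0 < t) (hρ : 0 < ρ) (h : ρ ^ 2 * (k ^ 2 / r ^ 2 + m ^ 2 / t ^ 2) ≤ 1) :
    optimalVolume k m ρ ≤ frameVolume k m r t := by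
  have hk0 : (0 : ℝ) < k := by positivity
  have hm0 : (0 : ℝ) < m := by positivity
  have h1 := pow_mul_pow_le_of_weighted_sum_le (k := k) (m := m) (by omega) (p := k / r ^ 2)
    (q := m / t ^ 2) (c := 1 / ((k + m) * ρ ^ 2)) (by positivity) (by positivity) (by
      rw [mul_one_div, mul_comm _ (ρ ^ 2), div_mul_eq_div_div_swap, div_self (by positivity),
        le_div_iff₀ (by positivity)]
      refine le_trans (le_of_eq ?_) h
      ring)
  refine Real.sqrt_le_sqrt ?_
  gcongr
  have h2 : (r ^ 2 / k) ^ k * (t ^ 2 / m) ^ m = ((k / r ^ 2) ^ k * (m / t ^ 2) ^ m : ℝ)⁻¹ := by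
    rw [mul_inv, ← inv_pow, ← inv_pow, inv_div, inv_div]
  rw [h2, ← inv_inv (((k : ℝ) + m) * ρ ^ 2), inv_pow]
  gcongr
  rwa [inv_eq_one_div]

/-- These radii satisfy `k / r ^ 2 = m / t ^ 2`, the case of equality between the two means. -/
theorem frameVolume_eq_optimalVolume {k m : ℕ} (hk : 1 ≤ k) (hm : 1 ≤ m) (ρ : ℝ) :
    frameVolume k m (ρ * √(k * (k + m))) (ρ * √(m * (k + m))) = optimalVolume k m ρ := by
  have hk0 : (0 : ℝ) < k := by positivity
  have hm0 : (0 : ℝ) < m := by positivity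
  rw [frameVolume, optimalVolume, mul_pow, mul_pow, Real.sq_sqrt (by positivity),
    Real.sq_sqrt (by positivity), pow_add (((k : ℝ) + m) * ρ ^ 2)]
  congr 4 <;> field_simp

theorem optimal_radius_bound {k m : ℕ} (hk : 1 ≤ k) (hm : 1 ≤ m) {ρ : ℝ} (hρ : 0 < ρ) :
    ρ ^ 2 * (k ^ 2 / (ρ * √(k * (k + m))) ^ 2 + m ^ 2 / (ρ * √(m * (k + m))) ^ 2) ≤ 1 := by
  have hk0 : (0 : ℝ) < k := by positivity
  have hm0 : (0 : ℝ) < m := by positivity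
  rw [mul_pow, mul_pow, Real.sq_sqrt (by positivity), Real.sq_sqrt (by positivity)]
  apply le_of_eq
  field_simp

theorem optimalVolume_pos {k m : ℕ} (hk : 1 ≤ k) {ρ : ℝ} (hρ : 0 < ρ) :
    0 < optimalVolume k m ρ := by
  have hk0 : (0 : ℝ) < k := by positivity
  exact Real.sqrt_pos.2 (by positivity)

theorem optimalVolume_eq_mul {k m : ℕ} {ρ : ℝ} (hρ : 0 ≤ ρ) :
    optimalVolume k m ρ = optimalVolume k m 1 * ρ ^ (k + m) := by
  rw [optimalVolume, optimalVolume, mul_pow _ (ρ ^ 2), one_pow, mul_one, ← mul_assoc,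
    Real.sqrt_mul (by positivity), ← pow_mul, mul_comm 2, pow_mul, Real.sqrt_sq (by positivity)]

/-- Both `x` and `y` are convex combinations of `p` and `q`, with interchanged weights, so strict
convexity of `x log x` is applied twice and added. -/
theorem mul_log_add_mul_log_lt {p q x y : ℝ} (hp : 0 ≤ p) (hpx : p < x) (hxq : x < q)
    (hsum : p + q = x + y) :
    x * Real.log x + y * Real.log y < p * Real.log p + q * Real.log q := by
  have hpq : p < q := hpx.trans hxq
  have hqp : 0 < q - p := by linarith
  set θ := (q - x) / (q - p) with hθ
  have hθ0 : 0 < θ := div_pos (by linarith) hqp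
  have hθ1 : 0 < 1 - θ := by
    rw [hθ, sub_pos, div_lt_one hqp]
    linarith
  have hx : θ * p + (1 - θ) * q = x := by rw [hθ]; field_simp; ring
  have hy : (1 - θ) * p + θ * q = y := by linarith
  have h1 := Real.strictConvexOn_mul_log.2 (Set.mem_Ici.2 hp) (Set.mem_Ici.2 (hp.trans hpq.le))
    hpq.ne hθ0 hθ1 (by ring)
  have h2 := Real.strictConvexOn_mul_log.2 (Set.mem_Ici.2 hp) (Set.mem_Ici.2 (hp.trans hpq.le))
    hpq.ne hθ1 hθ0 (by ring)
  simp only [smul_eq_mul, hx, hy] at h1 h2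
  linarith

/-- Balanced dimensions give the smallest volume. -/
theorem optimalVolume_half_lt {d k : ℕ} (hk : k < d / 2) {ρ : ℝ} (hρ : 0 < ρ) :
    optimalVolume (d / 2) (d - d / 2) ρ < optimalVolume k (d - k) ρ := by
  have h1 : d / 2 + (d - d / 2) = d := by omega
  have h2 : k + (d - k) = d := by omega
  have hlog := mul_log_add_mul_log_lt (p := (k : ℝ) + 1) (q := ((d - k : ℕ) : ℝ) + 1)
    (x := ((d / 2 : ℕ) : ℝ) + 1) (y := ((d - d / 2 : ℕ) : ℝ) + 1) (by positivity)
    (by have : (k : ℝ) < (d / 2 : ℕ) := by exact_mod_cast hk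
        linarith)
    (by have : ((d / 2 : ℕ) : ℝ) < (d - k : ℕ) := by exact_mod_cast (by omega)
        linarith)
    (by have : (k : ℝ) + (d - k : ℕ) = (d / 2 : ℕ) + (d - d / 2 : ℕ) := by
          exact_mod_cast h2.trans h1.symm
        linarith)
  have hexp : ∀ n : ℕ, ((n : ℝ) + 1) ^ (n + 1) = Real.exp (((n : ℝ) + 1) * Real.log ((n : ℝ) + 1)) := by
    intro n
    have : (0 : ℝ) < (n : ℝ) + 1 := by positivity
    rw [mul_comm, ← Real.rpow_def_of_pos this, ← Nat.cast_add_one, Real.rpow_natCast]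
  have hd : 0 < ((k : ℝ) + (d - k : ℕ)) * ρ ^ 2 := by
    have : (0 : ℝ) < (k : ℝ) + (d - k : ℕ) := by exact_mod_cast (by omega)
    positivity
  rw [optimalVolume, optimalVolume]
  -- The remaining factor depends only on the sum `d` of the dimensions, so only the powers compared
  -- through `hlog` matter.
  have h3 : (((d / 2 : ℕ) : ℝ) + (d - d / 2 : ℕ)) = (k : ℝ) + (d - k : ℕ) := by
    exact_mod_cast h1.trans h2.symm
  rw [h3, h1, h2]
  refine Real.sqrt_lt_sqrt (by positivity) ?_
  refine mul_lt_mul_of_pos_right ?_ (by positivity)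
  rw [hexp, hexp, hexp, hexp, ← Real.exp_add, ← Real.exp_add]
  exact Real.exp_lt_exp.2 hlog

theorem pow_mul_pow_le_frameVolume {k m : ℕ} (hk : 1 ≤ k) (hm : 1 ≤ m) {r t : ℝ} (hr : 0 < r)
    (ht : 0 < t) : r ^ k * t ^ m ≤ frameVolume k m r t := by
  have hk0 : (0 : ℝ) < k := by positivity
  have hm0 : (0 : ℝ) < m := by positivity
  have h : ∀ n : ℕ, (n : ℝ) ^ n ≤ ((n : ℝ) + 1) ^ (n + 1) := fun n => by
    calc (n : ℝ) ^ n ≤ ((n : ℝ) + 1) ^ n := by gcongr; linarith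
      _ ≤ ((n : ℝ) + 1) ^ (n + 1) := by
        refine pow_le_pow_right₀ ?_ (by omega)
        linarith [Nat.cast_nonneg (α := ℝ) n]
  refine Real.le_sqrt_of_sq_le ?_
  have h1 : (r ^ k * t ^ m) ^ 2 = (k : ℝ) ^ k * (m : ℝ) ^ m * ((r ^ 2 / k) ^ k * (t ^ 2 / m) ^ m) := by
    rw [div_pow, div_pow]
    field_simp
    ring
  rw [h1]
  have hk1 := h k
  have hm1 := h m
  gcongr

theorem le_radius_of_bound {k m : ℕ} (hk : 1 ≤ k) {r t ρ : ℝ} (hr : 0 < r)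
    (hρ : 0 < ρ) (h : ρ ^ 2 * (k ^ 2 / r ^ 2 + m ^ 2 / t ^ 2) ≤ 1) : ρ ≤ r := by
  have hk1 : (1 : ℝ) ≤ k := by exact_mod_cast hk
  have h1 : ρ ^ 2 * (1 / r ^ 2) ≤ 1 := by
    refine le_trans ?_ h
    gcongr
    calc 1 / r ^ 2 ≤ k ^ 2 / r ^ 2 := by gcongr; exact one_le_pow₀ hk1
      _ ≤ _ := le_add_of_nonneg_right (by positivity)
  rw [mul_one_div, div_le_one (by positivity)] at h1
  exact (pow_le_pow_iff_left₀ hρ.le hr.le two_ne_zero).1 h1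

/-- Both circumradii are at least `ρ` and one is at least `R`. For fixed `R` the bound has order `ρ
^ (d - 1)`, which beats the order `ρ ^ d` of the optimum as `ρ` tends to zero. -/
theorem frameVolume_ge_of_large_radius {k m : ℕ} (hk : 1 ≤ k) (hm : 1 ≤ m) {r t ρ R : ℝ}
    (hr : 0 < r) (ht : 0 < t) (hρ : 0 < ρ)
    (h : ρ ^ 2 * (k ^ 2 / r ^ 2 + m ^ 2 / t ^ 2) ≤ 1)
    (hlarge : R ≤ r ∨ R ≤ t) : R * ρ ^ (k + m - 1) ≤ frameVolume k m r t := by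
  have h1 := le_radius_of_bound hk hr hρ h
  have h2 := le_radius_of_bound (k := m) (m := k) hm ht hρ (t := r) (by rwa [add_comm (_ / _)])
  refine le_trans ?_ (pow_mul_pow_le_frameVolume hk hm hr ht)
  obtain ⟨k', rfl⟩ : ∃ k', k = k' + 1 := ⟨k - 1, by omega⟩
  obtain ⟨m', rfl⟩ : ∃ m', m = m' + 1 := ⟨m - 1, by omega⟩
  rcases hlarge with hl | hl
  · calc R * ρ ^ (k' + 1 + (m' + 1) - 1) = R * (ρ ^ k' * ρ ^ (m' + 1)) := by
          rw [← pow_add]; congr 2; omega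
      _ ≤ r * (r ^ k' * t ^ (m' + 1)) := by gcongr
      _ = _ := by ring
  · calc R * ρ ^ (k' + 1 + (m' + 1) - 1) = R * (ρ ^ (k' + 1) * ρ ^ m') := by
          rw [← pow_add]; congr 2
      _ ≤ t * (r ^ (k' + 1) * t ^ m') := by gcongr
      _ = _ := by ring

end VolumeBounds

/-! ### Reduction of arbitrary polytopes to orthogonal pairs -/

section PolytopeSymmetrization

variable {E : Type*} [NormedAddCommGroup E] [InnerProductSpace ℝ E] [FiniteDimensional ℝ E]
  [MeasurableSpace E] [BorelSpace E]

/-- The Radon partition determines the type and symmetrization does the rest. The bound `R` is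
carried along so that hyperbolic polytopes do not leave the model. -/
theorem exists_isOrthoFrame_of_polytope {f : ℝ → ENNReal} (hf : MonotoneOn f (Set.Ici 0))
    (hfm : Measurable f) {d : ℕ} (hd : 2 ≤ d) (hfin : Module.finrank ℝ E = d)
    {t : Finset E} (ht : t.card ≤ d + 2) {ρ R : ℝ} (hρ : 0 < ρ)
    (hball : Metric.closedBall 0 ρ ⊆ convexHull ℝ (t : Set E))
    (hR : ∀ x ∈ convexHull ℝ (t : Set E), ‖x‖ ≤ R) :
    ∃ k : ℕ, 1 ≤ k ∧ 2 * k ≤ d ∧ ∃ (a : Fin (k + 1) → E) (b : Fin (d - k + 1) → E) (r s : ℝ),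
      IsOrthoFrame a b r s ∧ r ≤ R ∧ s ≤ R ∧
      Metric.closedBall 0 ρ ⊆ convexHull ℝ (Set.range a ∪ Set.range b) ∧
      radialMeasure E f (convexHull ℝ (Set.range a ∪ Set.range b)) ≤
        radialMeasure E f (convexHull ℝ (t : Set E)) := by
  obtain ⟨k, m, hk, hkm, hsum, v, z, hz, hv, hvt⟩ := exists_isRadonDependency hd hfin ht hρ hball
  obtain rfl : m = d - k := by omega
  rw [← hv] at hball
  obtain ⟨a, b, r, s, h⟩ := exists_isOrthoFrame_radialMeasure_le hf hfm hk (by omega)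
    (by omega) hρ (fun i => hR _ (hvt i)) hz hball
  rw [hv] at h
  exact ⟨k, hk, by omega, a, b, r, s, h⟩

theorem radialMeasure_one : radialMeasure E (fun _ => 1) = volume := by
  simp [radialMeasure]

theorem optimalVolume_half_le {d k : ℕ} (hk : 2 * k ≤ d) {ρ : ℝ} (hρ : 0 < ρ) :
    optimalVolume (d / 2) (d - d / 2) ρ ≤ optimalVolume k (d - k) ρ := by
  rcases (show k ≤ d / 2 by omega).lt_or_eq with h | rfl
  · exact (optimalVolume_half_lt h hρ).le
  · rfl

theorem IsOrthoFrame.optimalVolume_mul_le_volume {k m : ℕ} (hk : 1 ≤ k) (hm : 1 ≤ m)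
    (hfin : k + m = Module.finrank ℝ E) {a : Fin (k + 1) → E} {b : Fin (m + 1) → E} {r s : ℝ}
    (h : IsOrthoFrame a b r s) {ρ : ℝ} (hρ : 0 < ρ)
    (hball : Metric.closedBall 0 ρ ⊆ convexHull ℝ (Set.range a ∪ Set.range b)) :
    ENNReal.ofReal (optimalVolume k m ρ) * cornerVolume E ≤
      volume (convexHull ℝ (Set.range a ∪ Set.range b)) := by
  rw [h.volume_eq hk hm hfin]
  gcongr
  exact optimalVolume_le_frameVolume hk hm h.r_pos h.t_pos hρ (h.radius_bound hk hm hρ hball)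

/-- A lower bound for the volume of a polytope with at most `d + 2` vertices containing a ball. -/
theorem optimalVolume_mul_le_volume_polytope {d : ℕ} (hd : 2 ≤ d) (hfin : Module.finrank ℝ E = d)
    {t : Finset E} (ht : t.card ≤ d + 2) {ρ : ℝ} (hρ : 0 < ρ)
    (hball : Metric.closedBall 0 ρ ⊆ convexHull ℝ (t : Set E)) :
    ENNReal.ofReal (optimalVolume (d / 2) (d - d / 2) ρ) * cornerVolume E ≤
      volume (convexHull ℝ (t : Set E)) := by
  obtain ⟨R, hR⟩ := ((t.finite_toSet.isCompact_convexHull ℝ).isBounded).exists_norm_le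
  obtain ⟨k, hk, hkd, a, b, r, s, h, -, -, hb, hle⟩ := exists_isOrthoFrame_of_polytope
    (f := fun _ => 1) monotoneOn_const measurable_const hd hfin ht hρ hball hR
  rw [radialMeasure_one] at hle
  refine le_trans ?_ ((h.optimalVolume_mul_le_volume hk (by omega) (by omega) hρ hb).trans hle)
  gcongr
  exact optimalVolume_half_le hkd hρ

/-- A pair of orthogonal regular simplices whose hull has the least possible volume. -/
theorem exists_optimal_isOrthoFrame {k m : ℕ} (hk : 1 ≤ k) (hm : 1 ≤ m)
    (hfin : k + m = Module.finrank ℝ E) {ρ : ℝ} (hρ : 0 < ρ) :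
    ∃ (a : Fin (k + 1) → E) (b : Fin (m + 1) → E),
      IsOrthoFrame a b (ρ * √(k * (k + m))) (ρ * √(m * (k + m))) ∧
      Metric.closedBall 0 ρ ⊆ convexHull ℝ (Set.range a ∪ Set.range b) ∧
      volume (convexHull ℝ (Set.range a ∪ Set.range b)) =
        ENNReal.ofReal (optimalVolume k m ρ) * cornerVolume E := by
  have hk0 : (0 : ℝ) < k := by positivity
  have hm0 : (0 : ℝ) < m := by positivity
  obtain ⟨a, b, h⟩ := exists_isOrthoFrame (E := E) hk hm hfin
    (r := ρ * √(k * (k + m))) (t := ρ * √(m * (k + m))) (by positivity) (by positivity)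
  refine ⟨a, b, h, h.closedBall_subset hk hm hfin (optimal_radius_bound hk hm hρ), ?_⟩
  rw [h.volume_eq hk hm hfin, frameVolume_eq_optimalVolume hk hm]

end PolytopeSymmetrization

/-! ### The Euclidean minimisers -/

section EuclideanHull

variable {d : ℕ}

theorem affineIndependent_iff_forall_sum {ι V : Type*} [Fintype ι] [AddCommGroup V] [Module ℝ V]
    {p : ι → V} : AffineIndependent ℝ p ↔
      ∀ w : ι → ℝ, ∑ i, w i = 0 → ∑ i, w i • p i = 0 → ∀ i, w i = 0 := by
  rw [affineIndependent_iff_of_fintype]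
  refine forall_congr' fun w => forall_congr' fun h => ?_
  rw [Finset.univ.weightedVSub_eq_linear_combination h]

theorem IsOrthoFrame.affineIndependent_a {E : Type*} [NormedAddCommGroup E]
    [InnerProductSpace ℝ E] {k m : ℕ} {a : Fin (k + 1) → E} {b : Fin (m + 1) → E} {r s : ℝ}
    (h : IsOrthoFrame a b r s) (hk : 1 ≤ k) : AffineIndependent ℝ a := by
  rw [affineIndependent_iff_forall_sum]
  intro w hw hwa i
  have hk0 : (0 : ℝ) < k := by positivity
  have hr := h.r_pos
  have h1 := h.inner_sum_a hk w 0 i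
  simp only [hwa, hw, Pi.zero_apply, zero_smul, Finset.sum_const_zero, add_zero,
    inner_zero_left, sub_zero] at h1
  have h2 : r ^ 2 / k * ((k + 1) * w i) = 0 := h1.symm
  have h3 : r ^ 2 / (k : ℝ) ≠ 0 := by positivity
  exact (mul_eq_zero.1 ((mul_eq_zero.1 h2).resolve_left h3)).resolve_left (by positivity)

theorem IsOrthoFrame.norm_sub_a {E : Type*} [NormedAddCommGroup E]
    [InnerProductSpace ℝ E] {k m : ℕ} {a : Fin (k + 1) → E} {b : Fin (m + 1) → E} {r s : ℝ}
    (h : IsOrthoFrame a b r s) (hk : 1 ≤ k) {i j : Fin (k + 1)} (hij : i ≠ j) :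
    ‖a i - a j‖ = √(2 * r ^ 2 + 2 * r ^ 2 / k) := by
  rw [← Real.sqrt_sq (norm_nonneg (a i - a j)), norm_sub_sq_real, h.norm_a, h.norm_a,
    h.inner_a_eq hk, if_neg hij]
  congr 1
  ring

/-- The regular simplex `c + conv a`. -/
theorem exists_simplex_of_isOrthoFrame {k m : ℕ} (hk : 1 ≤ k)
    {a : Fin (k + 1) → EuclideanSpace ℝ (Fin d)} {b : Fin (m + 1) → EuclideanSpace ℝ (Fin d)}
    {r s : ℝ} (h : IsOrthoFrame a b r s) (c : EuclideanSpace ℝ (Fin d)) :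
    ∃ S : Affine.Simplex ℝ (EuclideanSpace ℝ (Fin d)) k, S.points = (fun i => c + a i) ∧
      S.Equilateral ∧ S.centroid = c := by
  have hind : AffineIndependent ℝ fun i => c + a i := by
    have := h.affineIndependent_a hk
    rw [affineIndependent_iff_forall_sum] at this ⊢
    intro w hw hwa
    refine this w hw ?_
    simpa [smul_add, Finset.sum_add_distrib, ← Finset.sum_smul, hw] using hwa
  refine ⟨⟨_, hind⟩, rfl, ⟨√(2 * r ^ 2 + 2 * r ^ 2 / k), fun i j hij => ?_⟩, ?_⟩
  · rw [dist_eq_norm, add_sub_add_left_eq_sub]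
    exact h.norm_sub_a hk hij
  · rw [← sub_eq_zero, ← vsub_eq_sub, Affine.Simplex.centroid_vsub_eq]
    simp [h.sum_a]

/-- As the points sum to zero, adding `‖a i - a j‖ ^ 2` over `j` gives `k * l ^ 2 = (k + 1) * ‖a i‖
^ 2 + S`, with `S` independent of `i`; adding over `i` determines `S`. -/
theorem exists_const_norm_of_equilateral {E : Type*} [NormedAddCommGroup E]
    [InnerProductSpace ℝ E] {k : ℕ} (hk : 1 ≤ k) {a : Fin (k + 1) → E} (hsum : ∑ i, a i = 0)
    {l : ℝ} (hl : ∀ i j, i ≠ j → ‖a i - a j‖ = l) :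
    (∀ i, ‖a i‖ = √(k * l ^ 2 / (2 * (k + 1)))) ∧
      ∀ i j, i ≠ j → k * ⟪a i, a j⟫ = -√(k * l ^ 2 / (2 * (k + 1))) ^ 2 := by
  have hk0 : (0 : ℝ) < k := by positivity
  set S := ∑ j, ‖a j‖ ^ 2 with hS
  have h1 : ∀ i, (k : ℝ) * l ^ 2 = (k + 1) * ‖a i‖ ^ 2 + S := by
    intro i
    have h2 : ∑ j, ‖a i - a j‖ ^ 2 = k * l ^ 2 := by
      rw [← Finset.add_sum_erase _ _ (Finset.mem_univ i), sub_self, norm_zero,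
        Finset.sum_congr rfl (g := fun _ => l ^ 2)
          (fun j hj => by rw [hl i j (Finset.ne_of_mem_erase hj).symm])]
      simp
    rw [← h2]
    simp only [norm_sub_sq_real, Finset.sum_add_distrib, Finset.sum_sub_distrib, ← Finset.mul_sum,
      ← inner_sum, hsum, inner_zero_right]
    simp [hS]
  have hS' : 2 * S = k * l ^ 2 := by
    have h3 : ∑ i : Fin (k + 1), (k : ℝ) * l ^ 2 = ∑ i, ((k + 1) * ‖a i‖ ^ 2 + S) :=
      Finset.sum_congr rfl fun i _ => h1 i
    rw [Finset.sum_add_distrib, ← Finset.mul_sum Finset.univ (fun i => ‖a i‖ ^ 2), ← hS] at h3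
    simp only [Finset.sum_const, Finset.card_univ, Fintype.card_fin, nsmul_eq_mul] at h3
    push_cast at h3
    have hk1 : ((k : ℝ) + 1) ≠ 0 := by positivity
    have : ((k : ℝ) + 1) * (k * l ^ 2) = (k + 1) * (2 * S) := by linarith
    exact (mul_left_cancel₀ hk1 this).symm
  have h4 : ∀ i, ‖a i‖ ^ 2 = k * l ^ 2 / (2 * (k + 1)) := fun i => by
    have := h1 i
    field_simp
    linarith
  refine ⟨fun i => by rw [← h4 i, Real.sqrt_sq (norm_nonneg _)], fun i j hij => ?_⟩
  have h5 := norm_sub_sq_real (a i) (a j)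
  rw [hl i j hij, h4, h4] at h5
  rw [Real.sq_sqrt (by positivity)]
  have h6 : ⟪a i, a j⟫ = k * l ^ 2 / (2 * (k + 1)) - l ^ 2 / 2 := by linarith
  rw [h6]
  field_simp
  ring

theorem isOrthogonalSimplexHull_iff {k : ℕ} (hk : 1 ≤ k) (hkd : k + 1 ≤ d)
    {c : EuclideanSpace ℝ (Fin d)} {Q : Set (EuclideanSpace ℝ (Fin d))} :
    IsOrthogonalSimplexHull c k Q ↔ ∃ (a : Fin (k + 1) → EuclideanSpace ℝ (Fin d))
      (b : Fin (d - k + 1) → EuclideanSpace ℝ (Fin d)) (r s : ℝ), IsOrthoFrame a b r s ∧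
      Q = (fun x => c + x) '' convexHull ℝ (Set.range a ∪ Set.range b) := by
  have hhull : ∀ (a : Fin (k + 1) → EuclideanSpace ℝ (Fin d))
      (b : Fin (d - k + 1) → EuclideanSpace ℝ (Fin d))
      (S₁ : Affine.Simplex ℝ (EuclideanSpace ℝ (Fin d)) k)
      (S₂ : Affine.Simplex ℝ (EuclideanSpace ℝ (Fin d)) (d - k)),
      S₁.points = (fun i => c + a i) → S₂.points = (fun i => c + b i) →
      convexHull ℝ (S₁.closedInterior ∪ S₂.closedInterior) =
        (fun x => c + x) '' convexHull ℝ (Set.range a ∪ Set.range b) := by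
    intro a b S₁ S₂ h1 h2
    rw [← Affine.Simplex.convexHull_eq_closedInterior, ← Affine.Simplex.convexHull_eq_closedInterior,
      convexHull_convexHull_union_left, convexHull_convexHull_union_right, h1, h2]
    have := ((AffineEquiv.constVAdd ℝ (EuclideanSpace ℝ (Fin d)) c).toAffineMap).image_convexHull
      (Set.range a ∪ Set.range b)
    rw [Set.image_union, ← Set.range_comp, ← Set.range_comp] at this
    exact this.symm
  have hm : 1 ≤ d - k := by omega
  constructor
  · rintro ⟨S₁, S₂, ⟨l₁, hl₁⟩, ⟨l₂, hl₂⟩, hc₁, hc₂, horth, rfl⟩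
    have hs₁ : ∑ i, (S₁.points i - c) = 0 := by
      have := S₁.centroid_vsub_eq c
      rw [hc₁, vsub_self, eq_comm, smul_eq_zero] at this
      exact this.resolve_left (by positivity)
    have hs₂ : ∑ i, (S₂.points i - c) = 0 := by
      have := S₂.centroid_vsub_eq c
      rw [hc₂, vsub_self, eq_comm, smul_eq_zero] at this
      exact this.resolve_left (by positivity)
    have hd₁ : ∀ i j, i ≠ j → ‖(S₁.points i - c) - (S₁.points j - c)‖ = l₁ := fun i j hij => by
      rw [sub_sub_sub_cancel_right, ← dist_eq_norm, hl₁ i j hij]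
    have hd₂ : ∀ i j, i ≠ j → ‖(S₂.points i - c) - (S₂.points j - c)‖ = l₂ := fun i j hij => by
      rw [sub_sub_sub_cancel_right, ← dist_eq_norm, hl₂ i j hij]
    obtain ⟨hn₁, hi₁⟩ := exists_const_norm_of_equilateral hk hs₁ hd₁
    obtain ⟨hn₂, hi₂⟩ := exists_const_norm_of_equilateral hm hs₂ hd₂
    have hpos : ∀ {n : ℕ} (S : Affine.Simplex ℝ (EuclideanSpace ℝ (Fin d)) n) {l : ℝ},
        1 ≤ n → (∀ i j, i ≠ j → dist (S.points i) (S.points j) = l) → 0 < l := by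
      intro n S l hn hl
      have hne : (0 : Fin (n + 1)) ≠ Fin.last n := by simp [Fin.ext_iff]; omega
      rw [← hl 0 (Fin.last n) hne, dist_pos]
      exact S.independent.injective.ne hne
    have hp₁ := hpos S₁ hk hl₁
    have hp₂ := hpos S₂ hm hl₂
    have hk0 : (0 : ℝ) < k := by positivity
    have hm0 : (0 : ℝ) < (d - k : ℕ) := by positivity
    refine ⟨fun i => S₁.points i - c, fun i => S₂.points i - c, _, _,
      ⟨Real.sqrt_pos.2 (by positivity), Real.sqrt_pos.2 (by positivity), hn₁, hn₂, hs₁, hs₂, hi₁,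
        hi₂, fun i j => ?_⟩, ?_⟩
    · refine Submodule.isOrtho_iff_inner_eq.1 horth _ ?_ _ ?_
      · exact AffineSubspace.vsub_mem_direction (mem_affineSpan ℝ ⟨i, rfl⟩)
          (hc₁ ▸ S₁.centroid_mem_affineSpan)
      · exact AffineSubspace.vsub_mem_direction (mem_affineSpan ℝ ⟨j, rfl⟩)
          (hc₂ ▸ S₂.centroid_mem_affineSpan)
    · exact hhull _ _ S₁ S₂ (by simp) (by simp)
  · rintro ⟨a, b, r, s, h, rfl⟩
    obtain ⟨S₁, hp₁, he₁, hc₁⟩ := exists_simplex_of_isOrthoFrame hk h c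
    obtain ⟨S₂, hp₂, he₂, hc₂⟩ := exists_simplex_of_isOrthoFrame hm h.symm c
    refine ⟨S₁, S₂, he₁, he₂, hc₁, hc₂, ?_, (hhull a b S₁ S₂ hp₁ hp₂).symm⟩
    rw [direction_affineSpan, direction_affineSpan, vectorSpan_def, vectorSpan_def,
      Submodule.isOrtho_span, hp₁, hp₂]
    rintro _ ⟨_, ⟨i, rfl⟩, _, ⟨j, rfl⟩, rfl⟩ _ ⟨_, ⟨i', rfl⟩, _, ⟨j', rfl⟩, rfl⟩
    simp [inner_sub_left, inner_sub_right, h.inner_ab]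

/-- Type `d / 2` attains the lower bound valid for all polytopes. A minimiser of smaller type `k`
would have volume at least the optimum for `k`, which is strictly larger. -/
theorem euclidean_minimizers (hd : 2 ≤ d) (c : EuclideanSpace ℝ (Fin d)) {ρ : ℝ} (hρ : 0 < ρ) :
    (∃ k Q, IsEuclideanMinimizer c ρ k Q) ∧
      ∀ k Q, IsEuclideanMinimizer c ρ k Q → k = d / 2 := by
  have hfin : Module.finrank ℝ (EuclideanSpace ℝ (Fin d)) = d := finrank_euclideanSpace_fin
  have hball : ∀ A : Set (EuclideanSpace ℝ (Fin d)),
      Metric.closedBall c ρ ⊆ (fun x => c + x) '' A ↔ Metric.closedBall 0 ρ ⊆ A := by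
    intro A
    have : Metric.closedBall c ρ = (fun x => c + x) '' Metric.closedBall 0 ρ := by
      rw [Set.image_add_left, preimage_add_closedBall]
      simp
    rw [this, Set.image_subset_image_iff (add_right_injective c)]
  have hvol : ∀ A : Set (EuclideanSpace ℝ (Fin d)), volume ((fun x => c + x) '' A) = volume A := by
    intro A
    rw [Set.image_add_left, measure_preimage_add]
  have hpoly : ∀ P : Set (EuclideanSpace ℝ (Fin d)), IsPolytopeWithAtMost (d + 2) P →
      Metric.closedBall c ρ ⊆ P → ENNReal.ofReal (optimalVolume (d / 2) (d - d / 2) ρ) *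
        cornerVolume (EuclideanSpace ℝ (Fin d)) ≤ volume P := by
    classical
    rintro P ⟨t, ht, rfl⟩ hP
    have himage : convexHull ℝ (t : Set (EuclideanSpace ℝ (Fin d))) =
        (fun x => c + x) '' convexHull ℝ ((t.image fun x => -c + x : Finset _) : Set _) := by
      have := ((AffineEquiv.constVAdd ℝ (EuclideanSpace ℝ (Fin d)) c).toAffineMap).image_convexHull
        ((t.image fun x => -c + x : Finset _) : Set (EuclideanSpace ℝ (Fin d)))
      refine Eq.trans ?_ this.symm
      congr 1
      ext x
      simp
    rw [himage, hvol]
    rw [himage, hball] at hP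
    exact optimalVolume_mul_le_volume_polytope hd hfin (Finset.card_image_le.trans ht) hρ hP
  obtain ⟨a, b, h, hb, hv⟩ := exists_optimal_isOrthoFrame (E := EuclideanSpace ℝ (Fin d))
    (k := d / 2) (m := d - d / 2) (by omega) (by omega) (by rw [hfin]; omega) hρ
  have hopt : IsOrthogonalSimplexHull c (d / 2)
      ((fun x => c + x) '' convexHull ℝ (Set.range a ∪ Set.range b)) :=
    (isOrthogonalSimplexHull_iff (by omega) (by omega)).2 ⟨a, b, _, _, h, rfl⟩
  refine ⟨⟨d / 2, _, by omega, by omega, hopt, (hball _).2 hb, fun P hP hPb => ?_⟩, ?_⟩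
  · rw [hvol, hv]
    exact hpoly P hP hPb
  · rintro k Q ⟨hk, hkd, hQ, hQb, hmin⟩
    obtain ⟨a', b', r', s', h', rfl⟩ := (isOrthogonalSimplexHull_iff hk (by omega)).1 hQ
    rw [hball] at hQb
    have h1 := h'.optimalVolume_mul_le_volume hk (by omega) (by rw [hfin]; omega) hρ hQb
    have hP : IsPolytopeWithAtMost (d + 2)
        ((fun x => c + x) '' convexHull ℝ (Set.range a ∪ Set.range b)) := by
      classical
      refine ⟨Finset.univ.image (Sum.elim (fun i => c + a i) fun i => c + b i), ?_, ?_⟩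
      · refine Finset.card_image_le.trans ?_
        simp
        omega
      · have := ((AffineEquiv.constVAdd ℝ (EuclideanSpace ℝ (Fin d)) c).toAffineMap).image_convexHull
          (Set.range a ∪ Set.range b)
        rw [Set.image_union, ← Set.range_comp, ← Set.range_comp] at this
        refine this.trans ?_
        rw [Finset.coe_image, Finset.coe_univ, Set.image_univ, Set.Sum.elim_range]
        rfl
    have h2 := hmin _ hP ((hball _).2 hb)
    rw [hvol, hvol, hv] at h2
    have h3 := (ENNReal.mul_le_mul_iff_left cornerVolume_ne_zero cornerVolume_ne_top).1 (h1.trans h2)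
    rw [ENNReal.ofReal_le_ofReal_iff (optimalVolume_pos (by omega) hρ).le] at h3
    by_contra hne
    exact absurd (optimalVolume_half_lt (show k < d / 2 by omega) hρ) (not_lt.2 h3)

end EuclideanHull

/-! ### The projective involution exchanging the origin and a given point -/

section KleinInvolution

variable {E : Type*} [NormedAddCommGroup E] [InnerProductSpace ℝ E]

/-- The self-adjoint linear map with eigenvalue `1` at `c` and `√(1 - ‖c‖²)` on the orthogonal
complement. -/
noncomputable def kleinStretch (c : E) : E →L[ℝ] E :=
  √(1 - ‖c‖ ^ 2) • ContinuousLinearMap.id ℝ E +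
    (1 + √(1 - ‖c‖ ^ 2))⁻¹ • (innerSL ℝ c).smulRight c

theorem kleinStretch_apply (c x : E) :
    kleinStretch c x = √(1 - ‖c‖ ^ 2) • x + ((1 + √(1 - ‖c‖ ^ 2))⁻¹ * ⟪c, x⟫) • c := by
  simp [kleinStretch, smul_smul]

/-- The isometric involution of the projective model exchanging `0` and `c`: the point reflection
in the midpoint of `0` and `c`. -/
noncomputable def kleinInvolution (c x : E) : E := (1 - ⟪c, x⟫)⁻¹ • (c - kleinStretch c x)

variable {c x y : E}

theorem inner_lt_one_of_norm_lt_one (hc : ‖c‖ < 1) (hx : ‖x‖ < 1) : ⟪c, x⟫ < 1 :=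
  (real_inner_le_norm c x).trans_lt (by nlinarith [norm_nonneg c, norm_nonneg x])

theorem one_sub_inner_pos (hc : ‖c‖ < 1) (hx : ‖x‖ < 1) : 0 < 1 - ⟪c, x⟫ :=
  sub_pos.2 (inner_lt_one_of_norm_lt_one hc hx)

theorem one_sub_norm_sq_pos (hc : ‖c‖ < 1) : 0 < 1 - ‖c‖ ^ 2 := by
  nlinarith [norm_nonneg c]

theorem norm_sq_eq_one_sub_sqrt (hc : ‖c‖ < 1) : ‖c‖ ^ 2 = 1 - √(1 - ‖c‖ ^ 2) ^ 2 := by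
  rw [Real.sq_sqrt (one_sub_norm_sq_pos hc).le]
  ring

theorem inner_kleinStretch_self (hc : ‖c‖ < 1) (x : E) : ⟪c, kleinStretch c x⟫ = ⟪c, x⟫ := by
  have h := norm_sq_eq_one_sub_sqrt hc
  have h0 := Real.sqrt_nonneg (1 - ‖c‖ ^ 2)
  rw [kleinStretch_apply, inner_add_right, inner_smul_right, inner_smul_right,
    real_inner_self_eq_norm_sq]
  generalize √(1 - ‖c‖ ^ 2) = s at *
  rw [h]
  have : 1 + s ≠ 0 := by positivity
  field_simp
  ring

theorem inner_kleinStretch (hc : ‖c‖ < 1) (x y : E) :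
    ⟪kleinStretch c x, kleinStretch c y⟫ = (1 - ‖c‖ ^ 2) * ⟪x, y⟫ + ⟪c, x⟫ * ⟪c, y⟫ := by
  have h := norm_sq_eq_one_sub_sqrt hc
  have h0 := Real.sqrt_nonneg (1 - ‖c‖ ^ 2)
  rw [kleinStretch_apply, inner_add_left, inner_smul_left, inner_smul_left,
    inner_kleinStretch_self hc, kleinStretch_apply, inner_add_right, inner_smul_right,
    inner_smul_right, real_inner_comm c x]
  simp only [conj_trivial]
  generalize √(1 - ‖c‖ ^ 2) = s at *
  rw [h]
  have : 1 + s ≠ 0 := by positivity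
  field_simp
  ring

theorem kleinStretch_self (hc : ‖c‖ < 1) : kleinStretch c c = c := by
  have h := norm_sq_eq_one_sub_sqrt hc
  have h0 := Real.sqrt_nonneg (1 - ‖c‖ ^ 2)
  rw [kleinStretch_apply, ← add_smul, real_inner_self_eq_norm_sq]
  generalize √(1 - ‖c‖ ^ 2) = s at *
  rw [h]
  have : 1 + s ≠ 0 := by positivity
  rw [show s + (1 + s)⁻¹ * (1 - s ^ 2) = 1 by field_simp; ring, one_smul]

theorem kleinStretch_kleinStretch (hc : ‖c‖ < 1) (x : E) :
    kleinStretch c (kleinStretch c x) = (1 - ‖c‖ ^ 2) • x + ⟪c, x⟫ • c := by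
  have h := norm_sq_eq_one_sub_sqrt hc
  have h0 := Real.sqrt_nonneg (1 - ‖c‖ ^ 2)
  rw [kleinStretch_apply c x, map_add, map_smul, map_smul, kleinStretch_self hc,
    kleinStretch_apply, smul_add, smul_smul, smul_smul, add_assoc, ← add_smul]
  generalize √(1 - ‖c‖ ^ 2) = s at *
  rw [h]
  have : 1 + s ≠ 0 := by positivity
  congr 2
  · ring
  · field_simp
    ring

theorem smul_kleinInvolution (hc : ‖c‖ < 1) (hx : ‖x‖ < 1) :
    (1 - ⟪c, x⟫) • kleinInvolution c x = c - kleinStretch c x := by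
  rw [kleinInvolution, smul_inv_smul₀ (one_sub_inner_pos hc hx).ne']

/-- Up to sign, `1 - ⟪x, y⟫` is the Lorentz form of the lifts of `x` and `y` to height one. It is
preserved up to a constant and factors depending on `x` or `y` alone, which cancel in the formula
for the hyperbolic distance. -/
theorem one_sub_inner_kleinInvolution (hc : ‖c‖ < 1) (hx : ‖x‖ < 1) (hy : ‖y‖ < 1) :
    1 - ⟪kleinInvolution c x, kleinInvolution c y⟫ =
      (1 - ‖c‖ ^ 2) * (1 - ⟪x, y⟫) / ((1 - ⟪c, x⟫) * (1 - ⟪c, y⟫)) := by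
  have h1 := one_sub_inner_pos hc hx
  have h2 := one_sub_inner_pos hc hy
  rw [eq_div_iff (by positivity), sub_mul, mul_comm ⟪kleinInvolution c x, kleinInvolution c y⟫,
    mul_assoc, ← real_inner_smul_right, ← real_inner_smul_left, smul_kleinInvolution hc hx,
    smul_kleinInvolution hc hy, inner_sub_left, inner_sub_right, inner_sub_right,
    inner_kleinStretch hc, inner_kleinStretch_self hc, real_inner_comm c (kleinStretch c x),
    inner_kleinStretch_self hc, real_inner_self_eq_norm_sq]
  ring

theorem one_sub_norm_kleinInvolution_sq (hc : ‖c‖ < 1) (hx : ‖x‖ < 1) :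
    1 - ‖kleinInvolution c x‖ ^ 2 = (1 - ‖c‖ ^ 2) * (1 - ‖x‖ ^ 2) / (1 - ⟪c, x⟫) ^ 2 := by
  rw [← real_inner_self_eq_norm_sq, one_sub_inner_kleinInvolution hc hx hx,
    real_inner_self_eq_norm_sq, sq (1 - ⟪c, x⟫)]

theorem norm_kleinInvolution_lt_one (hc : ‖c‖ < 1) (hx : ‖x‖ < 1) :
    ‖kleinInvolution c x‖ < 1 := by
  have h := one_sub_norm_kleinInvolution_sq hc hx
  have h1 := one_sub_norm_sq_pos hc
  have h2 := one_sub_norm_sq_pos hx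
  have h3 := one_sub_inner_pos hc hx
  have h4 : 0 < 1 - ‖kleinInvolution c x‖ ^ 2 := by rw [h]; positivity
  nlinarith [norm_nonneg (kleinInvolution c x)]

theorem kleinInvolution_zero (c : E) : kleinInvolution c 0 = c := by
  simp [kleinInvolution]

theorem kleinInvolution_self (hc : ‖c‖ < 1) : kleinInvolution c c = 0 := by
  simp [kleinInvolution, kleinStretch_self hc]

theorem one_sub_inner_self_kleinInvolution (hc : ‖c‖ < 1) (hx : ‖x‖ < 1) :
    1 - ⟪c, kleinInvolution c x⟫ = (1 - ‖c‖ ^ 2) / (1 - ⟪c, x⟫) := by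
  have := one_sub_inner_kleinInvolution hc (x := 0) (by simp) hx
  rw [kleinInvolution_zero] at this
  simpa using this

theorem kleinInvolution_kleinInvolution (hc : ‖c‖ < 1) (hx : ‖x‖ < 1) :
    kleinInvolution c (kleinInvolution c x) = x := by
  have h1 := one_sub_norm_sq_pos hc
  have h3 := one_sub_inner_pos hc hx
  rw [kleinInvolution, one_sub_inner_self_kleinInvolution hc hx, inv_smul_eq_iff₀ (by positivity),
    kleinInvolution, map_smul, map_sub, kleinStretch_self hc, kleinStretch_kleinStretch hc]
  have h4 := h3.ne'
  rw [← smul_right_injective E h4 |>.eq_iff]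
  simp only [smul_sub, smul_smul, smul_add, mul_inv_cancel₀ h4, mul_div_cancel₀ _ h4]
  match_scalars
  · field_simp
    ring
  · field_simp

theorem smul_kleinInvolution_sub (hc : ‖c‖ < 1) (hx : ‖x‖ < 1) :
    (1 - ⟪c, x⟫) • (kleinInvolution c x - c) = ⟪c, x⟫ • c - kleinStretch c x := by
  rw [smul_sub, smul_kleinInvolution hc hx]
  module

/-- A projective map sends segments to segments: the barycentric weights are divided by the
denominators `1 - ⟪c, x⟫` and `1 - ⟪c, y⟫` and renormalised. -/
theorem exists_smul_add_smul_kleinInvolution (hc : ‖c‖ < 1) (hx : ‖x‖ < 1) (hy : ‖y‖ < 1)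
    {α β : ℝ} (hα : 0 ≤ α) (hβ : 0 ≤ β) (hαβ : α + β = 1) :
    ∃ α' β' : ℝ, 0 ≤ α' ∧ 0 ≤ β' ∧ α' + β' = 1 ∧
      kleinInvolution c (α' • x + β' • y) = α • kleinInvolution c x + β • kleinInvolution c y := by
  have h1 := one_sub_inner_pos hc hx
  have h2 := one_sub_inner_pos hc hy
  have hN : 0 < α / (1 - ⟪c, x⟫) + β / (1 - ⟪c, y⟫) := by
    rcases hα.eq_or_lt with rfl | h
    · have : β = 1 := by linarith
      subst this
      positivity
    · positivity
  set N := α / (1 - ⟪c, x⟫) + β / (1 - ⟪c, y⟫) with hNdef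
  refine ⟨α / (1 - ⟪c, x⟫) / N, β / (1 - ⟪c, y⟫) / N, by positivity, by positivity, ?_, ?_⟩
  · rw [← add_div, ← hNdef, div_self hN.ne']
  · have h3 : 1 - ⟪c, (α / (1 - ⟪c, x⟫) / N) • x + (β / (1 - ⟪c, y⟫) / N) • y⟫ = N⁻¹ := by
      rw [inner_add_right, inner_smul_right, inner_smul_right]
      refine eq_inv_of_mul_eq_one_right ?_
      have : N * (α / (1 - ⟪c, x⟫) / N * ⟪c, x⟫ + β / (1 - ⟪c, y⟫) / N * ⟪c, y⟫) = N - 1 := by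
        have e1 : ∀ u v : ℝ, N * (u / N * v) = u * v := fun u v => by field_simp
        have e2 : ∀ u v : ℝ, 0 < 1 - v → u / (1 - v) * v = u / (1 - v) - u := fun u v hv => by
          field_simp
          ring
        rw [mul_add, e1, e1, e2 _ _ h1, e2 _ _ h2, hNdef]
        linarith
      linarith
    rw [kleinInvolution, h3, inv_inv, map_add, map_smul, map_smul, kleinInvolution, kleinInvolution]
    have h4 : N • c = (α / (1 - ⟪c, x⟫)) • c + (β / (1 - ⟪c, y⟫)) • c := by
      rw [hNdef, add_smul]
    rw [smul_sub, smul_add, smul_smul, smul_smul, h4, mul_div_cancel₀ _ hN.ne',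
      mul_div_cancel₀ _ hN.ne', smul_smul, smul_smul, ← div_eq_mul_inv, ← div_eq_mul_inv]
    module

theorem convex_image_kleinInvolution (hc : ‖c‖ < 1) {S : Set E} (hS : Convex ℝ S)
    (hS1 : S ⊆ Metric.ball 0 1) : Convex ℝ (kleinInvolution c '' S) := by
  rintro _ ⟨x, hx, rfl⟩ _ ⟨y, hy, rfl⟩ α β hα hβ hαβ
  obtain ⟨α', β', h1, h2, h3, h4⟩ := exists_smul_add_smul_kleinInvolution hc
    (mem_ball_zero_iff.1 (hS1 hx)) (mem_ball_zero_iff.1 (hS1 hy)) hα hβ hαβ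
  exact ⟨_, hS hx hy h1 h2 h3, h4⟩

theorem image_kleinInvolution_subset_ball (hc : ‖c‖ < 1) {S : Set E}
    (hS : S ⊆ Metric.ball 0 1) : kleinInvolution c '' S ⊆ Metric.ball 0 1 := by
  rintro _ ⟨x, hx, rfl⟩
  exact mem_ball_zero_iff.2 (norm_kleinInvolution_lt_one hc (mem_ball_zero_iff.1 (hS hx)))

theorem image_kleinInvolution_image (hc : ‖c‖ < 1) {S : Set E} (hS : S ⊆ Metric.ball 0 1) :
    kleinInvolution c '' (kleinInvolution c '' S) = S := by
  rw [Set.image_image, Set.image_congr (g := id), Set.image_id]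
  exact fun x hx => kleinInvolution_kleinInvolution hc (mem_ball_zero_iff.1 (hS hx))

/-- One inclusion holds since images of convex sets are convex; applying it to the image of `S` and
using the involution property gives the other. -/
theorem image_kleinInvolution_convexHull (hc : ‖c‖ < 1) {S : Set E} (hS : S ⊆ Metric.ball 0 1) :
    kleinInvolution c '' convexHull ℝ S = convexHull ℝ (kleinInvolution c '' S) := by
  have key : ∀ S : Set E, S ⊆ Metric.ball 0 1 →
      convexHull ℝ (kleinInvolution c '' S) ⊆ kleinInvolution c '' convexHull ℝ S := fun S hS =>
    convexHull_min (Set.image_mono (subset_convexHull ℝ S))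
      (convex_image_kleinInvolution hc (convex_convexHull ℝ S)
        (convexHull_min hS (convex_ball 0 1)))
  refine Set.Subset.antisymm ?_ (key S hS)
  have h1 := image_kleinInvolution_subset_ball hc hS
  have h2 := Set.image_mono (f := kleinInvolution c) (key _ h1)
  rw [image_kleinInvolution_image hc hS,
    image_kleinInvolution_image hc (convexHull_min h1 (convex_ball 0 1))] at h2
  exact h2

theorem injOn_kleinInvolution (hc : ‖c‖ < 1) :
    Set.InjOn (kleinInvolution c) (Metric.ball 0 1) := fun x hx y hy h => by
  rw [← kleinInvolution_kleinInvolution hc (mem_ball_zero_iff.1 hx), h,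
    kleinInvolution_kleinInvolution hc (mem_ball_zero_iff.1 hy)]

/-- The derivative of `kleinInvolution c` at `x`. -/
noncomputable def kleinDeriv (c x : E) : E →L[ℝ] E :=
  (1 - ⟪c, x⟫)⁻¹ • ((innerSL ℝ c).smulRight (kleinInvolution c x) - kleinStretch c)

theorem hasFDerivAt_kleinInvolution (hc : ‖c‖ < 1) (hx : ‖x‖ < 1) :
    HasFDerivAt (kleinInvolution c) (kleinDeriv c x) x := by
  have h3 := (one_sub_inner_pos hc hx).ne'
  have h1 : HasFDerivAt (fun x : E => 1 - ⟪c, x⟫) (-innerSL ℝ c) x := by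
    simpa using ((innerSL ℝ c).hasFDerivAt (x := x)).const_sub 1
  have h2 : HasFDerivAt (fun x : E => c - kleinStretch c x) (-kleinStretch c) x :=
    (kleinStretch c).hasFDerivAt.const_sub c
  have h4 := (((hasDerivAt_inv h3).comp_hasFDerivAt x h1)).smul h2
  refine h4.congr_fderiv ?_
  ext1 v
  simp only [kleinDeriv, kleinInvolution, smul_apply,
    sub_apply, add_apply, neg_apply,
    ContinuousLinearMap.smulRight_apply, innerSL_apply_apply, smul_sub, smul_smul, Function.comp]
  simp only [smul_eq_mul]
  have : (1 - ⟪c, x⟫)⁻¹ * (1 - ⟪c, x⟫)⁻¹ = ((1 - ⟪c, x⟫) ^ 2)⁻¹ := by field_simp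
  match_scalars <;> field_simp

/-- The derivative is a scalar times a rank-one perturbation of the identity. The perturbation has
determinant equal to the absolute value of the scalar, whence the exponent exceeds the dimension by
one. -/
theorem abs_det_kleinDeriv [FiniteDimensional ℝ E] (hc : ‖c‖ < 1) (hx : ‖x‖ < 1) :
    |(kleinDeriv c x).det| = (√(1 - ‖c‖ ^ 2) / (1 - ⟪c, x⟫)) ^ (Module.finrank ℝ E + 1) := by
  have h3 := one_sub_inner_pos hc hx
  have hs : 0 < √(1 - ‖c‖ ^ 2) := Real.sqrt_pos.2 (one_sub_norm_sq_pos hc)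
  have h := norm_sq_eq_one_sub_sqrt hc
  have h5 := one_sub_inner_self_kleinInvolution hc hx
  set s := √(1 - ‖c‖ ^ 2) with hsdef
  have h4 : (kleinDeriv c x : E →ₗ[ℝ] E) = (-(s / (1 - ⟪c, x⟫))) •
      LinearMap.transvection (innerSL ℝ c : E →ₗ[ℝ] ℝ)
        (-s⁻¹ • (kleinInvolution c x - (1 + s)⁻¹ • c)) := by
    ext v
    simp only [kleinDeriv, ContinuousLinearMap.coe_coe, smul_apply,
      sub_apply, ContinuousLinearMap.smulRight_apply, innerSL_apply_apply,
      LinearMap.smul_apply, LinearMap.transvection.apply, kleinStretch_apply]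
    rw [← hsdef]
    match_scalars <;> field_simp
  rw [ContinuousLinearMap.det, h4, LinearMap.det_smul, LinearMap.transvection.det]
  have h6 : 1 + (innerSL ℝ c : E →ₗ[ℝ] ℝ) (-s⁻¹ • (kleinInvolution c x - (1 + s)⁻¹ • c)) =
      s / (1 - ⟪c, x⟫) := by
    have h7 : ⟪c, kleinInvolution c x⟫ = 1 - s ^ 2 / (1 - ⟪c, x⟫) := by
      rw [h, sub_sub_cancel] at h5
      linarith
    rw [ContinuousLinearMap.coe_coe, innerSL_apply_apply, inner_smul_right, inner_sub_right,
      inner_smul_right, h7, real_inner_self_eq_norm_sq, h]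
    field_simp
    ring
  rw [h6, abs_mul, abs_pow, abs_neg, abs_of_pos (by positivity), ← pow_succ]

end KleinInvolution

/-! ### Invariance of hyperbolic distance and volume -/

section HyperbolicIsometry

variable {d : ℕ} {c x y : EuclideanSpace ℝ (Fin d)}

theorem mem_kleinBall : x ∈ kleinBall d ↔ ‖x‖ < 1 := mem_ball_zero_iff

theorem hypDist_kleinInvolution (hc : c ∈ kleinBall d) (hx : x ∈ kleinBall d)
    (hy : y ∈ kleinBall d) :
    hypDist (kleinInvolution c x) (kleinInvolution c y) = hypDist x y := by
  rw [mem_kleinBall] at hc hx hy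
  have h1 := one_sub_inner_pos hc hx
  have h2 := one_sub_inner_pos hc hy
  have h3 := one_sub_norm_sq_pos hc
  have h4 := Real.sqrt_pos.2 (one_sub_norm_sq_pos hx)
  have h5 := Real.sqrt_pos.2 (one_sub_norm_sq_pos hy)
  have h6 := Real.sqrt_pos.2 h3
  have h7 := Real.sq_sqrt h3.le
  rw [hypDist, hypDist, one_sub_inner_kleinInvolution hc hx hy,
    one_sub_norm_kleinInvolution_sq hc hx, one_sub_norm_kleinInvolution_sq hc hy,
    Real.sqrt_div' _ (by positivity), Real.sqrt_div' _ (by positivity), Real.sqrt_sq h1.le,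
    Real.sqrt_sq h2.le, Real.sqrt_mul h3.le, Real.sqrt_mul h3.le]
  congr 1
  nth_rewrite 1 [← h7]
  field_simp

theorem hypDist_ratio_pos (hx : x ∈ kleinBall d) (hy : y ∈ kleinBall d) :
    0 < (1 - ⟪x, y⟫) / (√(1 - ‖x‖ ^ 2) * √(1 - ‖y‖ ^ 2)) := by
  rw [mem_kleinBall] at hx hy
  have h1 := one_sub_inner_pos hx hy
  have h4 := Real.sqrt_pos.2 (one_sub_norm_sq_pos hx)
  have h5 := Real.sqrt_pos.2 (one_sub_norm_sq_pos hy)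
  positivity

/-- The hyperbolic cosine of the distance from `0` to `x` is `1 / √(1 - ‖x‖ ^ 2)`, so `‖x‖` is its
hyperbolic tangent. -/
theorem hypClosedBall_zero {r : ℝ} (hr : 0 ≤ r) :
    hypClosedBall (0 : EuclideanSpace ℝ (Fin d)) r = Metric.closedBall 0 (Real.tanh r) := by
  have hcosh := Real.cosh_pos r
  have htanh : Real.tanh r ^ 2 = 1 - (Real.cosh r ^ 2)⁻¹ := by
    rw [Real.tanh_eq_sinh_div_cosh, div_pow, Real.sinh_sq]
    field_simp
  have htanh0 : 0 ≤ Real.tanh r := by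
    rw [Real.tanh_eq_sinh_div_cosh]
    have := Real.sinh_nonneg_iff.2 hr
    positivity
  ext x
  have key : ‖x‖ < 1 → (hypDist 0 x ≤ r ↔ ‖x‖ ≤ Real.tanh r) := by
    intro hx
    have h5 := one_sub_norm_sq_pos hx
    have h6 := Real.sqrt_pos.2 h5
    have h7 := hypDist_ratio_pos (d := d) (x := 0) (by simp [mem_kleinBall]) (mem_kleinBall.2 hx)
    nth_rewrite 1 [← Real.arcosh_cosh hr]
    rw [hypDist, Real.arcosh_le_arcosh h7 hcosh, ← sq_le_sq₀ (norm_nonneg x) htanh0, htanh]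
    simp only [inner_zero_left, sub_zero, norm_zero, ne_eq, OfNat.ofNat_ne_zero, not_false_eq_true,
      zero_pow, Real.sqrt_one, one_mul]
    rw [div_le_iff₀ h6, ← sq_le_sq₀ zero_le_one (by positivity), mul_pow, Real.sq_sqrt h5.le,
      one_pow, ← div_le_iff₀' (by positivity), one_div]
    constructor <;> intro h <;> linarith
  rw [mem_closedBall_zero_iff]
  constructor
  · rintro ⟨h1, h2⟩
    exact (key (mem_kleinBall.1 h1)).1 h2
  · intro h
    have h1 : ‖x‖ < 1 := h.trans_lt (Real.tanh_lt_one r)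
    exact ⟨mem_kleinBall.2 h1, (key h1).2 h⟩

theorem kleinInvolution_mem_kleinBall (hc : c ∈ kleinBall d) (hx : x ∈ kleinBall d) :
    kleinInvolution c x ∈ kleinBall d :=
  mem_kleinBall.2 (norm_kleinInvolution_lt_one (mem_kleinBall.1 hc) (mem_kleinBall.1 hx))

theorem image_hypClosedBall (hc : c ∈ kleinBall d) {r : ℝ} (hr : 0 ≤ r) :
    kleinInvolution c '' Metric.closedBall 0 (Real.tanh r) = hypClosedBall c r := by
  have h0 : (0 : EuclideanSpace ℝ (Fin d)) ∈ kleinBall d := by simp [mem_kleinBall]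
  rw [← hypClosedBall_zero hr]
  ext y
  constructor
  · rintro ⟨x, ⟨h1, h2⟩, rfl⟩
    refine ⟨kleinInvolution_mem_kleinBall hc h1, ?_⟩
    rw [← hypDist_kleinInvolution hc h0 h1, kleinInvolution_zero] at h2
    exact h2
  · rintro ⟨h1, h2⟩
    have h3 := kleinInvolution_kleinInvolution (mem_kleinBall.1 hc) (mem_kleinBall.1 h1)
    refine ⟨kleinInvolution c y, ⟨kleinInvolution_mem_kleinBall hc h1, ?_⟩, h3⟩
    rw [← kleinInvolution_self (mem_kleinBall.1 hc), hypDist_kleinInvolution hc hc h1]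
    exact h2

theorem hypVolume_apply {S : Set (EuclideanSpace ℝ (Fin d))} (hS : MeasurableSet S)
    (hS1 : S ⊆ kleinBall d) : hypVolume d S =
      ∫⁻ x in S, ENNReal.ofReal ((1 - ‖x‖ ^ 2) ^ (-(((d : ℝ) + 1) / 2))) := by
  rw [hypVolume, withDensity_apply _ hS, Measure.restrict_restrict hS,
    Set.inter_eq_self_of_subset_left hS1]

theorem hasFDerivWithinAt_kleinInvolution (hc : c ∈ kleinBall d)
    {S : Set (EuclideanSpace ℝ (Fin d))} (hS1 : S ⊆ kleinBall d) :
    ∀ x ∈ S, HasFDerivWithinAt (kleinInvolution c) (kleinDeriv c x) S x := fun _ hx =>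
  (hasFDerivAt_kleinInvolution (mem_kleinBall.1 hc)
    (mem_kleinBall.1 (hS1 hx))).hasFDerivWithinAt

/-- Change of variables: the Jacobian is `u ^ (d + 1)` and the density at the image is `u ^ (-(d +
1))` times the density at `x`, with `u = √(1 - ‖c‖ ^ 2) / (1 - ⟪c, x⟫)`. -/
theorem hypVolume_image_kleinInvolution (hc : c ∈ kleinBall d)
    {S : Set (EuclideanSpace ℝ (Fin d))} (hS : MeasurableSet S) (hS1 : S ⊆ kleinBall d) :
    hypVolume d (kleinInvolution c '' S) = hypVolume d S := by
  have hder := hasFDerivWithinAt_kleinInvolution hc hS1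
  have hinj := (injOn_kleinInvolution (mem_kleinBall.1 hc)).mono hS1
  rw [hypVolume_apply (measurable_image_of_fderivWithin hS hder hinj)
    (image_kleinInvolution_subset_ball (mem_kleinBall.1 hc) hS1), hypVolume_apply hS hS1,
    lintegral_image_eq_lintegral_abs_det_fderiv_mul volume hS hder hinj]
  refine setLIntegral_congr_fun hS fun x hx => ?_
  have hc1 := mem_kleinBall.1 hc
  have hx1 := mem_kleinBall.1 (hS1 hx)
  have h1 := one_sub_inner_pos hc1 hx1
  have h2 := one_sub_norm_sq_pos hc1
  have h3 := one_sub_norm_sq_pos hx1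
  have h4 := Real.sqrt_pos.2 h2
  rw [abs_det_kleinDeriv hc1 hx1, ← ENNReal.ofReal_mul (by positivity),
    one_sub_norm_kleinInvolution_sq hc1 hx1, finrank_euclideanSpace_fin]
  congr 1
  rw [show (1 - ‖c‖ ^ 2) * (1 - ‖x‖ ^ 2) / (1 - ⟪c, x⟫) ^ 2 =
      (√(1 - ‖c‖ ^ 2) / (1 - ⟪c, x⟫)) ^ 2 * (1 - ‖x‖ ^ 2) by
    rw [div_pow, Real.sq_sqrt h2.le]; ring]
  have h5 : 0 < √(1 - ‖c‖ ^ 2) / (1 - ⟪c, x⟫) := by positivity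
  generalize √(1 - ‖c‖ ^ 2) / (1 - ⟪c, x⟫) = u at h5 ⊢
  rw [Real.mul_rpow (by positivity) h3.le, ← Real.rpow_natCast u 2, ← Real.rpow_mul h5.le,
    ← mul_assoc, ← Real.rpow_natCast u (d + 1), ← Real.rpow_add h5]
  push_cast
  rw [show (d : ℝ) + 1 + 2 * -((d + 1) / 2) = 0 by ring, Real.rpow_zero, one_mul]

/-- The hyperbolic volume density as a function of the Euclidean norm, infinite outside the
model. -/
noncomputable def hypRadialDensity (d : ℕ) (s : ℝ) : ENNReal :=
  if s < 1 then ENNReal.ofReal ((1 - s ^ 2) ^ (-(((d : ℝ) + 1) / 2))) else ⊤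

theorem measurable_hypRadialDensity (d : ℕ) : Measurable (hypRadialDensity d) := by
  unfold hypRadialDensity
  exact Measurable.ite measurableSet_Iio (by fun_prop) measurable_const

theorem monotoneOn_hypRadialDensity (d : ℕ) : MonotoneOn (hypRadialDensity d) (Set.Ici 0) := by
  intro s hs t ht hst
  have hs : 0 ≤ s := hs
  unfold hypRadialDensity
  split_ifs with h1 h2 h2
  · refine ENNReal.ofReal_le_ofReal (Real.rpow_le_rpow_of_nonpos (by nlinarith) (by nlinarith) ?_)
    have : (0 : ℝ) ≤ d := by positivity
    linarith
  · exact le_top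
  · exact absurd (hst.trans_lt h2) h1
  · exact le_rfl

theorem one_le_hypRadialDensity (d : ℕ) {s : ℝ} (hs : 0 ≤ s) : 1 ≤ hypRadialDensity d s := by
  refine le_trans ?_ (monotoneOn_hypRadialDensity d (Set.mem_Ici.2 le_rfl) (Set.mem_Ici.2 hs) hs)
  simp [hypRadialDensity]

theorem hypVolume_eq_radialMeasure {S : Set (EuclideanSpace ℝ (Fin d))} (hS : MeasurableSet S)
    (hS1 : S ⊆ kleinBall d) :
    hypVolume d S = radialMeasure (EuclideanSpace ℝ (Fin d)) (hypRadialDensity d) S := by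
  rw [hypVolume_apply hS hS1, radialMeasure, withDensity_apply _ hS]
  refine setLIntegral_congr_fun hS fun x hx => ?_
  simp [hypRadialDensity, mem_kleinBall.1 (hS1 hx)]

theorem volume_le_radialMeasure_hypRadialDensity {S : Set (EuclideanSpace ℝ (Fin d))}
    (hS : MeasurableSet S) :
    volume S ≤ radialMeasure (EuclideanSpace ℝ (Fin d)) (hypRadialDensity d) S := by
  rw [radialMeasure, withDensity_apply _ hS, ← setLIntegral_one]
  exact lintegral_mono fun x => one_le_hypRadialDensity d (norm_nonneg x)

theorem radialMeasure_hypRadialDensity_le {S : Set (EuclideanSpace ℝ (Fin d))}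
    (hS : MeasurableSet S) {R : ℝ} (hR : ∀ x ∈ S, ‖x‖ ≤ R) :
    radialMeasure (EuclideanSpace ℝ (Fin d)) (hypRadialDensity d) S ≤
      hypRadialDensity d R * volume S := by
  rw [radialMeasure, withDensity_apply _ hS, ← setLIntegral_const]
  refine setLIntegral_mono' hS fun x hx => ?_
  exact monotoneOn_hypRadialDensity d (norm_nonneg x) ((norm_nonneg x).trans (hR x hx)) (hR x hx)

end HyperbolicIsometry

/-! ### Regular hyperbolic simplices in centred coordinates -/

section HyperbolicSimplex

variable {d : ℕ} {c : EuclideanSpace ℝ (Fin d)}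

/-- Pairing the relation with `a j` gives `(∑ i, μ i) * q + μ j * (r ^ 2 - q) = 0`, so all `μ j`
coincide and the relation says that the points sum to zero. -/
theorem sum_eq_zero_of_inner_eq {E : Type*} [NormedAddCommGroup E] [InnerProductSpace ℝ E] {n : ℕ}
    (hn : 1 ≤ n) {a : Fin (n + 1) → E} (hinj : Function.Injective a) {r q : ℝ}
    (hr : ∀ i, ‖a i‖ = r) (hq : ∀ i j, i ≠ j → ⟪a i, a j⟫ = q) {μ : Fin (n + 1) → ℝ}
    (hμ : ∑ i, μ i ≠ 0) (ha : ∑ i, μ i • a i = 0) :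
    0 < r ∧ ∑ i, a i = 0 ∧ ∀ i j, i ≠ j → n * ⟪a i, a j⟫ = -r ^ 2 := by
  have hne : (0 : Fin (n + 1)) ≠ Fin.last n := by simp [Fin.ext_iff]; omega
  have hrq : r ^ 2 - q ≠ 0 := by
    intro h
    refine hne (hinj (sub_eq_zero.1 (norm_eq_zero.1 (pow_eq_zero_iff two_ne_zero |>.1 ?_))))
    rw [norm_sub_sq_real, hr, hr, hq _ _ hne]
    linarith
  have hr0 : 0 < r := by
    refine lt_of_le_of_ne (hr 0 ▸ norm_nonneg _) fun h => hne (hinj ?_)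
    rw [norm_eq_zero.1 ((hr 0).trans h.symm), norm_eq_zero.1 ((hr (Fin.last n)).trans h.symm)]
  have hinner : ∀ i j, ⟪a i, a j⟫ = q + if i = j then r ^ 2 - q else 0 := by
    intro i j
    split_ifs with h
    · rw [h, real_inner_self_eq_norm_sq, hr]
      ring
    · rw [hq i j h, add_zero]
  have h1 : ∀ j, (∑ i, μ i) * q + μ j * (r ^ 2 - q) = 0 := by
    intro j
    have h2 : ⟪∑ i, μ i • a i, a j⟫ = 0 := by rw [ha, inner_zero_left]
    simp only [sum_inner, inner_smul_left, hinner, conj_trivial, mul_add, Finset.sum_add_distrib,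
      mul_ite, mul_zero, Finset.sum_ite_eq', Finset.mem_univ, if_true, ← Finset.sum_mul] at h2
    exact h2
  set ν := μ 0 with hν
  have h3 : ∀ j, μ j = ν := fun j => mul_right_cancel₀ hrq (by linarith [h1 j, h1 0])
  have hν0 : ν ≠ 0 := by
    intro h
    exact hμ (Finset.sum_eq_zero fun i _ => (h3 i).trans h)
  have hsum : ∑ i, a i = 0 := by
    simp only [h3, ← Finset.smul_sum] at ha
    exact (smul_eq_zero.1 ha).resolve_left hν0
  refine ⟨hr0, hsum, fun i j hij => ?_⟩
  have h4 : ⟪∑ l, a l, a j⟫ = 0 := by rw [hsum, inner_zero_left]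
  simp only [sum_inner, hinner, Finset.sum_add_distrib, Finset.sum_ite_eq', Finset.mem_univ,
    if_true, Finset.sum_const, Finset.card_univ, Fintype.card_fin, nsmul_eq_mul] at h4
  push_cast at h4
  rw [hq i j hij]
  linarith

theorem norm_eq_of_hypDist_zero_eq {x y : EuclideanSpace ℝ (Fin d)} (hx : x ∈ kleinBall d)
    (hy : y ∈ kleinBall d) (h : hypDist 0 x = hypDist 0 y) : ‖x‖ = ‖y‖ := by
  have h0 : (0 : EuclideanSpace ℝ (Fin d)) ∈ kleinBall d := by simp [mem_kleinBall]
  have h1 := Real.strictMonoOn_arcosh.injOn (hypDist_ratio_pos h0 hx) (hypDist_ratio_pos h0 hy) h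
  simp only [inner_zero_left, sub_zero, norm_zero, ne_eq, OfNat.ofNat_ne_zero, not_false_eq_true,
      zero_pow, Real.sqrt_one, one_mul, one_div, inv_inj] at h1
  rw [Real.sqrt_inj (one_sub_norm_sq_pos (mem_kleinBall.1 hx)).le
    (one_sub_norm_sq_pos (mem_kleinBall.1 hy)).le] at h1
  rw [← sq_eq_sq₀ (norm_nonneg x) (norm_nonneg y)]
  linarith

theorem inner_eq_of_hypDist_eq {x y : EuclideanSpace ℝ (Fin d)} (hx : x ∈ kleinBall d) {r l : ℝ} (hxr : ‖x‖ = r) (hyr : ‖y‖ = r) (h : hypDist x y = l) :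
    ⟪x, y⟫ = 1 - Real.cosh l * (1 - r ^ 2) := by
  have h1 := one_sub_norm_sq_pos (mem_kleinBall.1 hx)
  have hge : 1 ≤ (1 - ⟪x, y⟫) / (√(1 - ‖x‖ ^ 2) * √(1 - ‖y‖ ^ 2)) := by
    rw [hxr, hyr, Real.mul_self_sqrt (by rw [← hxr]; exact h1.le), one_le_div (by rwa [← hxr])]
    have := real_inner_le_norm x y
    rw [hxr, hyr] at this
    linarith
  rw [← h, hypDist, Real.cosh_arcosh hge, hxr, hyr,
    Real.mul_self_sqrt (by rw [← hxr]; exact h1.le), div_mul_cancel₀ _ (by rw [← hxr]; exact h1.ne')]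
  ring

/-- Once `c` is moved to `0`, equal distances from the centre become equal norms and equal edges
become equal inner products. That `c` lies in the affine span becomes a linear relation whose
weights have sum `1 - ‖c‖ ^ 2`, which is not zero. -/
theorem IsHypRegularSimplex.kleinInvolution_points (hc : c ∈ kleinBall d) {n : ℕ} (hn : 1 ≤ n)
    {S : Affine.Simplex ℝ (EuclideanSpace ℝ (Fin d)) n} (hS : IsHypRegularSimplex c S) :
    ∃ r : ℝ, 0 < r ∧ r < 1 ∧ (∀ i, ‖kleinInvolution c (S.points i)‖ = r) ∧
      ∑ i, kleinInvolution c (S.points i) = 0 ∧ ∀ i j, i ≠ j →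
        n * ⟪kleinInvolution c (S.points i), kleinInvolution c (S.points j)⟫ = -r ^ 2 := by
  obtain ⟨hmem, ⟨l, hl⟩, hspan, ⟨b, hb⟩⟩ := hS
  have hc1 := mem_kleinBall.1 hc
  have hmem' := fun i => kleinInvolution_mem_kleinBall hc (hmem i)
  have hr : ∀ i, ‖kleinInvolution c (S.points i)‖ = ‖kleinInvolution c (S.points 0)‖ := fun i => by
    refine norm_eq_of_hypDist_zero_eq (hmem' i) (hmem' 0) ?_
    rw [← kleinInvolution_self hc1, hypDist_kleinInvolution hc hc (hmem i),
      hypDist_kleinInvolution hc hc (hmem 0), hb, hb]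
  set r := ‖kleinInvolution c (S.points 0)‖ with hrdef
  have hq : ∀ i j, i ≠ j → ⟪kleinInvolution c (S.points i), kleinInvolution c (S.points j)⟫ =
      1 - Real.cosh l * (1 - r ^ 2) := fun i j hij => by
    refine inner_eq_of_hypDist_eq (hmem' i) (hr i) (hr j) ?_
    rw [hypDist_kleinInvolution hc (hmem i) (hmem j), hl i j hij]
  have hinj : Function.Injective fun i => kleinInvolution c (S.points i) := fun i j hij =>
    S.independent.injective (injOn_kleinInvolution hc1 (hmem i) (hmem j) hij)
  obtain ⟨w, hw, hcw⟩ := eq_affineCombination_of_mem_affineSpan_of_fintype hspan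
  rw [Finset.affineCombination_eq_linear_combination _ _ _ hw] at hcw
  have h1 : ∑ i, w i * (1 - ⟪c, S.points i⟫) = 1 - ‖c‖ ^ 2 := by
    simp only [mul_sub, Finset.sum_sub_distrib, mul_one, hw, ← inner_smul_right, ← inner_sum,
      ← hcw, real_inner_self_eq_norm_sq]
  have h2 : ∑ i, (w i * (1 - ⟪c, S.points i⟫)) • kleinInvolution c (S.points i) = 0 := by
    simp only [mul_smul, smul_kleinInvolution hc1 (mem_kleinBall.1 (hmem _)), smul_sub,
      Finset.sum_sub_distrib, ← Finset.sum_smul, hw, ← map_smul, ← map_sum, ← hcw,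
      kleinStretch_self hc1, one_smul, sub_self]
  obtain ⟨h3, h4, h5⟩ := sum_eq_zero_of_inner_eq hn hinj hr hq
    (by rw [h1]; exact (one_sub_norm_sq_pos hc1).ne') h2
  exact ⟨r, h3, mem_kleinBall.1 (hmem' 0), hr, h4, h5⟩

theorem hypDist_eq_of_inner {x y : EuclideanSpace ℝ (Fin d)} {r q : ℝ} (hx : ‖x‖ = r)
    (hy : ‖y‖ = r) (hq : ⟪x, y⟫ = q) :
    hypDist x y = Real.arcosh ((1 - q) / (√(1 - r ^ 2) * √(1 - r ^ 2))) := by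
  rw [hypDist, hx, hy, hq]

theorem zero_mem_convexHull_range {E : Type*} [AddCommGroup E] [Module ℝ E] {n : ℕ}
    {a : Fin (n + 1) → E} (ha : ∑ i, a i = 0) : 0 ∈ convexHull ℝ (Set.range a) := by
  have h := (convex_convexHull ℝ (Set.range a)).sum_mem (t := Finset.univ)
    (w := fun _ => ((n : ℝ) + 1)⁻¹) (z := a) (fun _ _ => by positivity)
    (by simp; field_simp) (fun i _ => subset_convexHull ℝ _ ⟨i, rfl⟩)
  rwa [← Finset.smul_sum, ha, smul_zero] at h

theorem exists_isHypRegularSimplex (hc : c ∈ kleinBall d) {k m : ℕ} (hk : 1 ≤ k)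
    {a : Fin (k + 1) → EuclideanSpace ℝ (Fin d)} {b : Fin (m + 1) → EuclideanSpace ℝ (Fin d)}
    {r s : ℝ} (h : IsOrthoFrame a b r s) (hr : r < 1) :
    ∃ S : Affine.Simplex ℝ (EuclideanSpace ℝ (Fin d)) k,
      S.points = (fun i => kleinInvolution c (a i)) ∧ IsHypRegularSimplex c S := by
  have hc1 := mem_kleinBall.1 hc
  have ha1 : ∀ i, ‖a i‖ < 1 := fun i => (h.norm_a i).trans_lt hr
  have ha : ∀ i, a i ∈ kleinBall d := fun i => mem_kleinBall.2 (ha1 i)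
  have h0 : (0 : EuclideanSpace ℝ (Fin d)) ∈ kleinBall d := by simp [mem_kleinBall]
  have hTa := fun i => kleinInvolution_mem_kleinBall hc (ha i)
  have hind : AffineIndependent ℝ fun i => kleinInvolution c (a i) := by
    have hi := h.affineIndependent_a hk
    rw [affineIndependent_iff_forall_sum] at hi ⊢
    intro w hw hwa i
    -- A dependency of the images becomes one of the `a i` after rescaling the weights by these
    -- positive factors.
    have h1 : ∀ i, (1 - ⟪c, kleinInvolution c (a i)⟫) • a i =
        c - kleinStretch c (kleinInvolution c (a i)) := fun i => by
      rw [← smul_kleinInvolution hc1 (mem_kleinBall.1 (hTa i)),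
        kleinInvolution_kleinInvolution hc1 (ha1 i)]
    have h2 := hi (fun i => w i * (1 - ⟪c, kleinInvolution c (a i)⟫)) ?_ ?_ i
    · exact (mul_eq_zero.1 h2).resolve_right
        (one_sub_inner_pos hc1 (mem_kleinBall.1 (hTa i))).ne'
    · simp only [mul_sub, Finset.sum_sub_distrib, mul_one, hw, ← inner_smul_right, ← inner_sum,
        hwa, inner_zero_right, sub_zero]
    · simp only [mul_smul, h1, smul_sub, Finset.sum_sub_distrib, ← Finset.sum_smul, hw, zero_smul,
        ← map_smul, ← map_sum, hwa, map_zero, sub_zero]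
  refine ⟨⟨_, hind⟩, rfl, hTa,
    ⟨Real.arcosh ((1 - (-r ^ 2 / k)) / (√(1 - r ^ 2) * √(1 - r ^ 2))), fun i j hij => ?_⟩, ?_,
    ⟨hypDist 0 (a 0), fun i => ?_⟩⟩
  · have hk0 : (k : ℝ) ≠ 0 := by positivity
    refine (hypDist_kleinInvolution hc (ha i) (ha j)).trans
      (hypDist_eq_of_inner (h.norm_a i) (h.norm_a j) ?_)
    rw [eq_div_iff hk0, mul_comm, h.inner_a i j hij]
  · refine convexHull_subset_affineSpan (𝕜 := ℝ) _ ?_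
    change c ∈ convexHull ℝ (Set.range (kleinInvolution c ∘ a))
    rw [Set.range_comp, ← image_kleinInvolution_convexHull hc1 (Set.range_subset_iff.2 ha)]
    exact ⟨0, zero_mem_convexHull_range h.sum_a, kleinInvolution_zero c⟩
  · have := hypDist_kleinInvolution hc h0 (ha i)
    rw [kleinInvolution_zero] at this
    refine this.trans ?_
    simp [hypDist, h.norm_a]

/-- Since the denominators are positive, orthogonality at `c` amounts to Euclidean orthogonality at
`0`. -/
theorem hypMetric_kleinInvolution_sub (hc : c ∈ kleinBall d) {x y : EuclideanSpace ℝ (Fin d)}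
    (hx : x ∈ kleinBall d) (hy : y ∈ kleinBall d) :
    hypMetric c (kleinInvolution c x - c) (kleinInvolution c y - c) =
      ⟪x, y⟫ / ((1 - ⟪c, x⟫) * (1 - ⟪c, y⟫)) := by
  rw [mem_kleinBall] at hc hx hy
  have h1 := one_sub_inner_pos hc hx
  have h2 := one_sub_inner_pos hc hy
  have h3 := one_sub_norm_sq_pos hc
  have key : ∀ x, ‖x‖ < 1 → kleinInvolution c x - c =
      (1 - ⟪c, x⟫)⁻¹ • (⟪c, x⟫ • c - kleinStretch c x) := fun x hx => by
    rw [← smul_kleinInvolution_sub hc hx, inv_smul_smul₀ (one_sub_inner_pos hc hx).ne']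
  rw [key x hx, key y hy, hypMetric]
  simp only [inner_smul_left, inner_smul_right, inner_sub_left, inner_sub_right,
    inner_kleinStretch hc, inner_kleinStretch_self hc, real_inner_comm c (kleinStretch c _),
    real_inner_self_eq_norm_sq, conj_trivial]
  field_simp
  ring

theorem hypMetric_add_left (c u u' v : EuclideanSpace ℝ (Fin d)) :
    hypMetric c (u + u') v = hypMetric c u v + hypMetric c u' v := by
  simp only [hypMetric, inner_add_left, inner_add_right]
  ring

theorem hypMetric_smul_left (c u v : EuclideanSpace ℝ (Fin d)) (t : ℝ) :
    hypMetric c (t • u) v = t * hypMetric c u v := by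
  simp only [hypMetric, inner_smul_left, inner_smul_right, conj_trivial]
  ring

theorem hypMetric_comm (c u v : EuclideanSpace ℝ (Fin d)) :
    hypMetric c u v = hypMetric c v u := by
  simp only [hypMetric, real_inner_comm u v]
  ring

theorem hypMetric_eq_zero_of_mem_vectorSpan {s : Set (EuclideanSpace ℝ (Fin d))}
    {u v : EuclideanSpace ℝ (Fin d)} (hs : ∀ x ∈ s, hypMetric c (x - c) v = 0)
    (hu : u ∈ vectorSpan ℝ s) : hypMetric c u v = 0 := by
  induction hu using Submodule.span_induction with
  | mem x hx =>
    obtain ⟨y, hy, z, hz, rfl⟩ := hx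
    have h : y - z = (y - c) + (-1 : ℝ) • (z - c) := by simp
    change hypMetric c (y - z) v = 0
    rw [h, hypMetric_add_left, hypMetric_smul_left, hs y hy, hs z hz]
    simp
  | zero => simp [hypMetric]
  | add x y _ _ hx hy => rw [hypMetric_add_left, hx, hy, add_zero]
  | smul t x _ hx => rw [hypMetric_smul_left, hx, mul_zero]

/-- In the coordinates given by `kleinInvolution c`, the members of the family of orthogonal
hyperbolic simplex hulls centred at `c` are the Euclidean ones centred at `0`. -/
theorem isHypOrthogonalSimplexHull_iff {k : ℕ} (hk : 1 ≤ k) (hkd : k + 1 ≤ d)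
    (hc : c ∈ kleinBall d) {Q : Set (EuclideanSpace ℝ (Fin d))} :
    IsHypOrthogonalSimplexHull c k Q ↔ ∃ (a : Fin (k + 1) → EuclideanSpace ℝ (Fin d))
      (b : Fin (d - k + 1) → EuclideanSpace ℝ (Fin d)) (r s : ℝ), IsOrthoFrame a b r s ∧
      r < 1 ∧ s < 1 ∧
      Q = kleinInvolution c '' convexHull ℝ (Set.range a ∪ Set.range b) := by
  have hc1 := mem_kleinBall.1 hc
  have hhull : ∀ (a : Fin (k + 1) → EuclideanSpace ℝ (Fin d))
      (b : Fin (d - k + 1) → EuclideanSpace ℝ (Fin d))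
      (S₁ : Affine.Simplex ℝ (EuclideanSpace ℝ (Fin d)) k)
      (S₂ : Affine.Simplex ℝ (EuclideanSpace ℝ (Fin d)) (d - k)),
      (∀ i, a i ∈ kleinBall d) → (∀ i, b i ∈ kleinBall d) →
      S₁.points = (fun i => kleinInvolution c (a i)) →
      S₂.points = (fun i => kleinInvolution c (b i)) →
      convexHull ℝ (S₁.closedInterior ∪ S₂.closedInterior) =
        kleinInvolution c '' convexHull ℝ (Set.range a ∪ Set.range b) := by
    intro a b S₁ S₂ ha hb h1 h2
    rw [← Affine.Simplex.convexHull_eq_closedInterior, ← Affine.Simplex.convexHull_eq_closedInterior,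
      convexHull_convexHull_union_left, convexHull_convexHull_union_right, h1, h2,
      image_kleinInvolution_convexHull hc1
        (Set.union_subset (Set.range_subset_iff.2 ha) (Set.range_subset_iff.2 hb)),
      Set.image_union, ← Set.range_comp, ← Set.range_comp]
    rfl
  have hm : 1 ≤ d - k := by omega
  constructor
  · rintro ⟨S₁, S₂, h₁, h₂, horth, rfl⟩
    obtain ⟨r, hr0, hr1, hn₁, hs₁, hi₁⟩ := h₁.kleinInvolution_points hc hk
    obtain ⟨s, hs0, hs1, hn₂, hs₂, hi₂⟩ := h₂.kleinInvolution_points hc hm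
    have hinv : ∀ {n : ℕ} (S : Affine.Simplex ℝ (EuclideanSpace ℝ (Fin d)) n),
        IsHypRegularSimplex c S → ∀ i, kleinInvolution c (kleinInvolution c (S.points i)) =
          S.points i := fun S hS i =>
      kleinInvolution_kleinInvolution hc1 (mem_kleinBall.1 (hS.1 i))
    have hmem₁ := fun i => kleinInvolution_mem_kleinBall hc (h₁.1 i)
    have hmem₂ := fun i => kleinInvolution_mem_kleinBall hc (h₂.1 i)
    refine ⟨fun i => kleinInvolution c (S₁.points i), fun i => kleinInvolution c (S₂.points i),
      r, s, ⟨hr0, hs0, hn₁, hn₂, hs₁, hs₂, hi₁, hi₂, fun i j => ?_⟩, hr1, hs1,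
      hhull _ _ S₁ S₂ hmem₁ hmem₂ (funext fun i => (hinv S₁ h₁ i).symm)
        (funext fun i => (hinv S₂ h₂ i).symm)⟩
    have h3 := hypMetric_kleinInvolution_sub hc (hmem₁ i) (hmem₂ j)
    have h4 := one_sub_inner_pos hc1 (mem_kleinBall.1 (hmem₁ i))
    have h5 := one_sub_inner_pos hc1 (mem_kleinBall.1 (hmem₂ j))
    have h6 := horth (S₁.points i - c)
      (AffineSubspace.vsub_mem_direction (mem_affineSpan ℝ ⟨i, rfl⟩) h₁.2.2.1) (S₂.points j - c)
      (AffineSubspace.vsub_mem_direction (mem_affineSpan ℝ ⟨j, rfl⟩) h₂.2.2.1)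
    rw [hinv S₁ h₁, hinv S₂ h₂, h6, eq_comm, div_eq_zero_iff] at h3
    exact h3.resolve_right (by positivity)
  · rintro ⟨a, b, r, s, h, hr, hs, rfl⟩
    obtain ⟨S₁, hp₁, h₁⟩ := exists_isHypRegularSimplex hc hk h hr
    obtain ⟨S₂, hp₂, h₂⟩ := exists_isHypRegularSimplex hc hm h.symm hs
    have ha : ∀ i, a i ∈ kleinBall d := fun i => mem_kleinBall.2 ((h.norm_a i).trans_lt hr)
    have hb : ∀ i, b i ∈ kleinBall d := fun i => mem_kleinBall.2 ((h.norm_b i).trans_lt hs)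
    refine ⟨S₁, S₂, h₁, h₂, fun u hu v hv => ?_, (hhull a b S₁ S₂ ha hb hp₁ hp₂).symm⟩
    rw [direction_affineSpan, hp₁] at hu
    rw [direction_affineSpan, hp₂] at hv
    refine hypMetric_eq_zero_of_mem_vectorSpan ?_ hu
    rintro _ ⟨i, rfl⟩
    rw [hypMetric_comm]
    refine hypMetric_eq_zero_of_mem_vectorSpan ?_ hv
    rintro _ ⟨j, rfl⟩
    rw [hypMetric_comm, hypMetric_kleinInvolution_sub hc (ha i) (hb j), h.inner_ab, zero_div]

end HyperbolicSimplex

/-! ### Hyperbolic polytopes and the dominating type -/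

section HyperbolicPolytopes

variable {d : ℕ} {c : EuclideanSpace ℝ (Fin d)}

theorem isCompact_convexHull_range_union {E : Type*} [NormedAddCommGroup E] [NormedSpace ℝ E]
    {ι κ : Type*} [Finite ι] [Finite κ] (a : ι → E) (b : κ → E) :
    IsCompact (convexHull ℝ (Set.range a ∪ Set.range b)) :=
  ((Set.finite_range a).union (Set.finite_range b)).isCompact_convexHull ℝ

theorem IsOrthoFrame.norm_le {E : Type*} [NormedAddCommGroup E] [InnerProductSpace ℝ E] {k m : ℕ}
    {a : Fin (k + 1) → E} {b : Fin (m + 1) → E} {r s R : ℝ} (h : IsOrthoFrame a b r s)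
    (hr : r ≤ R) (hs : s ≤ R) :
    convexHull ℝ (Set.range a ∪ Set.range b) ⊆ Metric.closedBall 0 R := by
  refine convexHull_min (Set.union_subset ?_ ?_) (convex_closedBall 0 R)
  · rintro _ ⟨i, rfl⟩
    simpa [h.norm_a] using hr
  · rintro _ ⟨i, rfl⟩
    simpa [h.norm_b] using hs

theorem IsOrthoFrame.convexHull_subset_kleinBall {k m : ℕ}
    {a : Fin (k + 1) → EuclideanSpace ℝ (Fin d)} {b : Fin (m + 1) → EuclideanSpace ℝ (Fin d)}
    {r s : ℝ} (h : IsOrthoFrame a b r s) (hr : r < 1) (hs : s < 1) :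
    convexHull ℝ (Set.range a ∪ Set.range b) ⊆ kleinBall d :=
  (h.norm_le (le_max_left r s) (le_max_right r s)).trans
    (Metric.closedBall_subset_ball (max_lt hr hs))

theorem IsOrthoFrame.hypVolume_image {k m : ℕ} (hc : c ∈ kleinBall d)
    {a : Fin (k + 1) → EuclideanSpace ℝ (Fin d)} {b : Fin (m + 1) → EuclideanSpace ℝ (Fin d)}
    {r s : ℝ} (h : IsOrthoFrame a b r s) (hr : r < 1) (hs : s < 1) :
    hypVolume d (kleinInvolution c '' convexHull ℝ (Set.range a ∪ Set.range b)) =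
      radialMeasure (EuclideanSpace ℝ (Fin d)) (hypRadialDensity d)
        (convexHull ℝ (Set.range a ∪ Set.range b)) := by
  have hm := (isCompact_convexHull_range_union a b).measurableSet
  rw [hypVolume_image_kleinInvolution hc hm (h.convexHull_subset_kleinBall hr hs),
    hypVolume_eq_radialMeasure hm (h.convexHull_subset_kleinBall hr hs)]

theorem hypClosedBall_subset_image_iff (hc : c ∈ kleinBall d) {r : ℝ} (hr : 0 ≤ r)
    {S : Set (EuclideanSpace ℝ (Fin d))} (hS : S ⊆ kleinBall d) :
    hypClosedBall c r ⊆ kleinInvolution c '' S ↔ Metric.closedBall 0 (Real.tanh r) ⊆ S := by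
  rw [← image_hypClosedBall hc hr]
  exact (injOn_kleinInvolution (mem_kleinBall.1 hc)).image_subset_image_iff
    (Metric.closedBall_subset_ball (Real.tanh_lt_one r)) hS

theorem tanh_pos_of_pos {r : ℝ} (hr : 0 < r) : 0 < Real.tanh r := by
  rw [Real.tanh_eq_sinh_div_cosh]
  exact div_pos (Real.sinh_pos_iff.2 hr) (Real.cosh_pos r)

theorem exists_isOrthoFrame_of_hyp_polytope (hd : 2 ≤ d) (hc : c ∈ kleinBall d) {ρ : ℝ}
    (hρ : 0 < ρ) {P : Set (EuclideanSpace ℝ (Fin d))} (hP : IsPolytopeWithAtMost (d + 2) P)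
    (hP1 : P ⊆ kleinBall d) (hball : hypClosedBall c ρ ⊆ P) :
    ∃ k : ℕ, 1 ≤ k ∧ 2 * k ≤ d ∧ ∃ (a : Fin (k + 1) → EuclideanSpace ℝ (Fin d))
      (b : Fin (d - k + 1) → EuclideanSpace ℝ (Fin d)) (r s : ℝ), IsOrthoFrame a b r s ∧
      r < 1 ∧ s < 1 ∧
      Metric.closedBall 0 (Real.tanh ρ) ⊆ convexHull ℝ (Set.range a ∪ Set.range b) ∧
      radialMeasure (EuclideanSpace ℝ (Fin d)) (hypRadialDensity d)
        (convexHull ℝ (Set.range a ∪ Set.range b)) ≤ hypVolume d P := by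
  classical
  have hc1 := mem_kleinBall.1 hc
  have hρ' := tanh_pos_of_pos hρ
  obtain ⟨t, ht, rfl⟩ := hP
  have himage : kleinInvolution c '' convexHull ℝ (t : Set _) =
      convexHull ℝ ((t.image (kleinInvolution c) : Finset _) : Set _) := by
    rw [Finset.coe_image, image_kleinInvolution_convexHull hc1
      ((subset_convexHull ℝ _).trans hP1)]
  have hsub := image_kleinInvolution_subset_ball hc1 hP1
  have hball' : Metric.closedBall 0 (Real.tanh ρ) ⊆
      kleinInvolution c '' convexHull ℝ (t : Set (EuclideanSpace ℝ (Fin d))) := by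
    rw [← hypClosedBall_subset_image_iff hc hρ.le hsub, image_kleinInvolution_image hc1 hP1]
    exact hball
  have hm : MeasurableSet (convexHull ℝ (t : Set (EuclideanSpace ℝ (Fin d)))) :=
    (t.finite_toSet.isCompact_convexHull ℝ).measurableSet
  rw [← hypVolume_image_kleinInvolution hc hm hP1]
  rw [himage] at hball' hsub ⊢
  have hcomp := (t.image (kleinInvolution c)).finite_toSet.isCompact_convexHull ℝ
  -- The farthest point of the compact polytope has norm below `1`; this norm bounds the circumradii
  -- after symmetrization.
  obtain ⟨x, hx, hmax⟩ := hcomp.exists_isMaxOn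
    ⟨0, hball' (Metric.mem_closedBall_self hρ'.le)⟩ continuous_norm.continuousOn
  obtain ⟨k, hk, hkd, a, b, r, s, h, hr, hs, hb, hle⟩ := exists_isOrthoFrame_of_polytope
    (monotoneOn_hypRadialDensity d) (measurable_hypRadialDensity d) hd finrank_euclideanSpace_fin
    (Finset.card_image_le.trans ht) hρ' hball' (R := ‖x‖) fun y hy => hmax hy
  have hx1 : ‖x‖ < 1 := mem_ball_zero_iff.1 (hsub hx)
  rw [← hypVolume_eq_radialMeasure hcomp.measurableSet hsub] at hle
  exact ⟨k, hk, hkd, a, b, r, s, h, hr.trans_lt hx1, hs.trans_lt hx1, hb, hle⟩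

/-- If every type failed, choose a counterexample for each and among these finitely many the one of
least volume. Symmetrizing it gives a hull of some type `j` no larger than the counterexample for
`j`, a contradiction. No minimiser needs to exist. -/
theorem exists_hyp_dominating_type (hd : 2 ≤ d) (hc : c ∈ kleinBall d) {ρ : ℝ} (hρ : 0 < ρ) :
    ∃ k : ℕ, 1 ≤ k ∧ 2 * k ≤ d ∧
      ∀ P : Set (EuclideanSpace ℝ (Fin d)), IsPolytopeWithAtMost (d + 2) P → P ⊆ kleinBall d →
        hypClosedBall c ρ ⊆ P → ∃ Q : Set (EuclideanSpace ℝ (Fin d)),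
          IsHypOrthogonalSimplexHull c k Q ∧ hypClosedBall c ρ ⊆ Q ∧
          hypVolume d Q ≤ hypVolume d P := by
  by_contra! hcon
  choose! P hP hP1 hPb hlt using hcon
  obtain ⟨k, hk, hmin⟩ := (Finset.Icc 1 (d / 2)).exists_min_image (fun k => hypVolume d (P k))
    ⟨1, Finset.mem_Icc.2 ⟨le_rfl, by omega⟩⟩
  rw [Finset.mem_Icc] at hk
  obtain ⟨j, hj, hjd, a, b, r, s, h, hr, hs, hb, hle⟩ := exists_isOrthoFrame_of_hyp_polytope hd hc
    hρ (hP k hk.1 (by omega)) (hP1 k hk.1 (by omega)) (hPb k hk.1 (by omega))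
  have h1 := hlt j hj hjd _
    ((isHypOrthogonalSimplexHull_iff hj (by omega) hc).2 ⟨a, b, r, s, h, hr, hs, rfl⟩)
    ((hypClosedBall_subset_image_iff hc hρ.le (h.convexHull_subset_kleinBall hr hs)).2 hb)
  rw [h.hypVolume_image hc hr hs] at h1
  exact absurd ((hmin j (Finset.mem_Icc.2 ⟨hj, by omega⟩)).trans_lt h1) (not_lt.2 hle)

end HyperbolicPolytopes

/-! ### Small hyperbolic balls by comparison with Euclidean volume -/

section SmallBalls

variable {d : ℕ} {ρ : ℝ}

/-- An upper bound for the factor by which the hyperbolic volume exceeds the Euclidean one for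
subsets of the ball of radius `ρ * d`. -/
noncomputable def volumeDistortion (d : ℕ) (ρ : ℝ) : ℝ :=
  (1 - (ρ * d) ^ 2) ^ (-(((d : ℝ) + 1) / 2))

/-- The radius `ρ` is so small that the Euclidean comparison of volumes decides. -/
structure IsSmallRadius (d : ℕ) (ρ : ℝ) : Prop where
  mul_le : ρ * d ≤ 1 / 2
  lt_optimalVolume : ∀ k < d / 2, 1 ≤ k →
    volumeDistortion d ρ * optimalVolume (d / 2) (d - d / 2) 1 < optimalVolume k (d - k) 1
  lt_half : volumeDistortion d ρ * optimalVolume (d / 2) (d - d / 2) 1 * ρ < 1 / 2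

/-- At `ρ = 0` the distortion is `1` and all the inequalities are strict, so continuity suffices. -/
theorem eventually_isSmallRadius (d : ℕ) : ∀ᶠ ρ in nhds (0 : ℝ), IsSmallRadius d ρ := by
  have h0 : ContinuousAt (volumeDistortion d) 0 := by
    unfold volumeDistortion
    refine ContinuousAt.rpow_const (by fun_prop) (Or.inl ?_)
    norm_num
  have h1 : volumeDistortion d 0 = 1 := by simp [volumeDistortion]
  have e1 : ∀ᶠ ρ : ℝ in nhds 0, ρ * (d : ℝ) < 1 / 2 := by
    refine ContinuousAt.eventually_lt (by fun_prop) continuousAt_const ?_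
    norm_num
  have e2 : ∀ᶠ ρ in nhds (0 : ℝ), ∀ k ∈ Finset.range (d / 2),
      volumeDistortion d ρ * optimalVolume (d / 2) (d - d / 2) 1 < optimalVolume k (d - k) 1 := by
    refine (Filter.eventually_all_finset _).2 fun k hk => ?_
    refine (h0.mul continuousAt_const).eventually_lt continuousAt_const ?_
    rw [Pi.mul_apply, h1, one_mul]
    exact optimalVolume_half_lt (Finset.mem_range.1 hk) one_pos
  have e3 : ∀ᶠ ρ in nhds (0 : ℝ),
      volumeDistortion d ρ * optimalVolume (d / 2) (d - d / 2) 1 * ρ < 1 / 2 := by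
    refine ((h0.mul continuousAt_const).mul continuousAt_id).eventually_lt continuousAt_const ?_
    norm_num
  filter_upwards [e1, e2, e3] with ρ h1 h2 h3
  exact ⟨h1.le, fun k hk _ => h2 k (Finset.mem_range.2 hk), h3⟩

theorem exists_pos_forall_isSmallRadius_tanh (d : ℕ) :
    ∃ ε : ℝ, 0 < ε ∧ ∀ r : ℝ, 0 < r → r ≤ ε → IsSmallRadius d (Real.tanh r) := by
  have h : Filter.Tendsto Real.tanh (nhds 0) (nhds 0) := by
    have h1 : Continuous fun x : ℝ => Real.sinh x / Real.cosh x :=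
      Real.continuous_sinh.div Real.continuous_cosh fun x => (Real.cosh_pos x).ne'
    simpa [← Real.tanh_eq_sinh_div_cosh] using h1.tendsto 0
  obtain ⟨ε, hε, h2⟩ := Metric.eventually_nhds_iff.1 (h.eventually (eventually_isSmallRadius d))
  refine ⟨ε / 2, by positivity, fun r hr hrε => h2 ?_⟩
  rw [Real.dist_eq, sub_zero, abs_of_pos hr]
  linarith

/-- A volume which is attained by a hull of simplices of the dimensions `d / 2` and `d - d / 2`,
but not by those of other dimensions. -/
noncomputable def separatingVolume (d : ℕ) (ρ : ℝ) : ENNReal :=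
  ENNReal.ofReal (volumeDistortion d ρ * optimalVolume (d / 2) (d - d / 2) 1 * ρ ^ d) *
    cornerVolume (EuclideanSpace ℝ (Fin d))

theorem IsSmallRadius.volumeDistortion_nonneg (h : IsSmallRadius d ρ) (hρ : 0 < ρ) :
    0 ≤ volumeDistortion d ρ := by
  have h1 := h.mul_le
  have h2 : 0 ≤ ρ * d := by positivity
  exact Real.rpow_nonneg (by nlinarith) _

theorem IsSmallRadius.exists_isOrthoFrame_le (hd : 2 ≤ d) (h : IsSmallRadius d ρ) (hρ : 0 < ρ) :
    ∃ (a : Fin (d / 2 + 1) → EuclideanSpace ℝ (Fin d))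
      (b : Fin (d - d / 2 + 1) → EuclideanSpace ℝ (Fin d)) (r s : ℝ), IsOrthoFrame a b r s ∧
      r ≤ 1 / 2 ∧ s ≤ 1 / 2 ∧
      Metric.closedBall 0 ρ ⊆ convexHull ℝ (Set.range a ∪ Set.range b) ∧
      radialMeasure (EuclideanSpace ℝ (Fin d)) (hypRadialDensity d)
        (convexHull ℝ (Set.range a ∪ Set.range b)) ≤ separatingVolume d ρ := by
  have hdd : d / 2 + (d - d / 2) = d := by omega
  obtain ⟨a, b, hab, hb, hv⟩ := exists_optimal_isOrthoFrame (E := EuclideanSpace ℝ (Fin d))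
    (k := d / 2) (m := d - d / 2) (by omega) (by omega)
    (hdd.trans finrank_euclideanSpace_fin.symm) hρ
  have hcast : ((d / 2 : ℕ) : ℝ) + ((d - d / 2 : ℕ) : ℝ) = d := by
    rw [← Nat.cast_add, hdd]
  -- The optimal radii are `ρ * √(n * d)` with `n ≤ d`, so the hull lies in the ball of radius `ρ *
  -- d`, where the density is at most `volumeDistortion d ρ`.
  have hbound : ∀ n : ℕ, n ≤ d →
      ρ * √(n * (((d / 2 : ℕ) : ℝ) + ((d - d / 2 : ℕ) : ℝ))) ≤ ρ * d := fun n hn => by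
    rw [hcast]
    have : (n : ℝ) ≤ d := by exact_mod_cast hn
    gcongr
    refine Real.sqrt_le_iff.2 ⟨by positivity, ?_⟩
    nlinarith
  have h1 := hbound (d / 2) (by omega)
  have h2 := hbound (d - d / 2) (by omega)
  refine ⟨a, b, _, _, hab, h1.trans h.mul_le, h2.trans h.mul_le, hb, ?_⟩
  refine (radialMeasure_hypRadialDensity_le (isCompact_convexHull_range_union a b).measurableSet
    (R := ρ * d) fun x hx => mem_closedBall_zero_iff.1 (hab.norm_le h1 h2 hx)).trans ?_
  have hlt : ρ * d < 1 := h.mul_le.trans_lt (by norm_num)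
  rw [hv, separatingVolume, hypRadialDensity, if_pos hlt, ← mul_assoc, ← volumeDistortion,
    ← ENNReal.ofReal_mul (h.volumeDistortion_nonneg hρ), optimalVolume_eq_mul hρ.le, hdd,
    ← mul_assoc]

/-- The hyperbolic density is at least `1`, so the Euclidean optimum for type `k` is already a lower
bound. -/
theorem IsSmallRadius.separatingVolume_lt (h : IsSmallRadius d ρ) (hρ : 0 < ρ) {k : ℕ}
    (hk : 1 ≤ k) (hkd : k < d / 2) {a : Fin (k + 1) → EuclideanSpace ℝ (Fin d)}
    {b : Fin (d - k + 1) → EuclideanSpace ℝ (Fin d)} {r s : ℝ} (hab : IsOrthoFrame a b r s)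
    (hball : Metric.closedBall 0 ρ ⊆ convexHull ℝ (Set.range a ∪ Set.range b)) :
    separatingVolume d ρ < radialMeasure (EuclideanSpace ℝ (Fin d)) (hypRadialDensity d)
      (convexHull ℝ (Set.range a ∪ Set.range b)) := by
  refine lt_of_lt_of_le ?_ ((hab.optimalVolume_mul_le_volume hk (by omega)
    (by rw [finrank_euclideanSpace_fin]; omega) hρ hball).trans
    (volume_le_radialMeasure_hypRadialDensity (isCompact_convexHull_range_union a b).measurableSet))
  rw [separatingVolume, ENNReal.mul_lt_mul_iff_left cornerVolume_ne_zero cornerVolume_ne_top,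
    ENNReal.ofReal_lt_ofReal_iff (optimalVolume_pos hk hρ), optimalVolume_eq_mul hρ.le,
    show k + (d - k) = d by omega]
  exact mul_lt_mul_of_pos_right (h.lt_optimalVolume k hkd hk) (by positivity)

theorem IsSmallRadius.separatingVolume_lt_of_large_radius (hd : 2 ≤ d) (h : IsSmallRadius d ρ)
    (hρ : 0 < ρ) {a : Fin (d / 2 + 1) → EuclideanSpace ℝ (Fin d)}
    {b : Fin (d - d / 2 + 1) → EuclideanSpace ℝ (Fin d)} {r s : ℝ} (hab : IsOrthoFrame a b r s)
    (hball : Metric.closedBall 0 ρ ⊆ convexHull ℝ (Set.range a ∪ Set.range b))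
    (hlarge : 1 / 2 ≤ r ∨ 1 / 2 ≤ s) :
    separatingVolume d ρ < radialMeasure (EuclideanSpace ℝ (Fin d)) (hypRadialDensity d)
      (convexHull ℝ (Set.range a ∪ Set.range b)) := by
  have hk : 1 ≤ d / 2 := by omega
  have hm : 1 ≤ d - d / 2 := by omega
  have hdd : d / 2 + (d - d / 2) = d := by omega
  have h1 := frameVolume_ge_of_large_radius hk hm hab.r_pos hab.t_pos hρ
    (hab.radius_bound hk hm hρ hball) hlarge
  refine lt_of_lt_of_le ?_
    (volume_le_radialMeasure_hypRadialDensity (isCompact_convexHull_range_union a b).measurableSet)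
  rw [hab.volume_eq hk hm (hdd.trans finrank_euclideanSpace_fin.symm), separatingVolume,
    ENNReal.mul_lt_mul_iff_left cornerVolume_ne_zero cornerVolume_ne_top]
  rw [hdd] at h1
  have h2 : volumeDistortion d ρ * optimalVolume (d / 2) (d - d / 2) 1 * ρ ^ d <
      1 / 2 * ρ ^ (d - 1) := by
    have h3 : ρ ^ d = ρ * ρ ^ (d - 1) := by rw [← pow_succ']; congr 1; omega
    rw [h3, ← mul_assoc]
    exact mul_lt_mul_of_pos_right h.lt_half (by positivity)
  exact (ENNReal.ofReal_lt_ofReal_iff (lt_of_lt_of_le (by positivity) h1)).2 (h2.trans_le h1)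

theorem IsOrthoFrame.isRadonDependency {E : Type*} [NormedAddCommGroup E] [InnerProductSpace ℝ E]
    {k m : ℕ} {a : Fin (k + 1) → E} {b : Fin (m + 1) → E} {r s : ℝ} (h : IsOrthoFrame a b r s) :
    IsRadonDependency (radonSign k m) (Sum.elim a b)
      (Sum.elim (fun _ => (2 * ((k : ℝ) + 1))⁻¹) fun _ => -(2 * ((m : ℝ) + 1))⁻¹) := by
  have hk : (k : ℝ) + 1 ≠ 0 := by positivity
  have hm : (m : ℝ) + 1 ≠ 0 := by positivity
  constructor
  · rintro (i | i) <;> simp [radonSign] <;> positivity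
  · simp [radonSign]
    field_simp
    norm_num
  · simp
    field_simp
    ring
  · simp [← Finset.smul_sum, h.sum_a, h.sum_b]

/-- Among the hulls of simplices of dimensions `d / 2` and `d - d / 2` with radii at most `1 / 2`
there is one of least hyperbolic volume. -/
theorem IsSmallRadius.exists_isOrthoFrame_minimal (hd : 2 ≤ d) (h : IsSmallRadius d ρ)
    (hρ : 0 < ρ) :
    ∃ (a : Fin (d / 2 + 1) → EuclideanSpace ℝ (Fin d))
      (b : Fin (d - d / 2 + 1) → EuclideanSpace ℝ (Fin d)) (r s : ℝ), IsOrthoFrame a b r s ∧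
      r ≤ 1 / 2 ∧ s ≤ 1 / 2 ∧
      Metric.closedBall 0 ρ ⊆ convexHull ℝ (Set.range a ∪ Set.range b) ∧
      ∀ (a' : Fin (d / 2 + 1) → EuclideanSpace ℝ (Fin d))
        (b' : Fin (d - d / 2 + 1) → EuclideanSpace ℝ (Fin d)) (r' s' : ℝ),
        IsOrthoFrame a' b' r' s' → r' ≤ 1 / 2 → s' ≤ 1 / 2 →
        Metric.closedBall 0 ρ ⊆ convexHull ℝ (Set.range a' ∪ Set.range b') →
        radialMeasure (EuclideanSpace ℝ (Fin d)) (hypRadialDensity d)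
          (convexHull ℝ (Set.range a ∪ Set.range b)) ≤
        radialMeasure (EuclideanSpace ℝ (Fin d)) (hypRadialDensity d)
          (convexHull ℝ (Set.range a' ∪ Set.range b')) := by
  have hcomp := isCompact_setOf_configurations (E := EuclideanSpace ℝ (Fin d))
    (radonSign_eq (d / 2) (d - d / 2)) (1 / 2) ρ
  have hmem : ∀ {a : Fin (d / 2 + 1) → EuclideanSpace ℝ (Fin d)}
      {b : Fin (d - d / 2 + 1) → EuclideanSpace ℝ (Fin d)} {r s : ℝ} (hab : IsOrthoFrame a b r s),
      r ≤ 1 / 2 → s ≤ 1 / 2 →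
      Metric.closedBall 0 ρ ⊆ convexHull ℝ (Set.range a ∪ Set.range b) →
      (∀ i, ‖Sum.elim a b i‖ ≤ 1 / 2) ∧ IsRadonDependency (radonSign (d / 2) (d - d / 2))
        (Sum.elim a b) (Sum.elim (fun _ => (2 * (((d / 2 : ℕ) : ℝ) + 1))⁻¹)
          fun _ => -(2 * (((d - d / 2 : ℕ) : ℝ) + 1))⁻¹) ∧
        Metric.closedBall 0 ρ ⊆ convexHull ℝ (Set.range (Sum.elim a b)) := by
    intro a b r s hab hr hs hb
    refine ⟨?_, hab.isRadonDependency, by rwa [Set.Sum.elim_range]⟩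
    rintro (i | i)
    · simpa [hab.norm_a] using hr
    · simpa [hab.norm_b] using hs
  obtain ⟨a₀, b₀, r₀, s₀, h₀, hr₀, hs₀, hb₀, -⟩ := h.exists_isOrthoFrame_le hd hρ
  have hlsc : LowerSemicontinuous
      fun x : (Fin (d / 2 + 1) ⊕ Fin (d - d / 2 + 1) → EuclideanSpace ℝ (Fin d)) ×
          (Fin (d / 2 + 1) ⊕ Fin (d - d / 2 + 1) → ℝ) =>
        radialMeasure (EuclideanSpace ℝ (Fin d)) (hypRadialDensity d)
          (convexHull ℝ (Set.range x.1)) :=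
    LowerSemicontinuous.comp (f := fun v : Fin (d / 2 + 1) ⊕ Fin (d - d / 2 + 1) → _ =>
      radialMeasure (EuclideanSpace ℝ (Fin d)) (hypRadialDensity d) (convexHull ℝ (Set.range v)))
      (lowerSemicontinuous_radialMeasure_convexHull (hypRadialDensity d)) continuous_fst
  -- The minimum is taken over all configurations with this Radon pattern, a compact set, and
  -- symmetrization then turns the minimiser into an orthogonal pair.
  obtain ⟨x, ⟨hx1, hx2, hx3⟩, hmin⟩ := LowerSemicontinuousOn.exists_isMinOn
    ⟨(_, _), hmem h₀ hr₀ hs₀ hb₀⟩ hcomp (hlsc.lowerSemicontinuousOn _)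
  rw [isMinOn_iff] at hmin
  obtain ⟨a, b, r, s, hab, hr, hs, hb, hle⟩ := exists_isOrthoFrame_radialMeasure_le
    (monotoneOn_hypRadialDensity d) (measurable_hypRadialDensity d) (k := d / 2) (m := d - d / 2)
    (by omega) (by omega) (by rw [finrank_euclideanSpace_fin]; omega) hρ hx1 hx2 hx3
  refine ⟨a, b, r, s, hab, hr, hs, hb, fun a' b' r' s' hab' hr' hs' hb' => hle.trans ?_⟩
  rw [← Set.Sum.elim_range]
  exact hmin (Sum.elim a' b', _) (hmem hab' hr' hs' hb')

/-- The volume `separatingVolume` is not exceeded by some hull of type `d / 2`, while it lies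
strictly below every hull of smaller type and every hull of type `d / 2` with a circumradius of at
least `1 / 2`. What remains is a compact family. -/
theorem IsSmallRadius.hyp_minimizers (hd : 2 ≤ d) {c : EuclideanSpace ℝ (Fin d)}
    (hc : c ∈ kleinBall d) (hρ : 0 < ρ) (h : IsSmallRadius d (Real.tanh ρ)) :
    (∃ k Q, IsHypMinimizer c ρ k Q) ∧ ∀ k Q, IsHypMinimizer c ρ k Q → k = d / 2 := by
  have hρ' := tanh_pos_of_pos hρ
  have hhalf : ∀ {x : ℝ}, x ≤ 1 / 2 → x < 1 := fun hx => hx.trans_lt (by norm_num)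
  constructor
  · obtain ⟨a, b, r, s, hab, hr, hs, hb, hmin⟩ := h.exists_isOrthoFrame_minimal hd hρ'
    obtain ⟨a₀, b₀, r₀, s₀, h₀, hr₀, hs₀, hb₀, hv₀⟩ := h.exists_isOrthoFrame_le hd hρ'
    refine ⟨d / 2, _, by omega, by omega, (isHypOrthogonalSimplexHull_iff (by omega) (by omega)
      hc).2 ⟨a, b, r, s, hab, hhalf hr, hhalf hs, rfl⟩, (hypClosedBall_subset_image_iff hc hρ.le
      (hab.convexHull_subset_kleinBall (hhalf hr) (hhalf hs))).2 hb, fun P hP hP1 hPb => ?_⟩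
    rw [hab.hypVolume_image hc (hhalf hr) (hhalf hs)]
    obtain ⟨k, hk, hkd, a', b', r', s', hab', -, -, hb', hle⟩ :=
      exists_isOrthoFrame_of_hyp_polytope hd hc hρ hP hP1 hPb
    refine le_trans ?_ hle
    have hsep := (hmin _ _ _ _ h₀ hr₀ hs₀ hb₀).trans hv₀
    rcases (show k ≤ d / 2 by omega).lt_or_eq with hlt | rfl
    · exact hsep.trans (h.separatingVolume_lt hρ' hk hlt hab' hb').le
    · rcases le_or_gt r' (1 / 2) with h1 | h1
      · rcases le_or_gt s' (1 / 2) with h2 | h2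
        · exact hmin _ _ _ _ hab' h1 h2 hb'
        · exact hsep.trans
            (h.separatingVolume_lt_of_large_radius hd hρ' hab' hb' (Or.inr h2.le)).le
      · exact hsep.trans
          (h.separatingVolume_lt_of_large_radius hd hρ' hab' hb' (Or.inl h1.le)).le
  · rintro k Q ⟨hk, hkd, hQ, hQb, hmin⟩
    obtain ⟨a', b', r', s', hab', hr', hs', rfl⟩ :=
      (isHypOrthogonalSimplexHull_iff hk (by omega) hc).1 hQ
    rw [hypClosedBall_subset_image_iff hc hρ.le (hab'.convexHull_subset_kleinBall hr' hs')] at hQb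
    obtain ⟨a₀, b₀, r₀, s₀, h₀, hr₀, hs₀, hb₀, hv₀⟩ := h.exists_isOrthoFrame_le hd hρ'
    have hsub := h₀.convexHull_subset_kleinBall (hhalf hr₀) (hhalf hs₀)
    have hP : IsPolytopeWithAtMost (d + 2)
        (kleinInvolution c '' convexHull ℝ (Set.range a₀ ∪ Set.range b₀)) := by
      classical
      refine ⟨Finset.univ.image (kleinInvolution c ∘ Sum.elim a₀ b₀), ?_, ?_⟩
      · refine Finset.card_image_le.trans ?_
        simp
        omega
      · rw [image_kleinInvolution_convexHull (mem_kleinBall.1 hc)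
          ((subset_convexHull ℝ _).trans hsub), Finset.coe_image, Finset.coe_univ, Set.image_univ,
          Set.range_comp, Set.Sum.elim_range]
    have h1 := hmin _ hP (image_kleinInvolution_subset_ball (mem_kleinBall.1 hc) hsub)
      ((hypClosedBall_subset_image_iff hc hρ.le hsub).2 hb₀)
    rw [hab'.hypVolume_image hc hr' hs', h₀.hypVolume_image hc (hhalf hr₀) (hhalf hs₀)] at h1
    by_contra hne
    exact absurd (h.separatingVolume_lt hρ' hk (by omega) hab' hQb) (not_lt.2 (h1.trans hv₀))

end SmallBalls

/-! ### The main theorem -/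

theorem mainTheorem2 (d : ℕ) (hd : 2 ≤ d) :
    -- Euclidean space, balls of every radius
    (∀ (c : EuclideanSpace ℝ (Fin d)) (r : ℝ), 0 < r →
      (∃ k Q, IsEuclideanMinimizer c r k Q) ∧
      ∀ k Q, IsEuclideanMinimizer c r k Q → k = d / 2 ∨ (d = 4 ∧ k = 1)) ∧
    -- hyperbolic space, balls of every radius
    (∀ c ∈ kleinBall d, ∀ r : ℝ, 0 < r →
      ∃ k : ℕ, 1 ≤ k ∧ 2 * k ≤ d ∧
        ∀ P : Set (EuclideanSpace ℝ (Fin d)), IsPolytopeWithAtMost (d + 2) P → P ⊆ kleinBall d →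
          hypClosedBall c r ⊆ P →
          ∃ Q : Set (EuclideanSpace ℝ (Fin d)), IsHypOrthogonalSimplexHull c k Q ∧
            hypClosedBall c r ⊆ Q ∧ hypVolume d Q ≤ hypVolume d P) ∧
    -- hyperbolic space, small balls
    (∃ ε : ℝ, 0 < ε ∧ ∀ c ∈ kleinBall d, ∀ r : ℝ, 0 < r → r ≤ ε →
      (∃ k Q, IsHypMinimizer c r k Q) ∧
      ∀ k Q, IsHypMinimizer c r k Q → k = d / 2 ∨ (d = 4 ∧ k = 1)) := by
  refine ⟨fun c r hr => ?_, fun c hc r hr => exists_hyp_dominating_type hd hc hr, ?_⟩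
  · obtain ⟨h1, h2⟩ := euclidean_minimizers hd c hr
    exact ⟨h1, fun k Q hQ => Or.inl (h2 k Q hQ)⟩
  · obtain ⟨ε, hε, h⟩ := exists_pos_forall_isSmallRadius_tanh d
    refine ⟨ε, hε, fun c hc r hr hrε => ?_⟩
    obtain ⟨h1, h2⟩ := (h r hr hrε).hyp_minimizers hd hc hr
    exact ⟨h1, fun k Q hQ => Or.inl (h2 k Q hQ)⟩
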